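/- **Hierarchically ordered instances.** A hierarchically ordered instance $\mathcal I=(V,L,\mathcal H,D,\prec,c,k)$ consists of a finite vertex set $V$ with $n=|V|$; costs $c:V\times V\to\mathbb R_{\ge 0}$ satisfying the triangle inequality; a hop-distance $k\in\mathbb Z_{\ge 0}$ with $k<n$; a depth $L\ge 1$; partitions $\mathcal H_1,\dots,\mathcal H_L$ of $V$ such that $\mathcal H_1=\{V\}$, $\mathcal H_L$ is the partition into singletons and every set of $\mathcal H_\ell$ ($1<\ell\le L$) is contained in a set of $\mathcal H_{\ell-1}$; a total order $\prec$ on $V$ such that every $H\in\mathcal H_\ell$ is a set of consecutive vertices; and nonnegative integers $D_1,\dots,D_L$ with $D_\ell\ge 2D_{\ell+1}$ for $1\le\ell<L$. For vertices $x,y$ let $\mathrm{level}(x,y)$ be the largest $\ell\in\{1,\dots,L\}$ such that $x,y$ lie in the same set of $\mathcal H_\ell$. It is required that $c(x,y)\le D_{\mathrm{level}(x,y)}$ if $x\prec y$ and $c(x,y)=D_{\mathrm{level}(x,y)}$ if $y\prec x$. For a constant $\gamma>0$, the instance has *low depth* if $L\le\gamma\log_2 n$. **Path Covering.** A *monotone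 path* $P$ visits a nonempty sequence of vertices $v_1\prec v_2\prec\dots\prec v_r$; $V(P)$ is the set of these vertices, and $c^{(k)}(P)=\sum_{\Delta=1}^{k}\sum_{i=1}^{r}c(v_i,v_{i+\Delta})$, where terms with $i+\Delta>r$ are $0$. A *path-level pair* is a pair $(P,\ell)$ with $\ell\in\{1,\dots,L\}$ and $P$ a monotone path such that $V(P)\subseteq H$ for some $H\in\mathcal H_\ell$. A *solution* is a finite set $\mathcal P$ of path-level pairs such that (a) every $v\in V$ lies in $V(P)$ for some $(P,\ell)\in\mathcal P$; and (b) for all $\ell\in\{2,\dots,L\}$ and $H\in\mathcal H_\ell$, either for every $v\in H$ there is $(P,j)\in\mathcal P$ with $j<\ell$ and $v\in V(P)$, or there is $(P,j)\in\mathcal P$ with $j<\ell$ and $|V(P)\cap H|\ge k$. Its weight is $w(\mathcal P)=\sum_{(P,\ell)\in\mathcal P}\bigl(c^{(k)}(P)+k^2D_\ell\bigr)$, and $\mathrm{OPT}(\mathcal I)$ is the minimum weight of a solution. **Running time** is the number of elementary steps: handling numbers (adding, subtracting or comparing two of them), handling lists (building or taking apart a pair), and branching each cost one step. A program contains no constants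 except $0$ and $1$; the instance is given by the list of $n$, $L$, $k$, the tables of $\prec$ and of the partitions, the numbers $D_\ell$ and the table of $c$. **Theorem.** For every constant $\gamma>0$ there are a program and a constant $C>0$ such that, for every hierarchically ordered instance $\mathcal I$ with $n$ vertices and low depth (i.e. $L\le\gamma\log_2 n$), the program computes in time at most $n^{C\log_2 n}$ a solution $\mathcal P$ of Path Covering with $$w(\mathcal P)\ \le\ C\cdot(\log_2 n)^2\cdot\mathrm{OPT}(\mathcal I).$$ -/

import Mathlib

noncomputable section

/-! ### The covering problem -/

/-- A hierarchically ordered instance `(V, L, 𝓗, D, ≺, c, k)` of Hop-ATSP on the finite vertex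
set `V`.  Levels are the natural numbers `1, …, L`; the values of `𝓗` and `D` at other indices
play no role. -/
structure HierInstance (V : Type*) [Fintype V] [DecidableEq V] where
  /-- the depth -/
  L : ℕ
  /-- the partition of `V` at each level -/
  𝓗 : ℕ → Finpartition (Finset.univ : Finset V)
  /-- the maximum edge cost of each level -/
  D : ℕ → ℤ
  /-- the total order `≺` on the vertices -/
  lt : V → V → Prop
  /-- the edge costs -/
  c : V → V → ℝ
  /-- the hop-distance -/
  k : ℕ
  c_nonneg : ∀ x y, 0 ≤ c x y
  c_triangle : ∀ x y z, c x z ≤ c x y + c y z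
  k_lt : k < Fintype.card V
  one_le_L : 1 ≤ L
  first_trivial : (𝓗 1).parts = {Finset.univ}
  last_singletons : (𝓗 L).parts = Finset.univ.image (fun v : V => ({v} : Finset V))
  refines : ∀ ℓ, 1 < ℓ → ℓ ≤ L → ∀ H ∈ (𝓗 ℓ).parts, ∃ H' ∈ (𝓗 (ℓ - 1)).parts, H ⊆ H'
  D_nonneg : ∀ ℓ, 1 ≤ ℓ → ℓ ≤ L → 0 ≤ D ℓ
  D_halves : ∀ ℓ, 1 ≤ ℓ → ℓ < L → 2 * D (ℓ + 1) ≤ D ℓ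
  lt_total : IsStrictTotalOrder V lt
  /-- every part consists of vertices that are consecutive in the total order -/
  compatible : ∀ ℓ, 1 ≤ ℓ → ℓ ≤ L → ∀ H ∈ (𝓗 ℓ).parts,
    ∀ x ∈ H, ∀ z ∈ H, ∀ y, lt x y → lt y z → y ∈ H
  /-- the cost of an edge is at most (forward edges) or exactly (backward edges) `D` at the level
  of the edge, the largest `ℓ ≤ L` for which both endpoints lie in the same part of `𝓗 ℓ` -/
  cost_forward : ∀ x y, lt x y → ∀ ℓ,
    IsGreatest {j | 1 ≤ j ∧ j ≤ L ∧ ∃ H ∈ (𝓗 j).parts, x ∈ H ∧ y ∈ H} ℓ → c x y ≤ D ℓ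
  cost_backward : ∀ x y, lt y x → ∀ ℓ,
    IsGreatest {j | 1 ≤ j ∧ j ≤ L ∧ ∃ H ∈ (𝓗 j).parts, x ∈ H ∧ y ∈ H} ℓ → c x y = D ℓ

namespace HierInstance

variable {V : Type*} [Fintype V] [DecidableEq V] (I : HierInstance V)

/-- The instance has low depth (with respect to the constant `γ`): `L ≤ γ * log₂ n`. -/
def LowDepth (γ : ℝ) : Prop :=
  (I.L : ℝ) ≤ γ * Real.logb 2 (Fintype.card V)

/-- A monotone path, given by the nonempty list of the vertices that it visits in this order: all
its edges are forward edges.  (Its vertices are then automatically distinct.) -/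
def IsMonotonePath (P : List V) : Prop :=
  P ≠ [] ∧ P.IsChain I.lt

/-- A path-level pair `(P, ℓ)`: a monotone path inside one part of the partition at level `ℓ`. -/
def IsPathLevelPair (p : List V × ℕ) : Prop :=
  I.IsMonotonePath p.1 ∧ 1 ≤ p.2 ∧ p.2 ≤ I.L ∧ ∃ H ∈ (I.𝓗 p.2).parts, ∀ v ∈ p.1, v ∈ H

/-- The `k`-hop cost of the path that visits the vertices of the list `P` in this order;
pairs of positions reaching beyond the end of the path contribute zero. -/
def hopCost (P : List V) : ℝ :=
  ∑ Δ ∈ Finset.Icc 1 I.k, ∑ i ∈ Finset.range P.length,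
    if h : i + Δ < P.length then I.c (P[i]'(by omega)) (P[i + Δ]'h) else 0

/-- The weight `w(P, ℓ)` of a path-level pair. -/
def pairWeight (p : List V × ℕ) : ℝ :=
  I.hopCost p.1 + (I.k : ℝ) ^ 2 * (I.D p.2 : ℝ)

/-- The weight of a set of path-level pairs. -/
def weight (S : Finset (List V × ℕ)) : ℝ :=
  ∑ p ∈ S, I.pairWeight p

/-- Feasible solutions of the Path Covering problem. -/
def IsSolution (S : Finset (List V × ℕ)) : Prop :=
  (∀ p ∈ S, I.IsPathLevelPair p) ∧
  (∀ v : V, ∃ p ∈ S, v ∈ p.1) ∧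
  (∀ ℓ, 2 ≤ ℓ → ℓ ≤ I.L → ∀ H ∈ (I.𝓗 ℓ).parts,
    (∀ v ∈ H, ∃ p ∈ S, p.2 < ℓ ∧ v ∈ p.1) ∨
    (∃ p ∈ S, p.2 < ℓ ∧ I.k ≤ (p.1.toFinset ∩ H).card))

/-- The optimum value of the Path Covering problem. -/
def opt : ℝ :=
  sInf {w | ∃ S : Finset (List V × ℕ), I.IsSolution S ∧ I.weight S = w}

end HierInstance

/-! ### The machine model

A structured machine over the real numbers whose memory holds binary trees (lists) with real
numbers at the leaves, as in the language WHILE or in LISP.  One step builds a pair, takes a pair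
apart, adds, subtracts or compares two numbers, or branches.  A program contains no constants
other than `0` and `1`, there is no multiplication and no rounding, and whole trees cannot be
compared in one step.  Up to polynomial factors this is the running time on a random access
machine with unit-cost additions and comparisons of numbers. -/

/-- Data: a real number or a pair. -/
inductive Data : Type
  | num (x : ℝ) : Data
  | pair (a b : Data) : Data

/-- Elementary operations. -/
inductive PrimOp : Type
  | id | zero | one | fst | snd | isPair | add | sub | le

open Classical in
/-- The value of an elementary operation; it is `0` on arguments of the wrong form. -/
def PrimOp.eval : PrimOp → Data → Data
  | .id, a => a
  | .zero, _ => .num 0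
  | .one, _ => .num 1
  | .fst, .pair a _ => a
  | .snd, .pair _ b => b
  | .isPair, .pair _ _ => .num 1
  | .add, .pair (.num x) (.num y) => .num (x + y)
  | .sub, .pair (.num x) (.num y) => .num (x - y)
  | .le, .pair (.num x) (.num y) => .num (if x ≤ y then 1 else 0)
  | _, _ => .num 0

/-- Programs; each takes one datum as input and, if it halts, outputs one datum. -/
inductive Program : Type
  /-- an elementary operation -/
  | prim (o : PrimOp) : Program
  /-- run both programs on the input and pair the outputs -/
  | pair (f g : Program) : Program
  /-- first `f`, then `g` -/
  | seq (f g : Program) : Program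
  /-- run `t`; continue with `f` on the input if the output of `t` is not `0`, else with `g` -/
  | cond (t f g : Program) : Program
  /-- while the output of `t` on the current datum is not `0`, replace the datum by the output
  of `f` -/
  | loop (t f : Program) : Program

/-- `p.Runs x y t`: on input `x` the program `p` halts with output `y` after exactly `t` steps. -/
inductive Program.Runs : Program → Data → Data → ℕ → Prop
  | prim (o : PrimOp) (x : Data) : Program.Runs (.prim o) x (o.eval x) 1
  | pair {f g : Program} {x y z : Data} {s t : ℕ} :
      Program.Runs f x y s → Program.Runs g x z t →
      Program.Runs (.pair f g) x (.pair y z) (s + t + 1)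
  | seq {f g : Program} {x y z : Data} {s t : ℕ} :
      Program.Runs f x y s → Program.Runs g y z t → Program.Runs (.seq f g) x z (s + t + 1)
  | cond_true {b f g : Program} {x u y : Data} {s t : ℕ} :
      Program.Runs b x u s → u ≠ .num 0 → Program.Runs f x y t →
      Program.Runs (.cond b f g) x y (s + t + 1)
  | cond_false {b f g : Program} {x y : Data} {s t : ℕ} :
      Program.Runs b x (.num 0) s → Program.Runs g x y t →
      Program.Runs (.cond b f g) x y (s + t + 1)
  | loop_stop {b f : Program} {x : Data} {s : ℕ} :
      Program.Runs b x (.num 0) s → Program.Runs (.loop b f) x x (s + 1)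
  | loop_step {b f : Program} {x u y z : Data} {r s t : ℕ} :
      Program.Runs b x u r → u ≠ .num 0 → Program.Runs f x y s →
      Program.Runs (.loop b f) y z t → Program.Runs (.loop b f) x z (r + s + t + 1)

/-- Programs are deterministic: the input determines the output and the number of steps. -/
theorem Program.Runs.deterministic {p : Program} {x y : Data} {t : ℕ} (h : p.Runs x y t) :
    ∀ {y' : Data} {t' : ℕ}, p.Runs x y' t' → y = y' ∧ t = t' := by
  induction h with
  | prim o x => intro y' t' h'; cases h'; exact ⟨rfl, rfl⟩
  | pair _ _ ih1 ih2 =>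
    intro y' t' h'
    cases h' with
    | pair h1 h2 =>
      obtain ⟨rfl, rfl⟩ := ih1 h1
      obtain ⟨rfl, rfl⟩ := ih2 h2
      exact ⟨rfl, rfl⟩
  | seq _ _ ih1 ih2 =>
    intro y' t' h'
    cases h' with
    | seq h1 h2 =>
      obtain ⟨rfl, rfl⟩ := ih1 h1
      obtain ⟨rfl, rfl⟩ := ih2 h2
      exact ⟨rfl, rfl⟩
  | cond_true _ hu _ ih1 ih2 =>
    intro y' t' h'
    cases h' with
    | cond_true h1 _ h2 =>
      obtain ⟨rfl, rfl⟩ := ih1 h1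
      obtain ⟨rfl, rfl⟩ := ih2 h2
      exact ⟨rfl, rfl⟩
    | cond_false h1 _ => exact absurd (ih1 h1).1 hu
  | cond_false _ _ ih1 ih2 =>
    intro y' t' h'
    cases h' with
    | cond_true h1 hu _ => exact absurd (ih1 h1).1.symm hu
    | cond_false h1 h2 =>
      obtain ⟨-, rfl⟩ := ih1 h1
      obtain ⟨rfl, rfl⟩ := ih2 h2
      exact ⟨rfl, rfl⟩
  | loop_stop _ ih =>
    intro y' t' h'
    cases h' with
    | loop_stop h1 =>
      obtain ⟨-, rfl⟩ := ih h1
      exact ⟨rfl, rfl⟩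
    | loop_step h1 hu _ _ => exact absurd (ih h1).1.symm hu
  | loop_step _ hu _ _ ih1 ih2 ih3 =>
    intro y' t' h'
    cases h' with
    | loop_stop h1 => exact absurd (ih1 h1).1 hu
    | loop_step h1 _ h2 h3 =>
      obtain ⟨rfl, rfl⟩ := ih1 h1
      obtain ⟨rfl, rfl⟩ := ih2 h2
      obtain ⟨rfl, rfl⟩ := ih3 h3
      exact ⟨rfl, rfl⟩

/-! ### Input and output format -/

/-- A list as nested pairs, ended by the number `0`. -/
def Data.ofList : List Data → Data
  | [] => .num 0
  | a :: l => .pair a (Data.ofList l)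

/-- A natural number (for instance the name of a vertex, or a level). -/
def Data.ofNat (m : ℕ) : Data := .num (m : ℝ)

open Classical in
/-- A truth value. -/
def Data.ofProp (p : Prop) : Data := .num (if p then 1 else 0)

/-- A matrix, as the list of its rows. -/
def Data.ofMatrix {n : ℕ} (M : Fin n → Fin n → Data) : Data :=
  Data.ofList (List.ofFn fun i => Data.ofList (List.ofFn fun j => M i j))

/-- The input for an instance whose vertices are named `0, …, n - 1`: the list of `n`, `L`, `k`,
the table of the order `≺`, the list of the partitions of levels `1, …, L` (each as the table of
the relation of lying in the same part), the list `D 1, …, D L`, and the table of the costs. -/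
def HierInstance.encode {n : ℕ} (I : HierInstance (Fin n)) : Data :=
  Data.ofList
    [ Data.ofNat n,
      Data.ofNat I.L,
      Data.ofNat I.k,
      Data.ofMatrix fun x y => Data.ofProp (I.lt x y),
      Data.ofList ((List.range' 1 I.L).map fun ℓ =>
        Data.ofMatrix fun x y => Data.ofProp (∃ H ∈ (I.𝓗 ℓ).parts, x ∈ H ∧ y ∈ H)),
      Data.ofList ((List.range' 1 I.L).map fun ℓ => Data.num (I.D ℓ : ℝ)),
      Data.ofMatrix fun x y => Data.num (I.c x y) ]

/-- The output for a list of path-level pairs: each pair is given by the list of the names of the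
vertices on the path and by the level. -/
def encodePairs {n : ℕ} (l : List (List (Fin n) × ℕ)) : Data :=
  Data.ofList (l.map fun p =>
    Data.pair (Data.ofList (p.1.map fun v => Data.ofNat (v : ℕ))) (Data.ofNat p.2))

end

/-! Path Covering is a set cover problem. The ground set consists of the elements `(x, j)` with `1 ≤
j ≤ L`, and a pair `(P, ℓ)` covers `(x, j)` if `ℓ ≤ j` and `P` visits `x` or, for `j < L`, at least
`k` vertices of the part of `x` at level `j + 1`. Elements with `j < L` encode condition (b) at
level `j + 1`, those with `j = L` condition (a); see `IsSolution.exists_covers` and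
`isSolution_of_covers`. Greedy set cover loses a factor `harmonic (n * L)`, times the factor by
which each round misses the best ratio of weight to new coverage. It remains to find a nearly best
pair in time `n ^ O(log n)`.

A dynamic program builds the path vertex by vertex. It stores, for each level, the number of path
vertices in the part of the current vertex; parts are intervals of the order, so a monotone path
never returns to a part that it has left. An element is credited when its vertex is visited, and
again when the count of its part reaches exactly `k`. The total gain thus lies between the coverage
and twice the coverage (`countP_le_sum_gain`, `Increasing.sum_gain_le`).

The exact hop cost would require remembering the last `k` vertices. It is replaced by a hub cost. At
each of `O(log n)` scales `s` the positions are divided into blocks of length `2 ^ (s + 1)`; any two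
positions lie in different halves of a common block at some scale (`exists_separated`). The state
guesses one hub vertex per scale, and an edge is bounded by the detour through the hub. A position
has at most `2 ^ s` partners at scale `s`, so paying `2 ^ s` times the cost to or from the hub
bounds the hop cost from above, whatever the guesses are (`IsRun.hopCost_le`). Conversely, let the
hub be the vertex at the centre of the block and shift the path by a random offset. A given edge
ends or begins at a centre of scale `s` with probability at most `2 ^ (-s)`, which cancels the
weight; so some offset costs at most `2 * scales n` times the hop cost (`exists_offset`).

Together the ratio is `4 * scales n * harmonic (n * L)`, which is `O(log² n)` (`greedy_spec`,
`LowDepth.ratio_le`). A state is a vertex, a gain and `L + scales n` numbers up to `n`, so there are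
`n ^ O(log n)` states. For the running time, a program whose loops all make at most `N` iterations
takes time polynomial in `N`, with an exponent determined by the program alone (`Program.Ok`). For
`k = 0` all weights vanish, and the instance with `k = 1` is solved instead. -/

noncomputable section

/-! ### Encodings -/

/-- Types whose elements are represented by data. -/
class Enc (α : Type*) where
  /-- the representation -/
  enc : α → Data

open Enc (enc)

instance : Enc Data := ⟨id⟩
instance : Enc ℝ := ⟨Data.num⟩
instance : Enc ℕ := ⟨Data.ofNat⟩
instance : Enc Prop := ⟨Data.ofProp⟩
instance {n : ℕ} : Enc (Fin n) := ⟨fun i => Data.ofNat i⟩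
instance {α β : Type*} [Enc α] [Enc β] : Enc (α × β) := ⟨fun x => .pair (enc x.1) (enc x.2)⟩
instance {α : Type*} [Enc α] : Enc (List α) := ⟨fun l => Data.ofList (l.map enc)⟩

/-! ### Programs all of whose loops are short -/

namespace Program

/-- The exponent of a polynomial bound for the running time in terms of a bound for the number of
iterations of each loop. -/
def expo : Program → ℕ
  | .prim _ => 0
  | .pair f g => f.expo + g.expo + 2
  | .seq f g => f.expo + g.expo + 2
  | .cond b f g => b.expo + f.expo + g.expo + 2
  | .loop b f => b.expo + f.expo + 3

/-- On input `x` the program `p` outputs `y` in time polynomial in `N`, with an exponent that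
depends on `p` only. -/
def Ok (N : ℕ) (p : Program) (x y : Data) : Prop :=
  ∃ t ≤ (N + 2) ^ p.expo, p.Runs x y t

/-- The left side is at most `3 * M ^ a * M ^ b`, and `M ^ 2 ≥ 4`. This is why `expo` adds `2` at
each composition: it absorbs the sum of two running times and the extra step. -/
theorem pow_add_pow_lt {M a b : ℕ} (hM : 2 ≤ M) : M ^ a + M ^ b + 1 ≤ M ^ (a + b + 2) := by
  have ha : 1 ≤ M ^ a := Nat.one_le_pow _ _ (by omega)
  have hb : 1 ≤ M ^ b := Nat.one_le_pow _ _ (by omega)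
  have h : M ^ (a + b + 2) = M ^ a * M ^ b * M ^ 2 := by ring
  have h4 : 4 ≤ M ^ 2 := by nlinarith
  rw [h]
  nlinarith [Nat.mul_le_mul ha hb, Nat.mul_le_mul ha (le_refl (M ^ b)),
    Nat.mul_le_mul (le_refl (M ^ a)) hb,
    Nat.mul_le_mul (le_refl (M ^ a * M ^ b)) h4]

variable {N : ℕ} {x y z : Data} {p f g b l i : Program}

theorem Ok.prim (o : PrimOp) (x : Data) : Ok N (.prim o) x (o.eval x) :=
  ⟨1, by simp [expo], .prim o x⟩

theorem Ok.pair (hf : Ok N f x y) (hg : Ok N g x z) : Ok N (.pair f g) x (.pair y z) := by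
  obtain ⟨s, hs, h1⟩ := hf
  obtain ⟨t, ht, h2⟩ := hg
  exact ⟨_, le_trans (by omega) (pow_add_pow_lt (by omega)), .pair h1 h2⟩

theorem Ok.seq (hf : Ok N f x y) (hg : Ok N g y z) : Ok N (.seq f g) x z := by
  obtain ⟨s, hs, h1⟩ := hf
  obtain ⟨t, ht, h2⟩ := hg
  exact ⟨_, le_trans (by omega) (pow_add_pow_lt (by omega)), .seq h1 h2⟩

/-- Each branch is examined only under its own truth value of `q`, so that bounds guaranteed by the
test, such as an index being in range, are available there. -/
theorem Ok.ite {q : Prop} (hb : Ok N b x (enc q)) (hf : q → Ok N f x y)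
    (hg : ¬ q → Ok N g x y) : Ok N (.cond b f g) x y := by
  obtain ⟨s, hs, h1⟩ := hb
  by_cases hq : q
  · obtain ⟨t, ht, h2⟩ := hf hq
    refine ⟨s + t + 1, le_trans (le_trans ?_ (pow_add_pow_lt (M := N + 2) (a := b.expo)
      (b := f.expo + g.expo) (by omega))) (le_of_eq ?_),
      .cond_true h1 (by simp [enc, Data.ofProp, hq]) h2⟩
    · have : (N + 2) ^ f.expo ≤ (N + 2) ^ (f.expo + g.expo) :=
        Nat.pow_le_pow_right (by omega) (by omega)
      omega
    · simp only [expo]; ring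
  · obtain ⟨t, ht, h2⟩ := hg hq
    have h1' : b.Runs x (.num 0) s := by simpa [enc, Data.ofProp, hq] using h1
    refine ⟨s + t + 1, le_trans (le_trans ?_ (pow_add_pow_lt (M := N + 2) (a := b.expo)
      (b := f.expo + g.expo) (by omega))) (le_of_eq ?_), .cond_false h1' h2⟩
    · have : (N + 2) ^ g.expo ≤ (N + 2) ^ (f.expo + g.expo) :=
        Nat.pow_le_pow_right (by omega) (by omega)
      omega
    · simp only [expo]; ring

/-- A loop with `m ≤ N` iterations, which passes through the data `s 0, …, s m`. -/
theorem Ok.loop {m : ℕ} (hm : m ≤ N) (s : ℕ → Data)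
    (hb : ∀ j < m, ∃ u, u ≠ .num 0 ∧ Ok N b (s j) u) (hf : ∀ j < m, Ok N f (s j) (s (j + 1)))
    (hend : Ok N b (s m) (.num 0)) : Ok N (.loop b f) (s 0) (s m) := by
  set A := (N + 2) ^ b.expo with hA
  set B := (N + 2) ^ f.expo with hB
  -- Induction on the number `d` of iterations still to come, because `loop_step` peels off the
  -- first iteration.
  have key : ∀ d ≤ m, ∃ t ≤ d * (A + B + 1) + (A + 1),
      (Program.loop b f).Runs (s (m - d)) (s m) t := by
    intro d
    induction d with
    | zero =>
      intro _
      obtain ⟨t, ht, h⟩ := hend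
      exact ⟨t + 1, by omega, Program.Runs.loop_stop h⟩
    | succ d ih =>
      intro hd
      obtain ⟨t, ht, h⟩ := ih (by omega)
      obtain ⟨u, hu, r, hr, h1⟩ := hb (m - (d + 1)) (by omega)
      obtain ⟨q, hq, h2⟩ := hf (m - (d + 1)) (by omega)
      rw [show m - (d + 1) + 1 = m - d by omega] at h2
      refine ⟨r + q + t + 1, ?_, .loop_step h1 hu h2 h⟩
      rw [Nat.succ_mul]
      omega
  obtain ⟨t, ht, h⟩ := key m le_rfl
  rw [Nat.sub_self] at h
  refine ⟨t, ht.trans ?_, h⟩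
  have h3 : A + B + 1 ≤ (N + 2) ^ (b.expo + f.expo + 2) := pow_add_pow_lt (by omega)
  calc m * (A + B + 1) + (A + 1) ≤ N * (A + B + 1) + 1 * (A + B + 1) := by
        have := Nat.mul_le_mul_right (A + B + 1) hm
        omega
    _ = (N + 1) * (A + B + 1) := by ring
    _ ≤ (N + 2) * (N + 2) ^ (b.expo + f.expo + 2) := Nat.mul_le_mul (by omega) h3
    _ = (N + 2) ^ (Program.loop b f).expo := by simp only [expo]; ring

/-! ### Variables, numbers, truth values -/

/-- The value of the newest variable of the environment. -/
def var0 : Program := .prim .snd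

/-- Evaluate `p` in the environment without its newest variable. -/
def wk (p : Program) : Program := .seq (.prim .fst) p

/-- The value of the second newest variable of the environment. -/
def var1 : Program := wk var0

theorem ok_var0 : Ok N var0 (.pair x y) y := Ok.prim .snd _

theorem ok_wk (h : Ok N p x z) : Ok N (wk p) (.pair x y) z := Ok.seq (Ok.prim .fst _) h

theorem ok_var1 : Ok N var1 (.pair (.pair x y) z) y := ok_wk ok_var0

/-- The first component. -/
def fstP (p : Program) : Program := .seq p (.prim .fst)

/-- The second component. -/
def sndP (p : Program) : Program := .seq p (.prim .snd)

theorem ok_fst {α β : Type*} [Enc α] [Enc β] {a : α × β} (h : Ok N p x (enc a)) :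
    Ok N (fstP p) x (enc a.1) := h.seq (Ok.prim .fst _)

theorem ok_snd {α β : Type*} [Enc α] [Enc β] {a : α × β} (h : Ok N p x (enc a)) :
    Ok N (sndP p) x (enc a.2) := h.seq (Ok.prim .snd _)

theorem ok_pair {α β : Type*} [Enc α] [Enc β] {a : α} {c : β} (hf : Ok N f x (enc a))
    (hg : Ok N g x (enc c)) : Ok N (.pair f g) x (enc (a, c)) := hf.pair hg

/-- Evaluate `b` in the environment extended by the value of `p`. -/
def letP (p b : Program) : Program := .seq (.pair (.prim .id) p) b

theorem ok_let (hp : Ok N p x y) (hb : Ok N b (.pair x y) z) : Ok N (letP p b) x z :=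
  (Ok.pair (Ok.prim .id x) hp).seq hb

/-- The number `0`. -/
def zeroP : Program := .prim .zero

/-- The number `1`. -/
def oneP : Program := .prim .one

/-- Addition. -/
def addP (f g : Program) : Program := .seq (.pair f g) (.prim .add)

/-- Comparison. -/
def leP (f g : Program) : Program := .seq (.pair f g) (.prim .le)

theorem ok_zero : Ok N zeroP x (enc (0 : ℕ)) := by
  have := Ok.prim (N := N) .zero x
  simpa [zeroP, PrimOp.eval, enc, Data.ofNat] using this

theorem ok_zero_real : Ok N zeroP x (enc (0 : ℝ)) := Ok.prim .zero x

theorem ok_one : Ok N oneP x (enc (1 : ℕ)) := by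
  have := Ok.prim (N := N) .one x
  simpa [oneP, PrimOp.eval, enc, Data.ofNat] using this

theorem ok_true : Ok N oneP x (enc True) := by
  have := Ok.prim (N := N) .one x
  simpa [oneP, PrimOp.eval, enc, Data.ofProp] using this

theorem ok_false : Ok N zeroP x (enc False) := by
  have := Ok.prim (N := N) .zero x
  simpa [zeroP, PrimOp.eval, enc, Data.ofProp] using this

theorem ok_add_real {r s : ℝ} (hf : Ok N f x (enc r)) (hg : Ok N g x (enc s)) :
    Ok N (addP f g) x (enc (r + s)) := (hf.pair hg).seq (Ok.prim .add _)

theorem ok_add {r s : ℕ} (hf : Ok N f x (enc r)) (hg : Ok N g x (enc s)) :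
    Ok N (addP f g) x (enc (r + s)) := by
  have := (hf.pair hg).seq (Ok.prim .add _)
  simpa [addP, PrimOp.eval, enc, Data.ofNat] using this

theorem ok_le_real {r s : ℝ} (hf : Ok N f x (enc r)) (hg : Ok N g x (enc s)) :
    Ok N (leP f g) x (enc (r ≤ s)) := (hf.pair hg).seq (Ok.prim .le _)

theorem ok_le {r s : ℕ} (hf : Ok N f x (enc r)) (hg : Ok N g x (enc s)) :
    Ok N (leP f g) x (enc (r ≤ s)) := by
  have := (hf.pair hg).seq (Ok.prim .le _)
  rw [← Nat.cast_le (α := ℝ), leP]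
  exact this

/-- Strict comparison of integers. -/
def ltP (f g : Program) : Program := leP (addP f oneP) g

theorem ok_lt {r s : ℕ} (hf : Ok N f x (enc r)) (hg : Ok N g x (enc s)) :
    Ok N (ltP f g) x (enc (r < s)) := ok_le (ok_add hf ok_one) hg

/-- Conjunction; the second formula is evaluated only if the first one is true. -/
def andP (f g : Program) : Program := .cond f g zeroP

/-- Disjunction. -/
def orP (f g : Program) : Program := .cond f oneP g

/-- Negation. -/
def notP (f : Program) : Program := .cond f zeroP oneP

theorem ok_and {q r : Prop} (hf : Ok N f x (enc q)) (hg : q → Ok N g x (enc r)) :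
    Ok N (andP f g) x (enc (q ∧ r)) :=
  hf.ite (fun h => by simpa [h] using hg h) (fun h => by simpa [h] using ok_false)

theorem ok_or {q r : Prop} (hf : Ok N f x (enc q)) (hg : ¬ q → Ok N g x (enc r)) :
    Ok N (orP f g) x (enc (q ∨ r)) :=
  hf.ite (fun h => by simpa [h] using ok_true) (fun h => by simpa [h] using hg h)

theorem ok_not {q : Prop} (hf : Ok N f x (enc q)) : Ok N (notP f) x (enc (¬ q)) :=
  hf.ite (fun h => by simpa [h] using ok_false) (fun h => by simpa [h] using ok_true)

theorem ok_ite {α : Type*} [Enc α] {q : Prop} [Decidable q] {a c : α} (hb : Ok N b x (enc q))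
    (hf : q → Ok N f x (enc a)) (hg : ¬ q → Ok N g x (enc c)) :
    Ok N (.cond b f g) x (enc (if q then a else c)) :=
  hb.ite (fun h => by simpa [h] using hf h) (fun h => by simpa [h] using hg h)

/-- Equality of numbers. -/
def eqP (f g : Program) : Program := andP (leP f g) (leP g f)

theorem ok_eq {r s : ℕ} (hf : Ok N f x (enc r)) (hg : Ok N g x (enc s)) :
    Ok N (eqP f g) x (enc (r = s)) := by
  have := ok_and (ok_le hf hg) (fun _ => ok_le hg hf)
  rwa [← le_antisymm_iff] at this

theorem ok_eq_fin {n : ℕ} {r s : Fin n} (hf : Ok N f x (enc r)) (hg : Ok N g x (enc s)) :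
    Ok N (eqP f g) x (enc (r = s)) := by
  rw [Fin.ext_iff]
  exact ok_eq (r := (r : ℕ)) (s := (s : ℕ)) hf hg

/-! ### Lists -/

theorem ok_nil {α : Type*} [Enc α] : Ok N zeroP x (enc ([] : List α)) := Ok.prim .zero x

theorem ok_cons {α : Type*} [Enc α] {a : α} {as : List α} (hf : Ok N f x (enc a))
    (hg : Ok N g x (enc as)) : Ok N (.pair f g) x (enc (a :: as)) := hf.pair hg

/-- Fold over the list `l` from the left, with initial value `i`; the program `b` for one step
finds the accumulator and the element of the list in its environment. -/
def foldP (l i b : Program) : Program :=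
  .seq (.seq (.pair (.pair (.prim .id) i) l)
    (.loop (.seq (.prim .snd) (.prim .isPair))
      (.pair (.pair (.seq (.prim .fst) (.prim .fst))
        (.seq (.pair (.prim .fst) (.seq (.prim .snd) (.prim .fst))) b))
        (.seq (.prim .snd) (.prim .snd)))))
    (.seq (.prim .fst) (.prim .snd))

/-- The body has to be correct only on accumulators that satisfy the invariant; this is how length
bounds for intermediate lists enter. The index counts the elements consumed so far. -/
theorem ok_foldIdx {α β : Type*} [Enc α] [Enc β] {as : List α} {c : β} {F : β → α → β}
    (Inv : ℕ → β → Prop) (hl : Ok N l x (enc as)) (hi : Ok N i x (enc c)) (hN : as.length ≤ N)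
    (h0 : Inv 0 c) (hInv : ∀ j (hj : j < as.length) c, Inv j c → Inv (j + 1) (F c as[j]))
    (hb : ∀ j (hj : j < as.length) c, Inv j c →
      Ok N b (.pair (.pair x (enc c)) (enc as[j])) (enc (F c as[j]))) :
    Ok N (foldP l i b) x (enc (as.foldl F c)) := by
  -- The loop passes through the environment extended by the accumulator, paired with the rest of
  -- the list. Since the empty list is the number `0`, the test `isPair` detects the end.
  let s : ℕ → Data := fun j =>
    .pair (.pair x (enc ((as.take j).foldl F c))) (enc (as.drop j))
  have hI : ∀ j ≤ as.length, Inv j ((as.take j).foldl F c) := by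
    intro j
    induction j with
    | zero => intro _; simpa using h0
    | succ j ih =>
      intro hj
      rw [List.take_succ_eq_append_getElem (by omega), List.foldl_append]
      exact hInv _ _ _ (ih (by omega))
  have hs0 : s 0 = .pair (.pair x (enc c)) (enc as) := by simp [s]
  have hsm : s as.length = .pair (.pair x (enc (as.foldl F c))) (enc ([] : List α)) := by simp [s]
  have hloop : Ok N (.loop (.seq (.prim .snd) (.prim .isPair))
      (.pair (.pair (.seq (.prim .fst) (.prim .fst))
        (.seq (.pair (.prim .fst) (.seq (.prim .snd) (.prim .fst))) b))
        (.seq (.prim .snd) (.prim .snd)))) (s 0) (s as.length) := by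
    refine Ok.loop hN s (fun j hj => ⟨.num 1, by simp, ?_⟩) (fun j hj => ?_) ?_
    · simp only [s, List.drop_eq_getElem_cons hj]
      exact (Ok.prim .snd _).seq (Ok.prim .isPair _)
    · simp only [s, List.drop_eq_getElem_cons hj]
      rw [List.take_succ_eq_append_getElem hj, List.foldl_append]
      refine Ok.pair (Ok.pair ((Ok.prim .fst _).seq (Ok.prim .fst _)) ?_)
        ((Ok.prim .snd _).seq (Ok.prim .snd _))
      exact (Ok.pair (Ok.prim .fst _) ((Ok.prim .snd _).seq (Ok.prim .fst _))).seq
        (hb _ hj _ (hI j hj.le))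
    · rw [hsm]
      exact (Ok.prim .snd _).seq (Ok.prim .isPair _)
  rw [hs0, hsm] at hloop
  exact (((Ok.pair (Ok.prim .id x) hi).pair hl).seq hloop).seq
    ((Ok.prim .fst _).seq (Ok.prim .snd _))

theorem ok_fold {α β : Type*} [Enc α] [Enc β] {as : List α} {c : β} {F : β → α → β}
    (Inv : β → Prop) (hl : Ok N l x (enc as)) (hi : Ok N i x (enc c)) (hN : as.length ≤ N)
    (h0 : Inv c) (hInv : ∀ c, ∀ a ∈ as, Inv c → Inv (F c a))
    (hb : ∀ c, ∀ a ∈ as, Inv c → Ok N b (.pair (.pair x (enc c)) (enc a)) (enc (F c a))) :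
    Ok N (foldP l i b) x (enc (as.foldl F c)) :=
  ok_foldIdx (fun _ => Inv) hl hi hN h0 (fun _ _ c hc => hInv c _ (List.getElem_mem _) hc)
    (fun _ _ c hc => hb c _ (List.getElem_mem _) hc)

/-- The reverse of a list. -/
def reverseP (l : Program) : Program := foldP l zeroP (.pair var0 var1)

theorem ok_reverse {α : Type*} [Enc α] {as : List α} (hl : Ok N l x (enc as))
    (hN : as.length ≤ N) : Ok N (reverseP l) x (enc as.reverse) := by
  have h := ok_fold (F := fun (c : List α) a => a :: c) (fun _ => True) hl ok_nil hN trivial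
    (fun _ _ _ _ => trivial) (b := .pair var0 var1)
    (fun c a _ _ => ok_cons ok_var0 ok_var1)
  simpa [reverseP] using h

/-- Concatenation of two lists. -/
def appendP (f g : Program) : Program := foldP (reverseP f) g (.pair var0 var1)

theorem ok_append {α : Type*} [Enc α] {as bs : List α} (hf : Ok N f x (enc as))
    (hg : Ok N g x (enc bs)) (hN : as.length ≤ N) : Ok N (appendP f g) x (enc (as ++ bs)) := by
  have h := ok_fold (F := fun (c : List α) a => a :: c) (fun _ => True) (ok_reverse hf hN) hg
    (by simpa using hN) trivial (fun _ _ _ _ => trivial) (b := .pair var0 var1)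
    (fun c a _ _ => ok_cons ok_var0 ok_var1)
  simpa [appendP] using h

/-- The concatenation of the lists that `b` computes for the elements of the list `l`. -/
def flatMapP (l b : Program) : Program :=
  reverseP (foldP l zeroP (foldP (.seq (.pair (wk (wk (.prim .id))) var0) b) var1
    (.pair var0 var1)))

theorem ok_flatMap {α β : Type*} [Enc α] [Enc β] {as : List α} {F : α → List β}
    (hl : Ok N l x (enc as)) (hb : ∀ a ∈ as, Ok N b (.pair x (enc a)) (enc (F a)))
    (hN : as.length ≤ N) (hF : ∀ a ∈ as, (F a).length ≤ N) (hlen : (as.flatMap F).length ≤ N) :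
    Ok N (flatMapP l b) x (enc (as.flatMap F)) := by
  have h := ok_fold (F := fun (c : List β) a => (F a).reverse ++ c) (fun _ => True) hl ok_nil hN
    trivial (fun _ _ _ _ => trivial)
    (b := foldP (.seq (.pair (wk (wk (.prim .id))) var0) b) var1 (.pair var0 var1)) (by
      intro c a ha _
      -- The accumulator is cut out of the environment, so that `b` sees only the element on top of
      -- the original environment.
      have h1 : Ok N (.seq (.pair (wk (wk (.prim .id))) var0) b)
          (.pair (.pair x (enc c)) (enc a)) (enc (F a)) :=
        ((ok_wk (ok_wk (Ok.prim .id x))).pair ok_var0).seq (hb a ha)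
      have h2 := ok_fold (F := fun (c : List β) a => a :: c) (fun _ => True) h1 ok_var1 (hF a ha)
        trivial (fun _ _ _ _ => trivial) (b := .pair var0 var1)
        (fun c a _ _ => ok_cons ok_var0 ok_var1)
      simpa using h2)
  -- Elements can only be prepended, so the accumulator is the reversal of the result; one final
  -- reversal repairs this.
  have hfold : ∀ (as : List α) (c : List β),
      as.foldl (fun c a => (F a).reverse ++ c) c = (as.flatMap F).reverse ++ c := by
    intro as
    induction as with
    | nil => simp
    | cons a as ih => intro c; simp [ih]
  rw [hfold, List.append_nil] at h
  simpa [flatMapP] using ok_reverse h (by simpa using hlen)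

/-- The list of the values of `b` at the elements of the list `l`. -/
def mapP (l b : Program) : Program := flatMapP l (.pair b zeroP)

theorem ok_map {α β : Type*} [Enc α] [Enc β] {as : List α} {F : α → β}
    (hl : Ok N l x (enc as)) (hb : ∀ a ∈ as, Ok N b (.pair x (enc a)) (enc (F a)))
    (hN : as.length ≤ N) (hN1 : 1 ≤ N) : Ok N (mapP l b) x (enc (as.map F)) := by
  have h := ok_flatMap (F := fun a => [F a]) (b := .pair b zeroP) hl
    (fun a ha => ok_cons (hb a ha) ok_nil) hN (fun a _ => by simpa using hN1)
    (by simpa using hN)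
  rwa [← List.map_eq_flatMap] at h

/-- The sublist of the elements of the list `l` for which `b` is true. -/
def filterP (l b : Program) : Program := flatMapP l (.cond b (.pair var0 zeroP) zeroP)

theorem ok_filter {α : Type*} [Enc α] {as : List α} {F : α → Prop} [DecidablePred F]
    (hl : Ok N l x (enc as)) (hb : ∀ a ∈ as, Ok N b (.pair x (enc a)) (enc (F a)))
    (hN : as.length ≤ N) (hN1 : 1 ≤ N) :
    Ok N (filterP l b) x (enc (as.filter fun a => F a)) := by
  have hfm : ∀ as : List α, (as.flatMap fun a => if F a then [a] else []) =
      as.filter fun a => F a := by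
    intro as
    induction as with
    | nil => rfl
    | cons a as ih => by_cases h : F a <;> simp [h, ih]
  have h := ok_flatMap (F := fun a => if F a then [a] else [])
    (b := .cond b (.pair var0 zeroP) zeroP) hl
    (fun a ha => ok_ite (hb a ha) (fun _ => ok_cons ok_var0 ok_nil) (fun _ => ok_nil)) hN
    (fun a _ => by split_ifs <;> simp [hN1])
    (by rw [hfm]; exact (List.length_filter_le _ _).trans hN)
  rwa [hfm] at h

/-- The sum of the integers that `b` computes for the elements of the list `l`. -/
def sumP (l b : Program) : Program :=
  foldP l zeroP (addP var1 (.seq (.pair (wk (wk (.prim .id))) var0) b))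

theorem foldl_add_eq_sum {α M : Type*} [AddMonoid M] (F : α → M) (as : List α) (c : M) :
    as.foldl (fun c a => c + F a) c = c + (as.map F).sum := by
  induction as generalizing c with
  | nil => simp
  | cons a as ih => simp [ih, add_assoc]

theorem ok_sum {α : Type*} [Enc α] {as : List α} {F : α → ℕ}
    (hl : Ok N l x (enc as)) (hb : ∀ a ∈ as, Ok N b (.pair x (enc a)) (enc (F a)))
    (hN : as.length ≤ N) : Ok N (sumP l b) x (enc (as.map F).sum) := by
  have h := ok_fold (F := fun c a => c + F a) (fun _ => True) hl ok_zero hN trivial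
    (fun _ _ _ _ => trivial) (b := addP var1 (.seq (.pair (wk (wk (.prim .id))) var0) b))
    (fun c a ha _ => ok_add ok_var1 (((ok_wk (ok_wk (Ok.prim .id x))).pair ok_var0).seq (hb a ha)))
  rwa [foldl_add_eq_sum, zero_add] at h

theorem ok_sum_real {α : Type*} [Enc α] {as : List α} {F : α → ℝ}
    (hl : Ok N l x (enc as)) (hb : ∀ a ∈ as, Ok N b (.pair x (enc a)) (enc (F a)))
    (hN : as.length ≤ N) : Ok N (sumP l b) x (enc (as.map F).sum) := by
  have h := ok_fold (F := fun c a => c + F a) (fun _ => True) hl ok_zero_real hN trivial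
    (fun _ _ _ _ => trivial) (b := addP var1 (.seq (.pair (wk (wk (.prim .id))) var0) b))
    (fun c a ha _ =>
      ok_add_real ok_var1 (((ok_wk (ok_wk (Ok.prim .id x))).pair ok_var0).seq (hb a ha)))
  rwa [foldl_add_eq_sum, zero_add] at h

/-- Whether `b` is true for some element of the list `l`. -/
def anyP (l b : Program) : Program :=
  foldP l zeroP (orP var1 (.seq (.pair (wk (wk (.prim .id))) var0) b))

theorem foldl_or_iff {α : Type*} (F : α → Prop) (as : List α) (c : Prop) :
    as.foldl (fun c a => c ∨ F a) c ↔ (c ∨ ∃ a ∈ as, F a) := by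
  induction as generalizing c with
  | nil => simp
  | cons a as ih => simp [ih, or_assoc]

theorem ok_any {α : Type*} [Enc α] {as : List α} {F : α → Prop}
    (hl : Ok N l x (enc as)) (hb : ∀ a ∈ as, Ok N b (.pair x (enc a)) (enc (F a)))
    (hN : as.length ≤ N) : Ok N (anyP l b) x (enc (∃ a ∈ as, F a)) := by
  have h := ok_fold (F := fun (c : Prop) a => c ∨ F a) (fun _ => True) hl ok_false hN trivial
    (fun _ _ _ _ => trivial) (b := orP var1 (.seq (.pair (wk (wk (.prim .id))) var0) b))
    (fun c a ha _ =>
      ok_or ok_var1 fun _ => (((ok_wk (ok_wk (Ok.prim .id x))).pair ok_var0).seq (hb a ha)))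
  rwa [propext (foldl_or_iff F as False), false_or] at h

/-- Whether `b` is true for all elements of the list `l`. -/
def allP (l b : Program) : Program := notP (anyP l (notP b))

theorem ok_all {α : Type*} [Enc α] {as : List α} {F : α → Prop}
    (hl : Ok N l x (enc as)) (hb : ∀ a ∈ as, Ok N b (.pair x (enc a)) (enc (F a)))
    (hN : as.length ≤ N) : Ok N (allP l b) x (enc (∀ a ∈ as, F a)) := by
  have h := ok_not (ok_any hl (fun a ha => ok_not (hb a ha)) hN)
  have e : (¬ ∃ a ∈ as, ¬ F a) = ∀ a ∈ as, F a := by simp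
  rwa [e] at h

/-- The list `0, …, m - 1`, for a number `m`. -/
def rangeP (f : Program) : Program :=
  .seq (.seq (.pair f zeroP) (.loop (.seq (.pair (.prim .one) (.prim .fst)) (.prim .le))
    (.pair (.seq (.pair (.prim .fst) (.prim .one)) (.prim .sub))
      (.pair (.seq (.pair (.prim .fst) (.prim .one)) (.prim .sub)) (.prim .snd)))))
    (.prim .snd)

theorem ok_range {m : ℕ} (hf : Ok N f x (enc m)) (hN : m ≤ N) :
    Ok N (rangeP f) x (enc (List.range m)) := by
  -- Counting down from `m` while prepending the counter yields the increasing list directly.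
  let s : ℕ → Data := fun j => .pair (.num (m - j)) (enc (List.range' (m - j) j))
  have hs0 : s 0 = .pair (enc m) (enc ([] : List ℕ)) := by simp [s, enc, Data.ofNat]
  have hsm : s m = .pair (.num 0) (enc (List.range m)) := by simp [s, List.range_eq_range']
  have hloop : Ok N (.loop (.seq (.pair (.prim .one) (.prim .fst)) (.prim .le))
    (.pair (.seq (.pair (.prim .fst) (.prim .one)) (.prim .sub))
      (.pair (.seq (.pair (.prim .fst) (.prim .one)) (.prim .sub)) (.prim .snd)))) (s 0) (s m) := by
    refine Ok.loop hN s (fun j hj => ⟨.num 1, by simp, ?_⟩) (fun j hj => ?_) ?_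
    · have h := ((Ok.prim (N := N) .one (s j)).pair (Ok.prim .fst (s j))).seq (Ok.prim .le _)
      have hle : (1 : ℝ) ≤ m - j := by
        have : ((j + 1 : ℕ) : ℝ) ≤ m := by exact_mod_cast hj
        push_cast at this; linarith
      simpa [PrimOp.eval, s, hle] using h
    · have h1 := ((Ok.prim (N := N) .fst (s j)).pair (Ok.prim .one (s j))).seq (Ok.prim .sub _)
      have h := h1.pair (h1.pair (Ok.prim .snd (s j)))
      have e1 : List.range' (m - (j + 1)) (j + 1) = (m - (j + 1)) :: List.range' (m - j) j := by
        rw [List.range'_succ, show m - (j + 1) + 1 = m - j by omega]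
      have e2 : ((m : ℝ) - ((j + 1 : ℕ) : ℝ)) = m - j - 1 := by push_cast; ring
      have e3 : ((m - (j + 1) : ℕ) : ℝ) = m - j - 1 := by rw [Nat.cast_sub (by omega), e2]
      have e4 : s (j + 1) = .pair (.num (m - j - 1)) (.pair (.num (m - j - 1))
          (enc (List.range' (m - j) j))) := by
        simp only [s, e1, e2]
        rw [← e3]
        rfl
      rw [e4]
      exact h
    · rw [hsm]
      have h := ((Ok.prim (N := N) .one (.pair (.num 0) (enc (List.range m)))).pair
        (Ok.prim .fst _)).seq (Ok.prim .le _)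
      simpa [PrimOp.eval, not_le.2 (zero_lt_one' ℝ)] using h
  rw [hs0, hsm] at hloop
  exact ((hf.pair ok_nil).seq hloop).seq (Ok.prim .snd _)

/-- The element at position `i` of the list `l`. -/
def nthP (l i : Program) : Program := fstP (foldP (rangeP i) l (.seq var1 (.prim .snd)))

/-- Stated with the raw operation `fst` so that positions beyond the end are included: there the
machine returns `0`, which agrees with the default value in `getD j 0`. -/
theorem ok_nth_aux {α : Type*} [Enc α] {as : List α} {j : ℕ} (hl : Ok N l x (enc as))
    (hi : Ok N i x (enc j)) (hN : j ≤ N) :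
    Ok N (nthP l i) x (PrimOp.fst.eval (enc (as.drop j))) := by
  have htail : ∀ bs : List α, PrimOp.snd.eval (enc bs) = enc bs.tail := by
    intro bs; cases bs <;> rfl
  have h := ok_fold (F := fun (c : List α) (_ : ℕ) => c.tail) (fun _ => True) (ok_range hi hN) hl
    (by simpa using hN) trivial (fun _ _ _ _ => trivial) (b := .seq var1 (.prim .snd)) (by
      intro c a _ _
      rw [← htail]
      exact ok_var1.seq (Ok.prim .snd _))
  have e : ∀ j, (List.range j).foldl (fun (c : List α) (_ : ℕ) => c.tail) as = as.drop j := by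
    intro j
    induction j with
    | zero => simp
    | succ j ih => rw [List.range_succ, List.foldl_append, ih]; simp
  rw [e] at h
  exact h.seq (Ok.prim .fst _)

theorem ok_getD {as : List ℕ} {j : ℕ} (hl : Ok N l x (enc as))
    (hi : Ok N i x (enc j)) (hN : j ≤ N) : Ok N (nthP l i) x (enc (as.getD j 0)) := by
  have h := ok_nth_aux hl hi hN
  by_cases hj : j < as.length
  · rw [List.drop_eq_getElem_cons hj] at h
    rw [List.getD_eq_getElem _ _ hj]
    exact h
  · rw [List.drop_eq_nil_of_le (by omega)] at h
    rw [List.getD_eq_default _ _ (by omega)]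
    simpa [enc, Data.ofList, PrimOp.eval, Data.ofNat] using h

theorem ok_nth {as : List Data} {j : ℕ} (hl : Ok N l x (Data.ofList as))
    (hi : Ok N i x (enc j)) (hN : j ≤ N) (hj : j < as.length) : Ok N (nthP l i) x as[j] := by
  have h := ok_nth_aux (as := as) (by simpa [enc] using hl) hi hN
  rw [List.drop_eq_getElem_cons hj] at h
  exact h

theorem ok_matrix {n : ℕ} {M : Fin n → Fin n → Data} {u v : Fin n}
    (hl : Ok N l x (Data.ofMatrix M)) (hf : Ok N f x (enc u)) (hg : Ok N g x (enc v))
    (hN : n ≤ N) : Ok N (nthP (nthP l f) g) x (M u v) := by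
  have h1 := ok_nth (j := u) hl hf (by omega) (by simp)
  have h2 := ok_nth (j := v) (as := List.ofFn fun j => M u j) (by simpa using h1) hg
    (by omega) (by simp)
  simpa using h2

/-- The product of an arbitrary number and an integer. -/
def mulP (f g : Program) : Program := foldP (rangeP g) zeroP (addP var1 (wk (wk f)))

theorem ok_mul_real {r : ℝ} {m : ℕ} (hf : Ok N f x (enc r)) (hg : Ok N g x (enc m))
    (hN : m ≤ N) : Ok N (mulP f g) x (enc (m * r)) := by
  have h := ok_fold (F := fun (c : ℝ) (_ : ℕ) => c + r) (fun _ => True) (ok_range hg hN)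
    ok_zero_real (by simpa using hN) trivial (fun _ _ _ _ => trivial)
    (b := addP var1 (wk (wk f))) (fun c a _ _ => ok_add_real ok_var1 (ok_wk (ok_wk hf)))
  rw [foldl_add_eq_sum] at h
  simpa [mulP] using h

theorem ok_mul {r m : ℕ} (hf : Ok N f x (enc r)) (hg : Ok N g x (enc m))
    (hN : m ≤ N) : Ok N (mulP f g) x (enc (m * r)) := by
  have h := ok_fold (F := fun (c : ℕ) (_ : ℕ) => c + r) (fun _ => True) (ok_range hg hN)
    ok_zero (by simpa using hN) trivial (fun _ _ _ _ => trivial)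
    (b := addP var1 (wk (wk f))) (fun c a _ _ => ok_add ok_var1 (ok_wk (ok_wk hf)))
  rw [foldl_add_eq_sum] at h
  simpa [mulP] using h

/-- The power of two with exponent `f`. -/
def twoPowP (f : Program) : Program := foldP (rangeP f) oneP (addP var1 var1)

theorem ok_twoPow {m : ℕ} (hf : Ok N f x (enc m)) (hN : m ≤ N) :
    Ok N (twoPowP f) x (enc (2 ^ m)) := by
  have h := ok_fold (F := fun (c : ℕ) (_ : ℕ) => c + c) (fun _ => True) (ok_range hf hN)
    ok_one (by simpa using hN) trivial (fun _ _ _ _ => trivial)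
    (b := addP var1 var1) (fun c a _ _ => ok_add ok_var1 ok_var1)
  have e : ∀ m, (List.range m).foldl (fun (c : ℕ) (_ : ℕ) => c + c) 1 = 2 ^ m := by
    intro m
    induction m with
    | zero => simp
    | succ j ih => rw [List.range_succ, List.foldl_append, ih]; simp; ring
  rwa [e] at h

/-- The remainder of the division of `f` by `g`. -/
def modP (f g : Program) : Program :=
  foldP (rangeP f) zeroP
    (.cond (eqP (addP var1 oneP) (wk (wk g))) zeroP (addP var1 oneP))

theorem ok_mod {r m : ℕ} (hf : Ok N f x (enc r)) (hg : Ok N g x (enc m)) (hN : r ≤ N)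
    (hm : 0 < m) : Ok N (modP f g) x (enc (r % m)) := by
  have h := ok_fold (F := fun (c : ℕ) (_ : ℕ) => if c + 1 = m then 0 else c + 1) (fun _ => True)
    (ok_range hf hN) ok_zero (by simpa using hN) trivial (fun _ _ _ _ => trivial)
    (b := .cond (eqP (addP var1 oneP) (wk (wk g))) zeroP (addP var1 oneP))
    (fun c a _ _ => ok_ite (ok_eq (ok_add ok_var1 ok_one) (ok_wk (ok_wk hg)))
      (fun _ => ok_zero) (fun _ => ok_add ok_var1 ok_one))
  have e : ∀ r, (List.range r).foldl (fun (c : ℕ) (_ : ℕ) => if c + 1 = m then 0 else c + 1) 0 =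
      r % m := by
    intro r
    induction r with
    | zero => simp
    | succ j ih =>
      rw [List.range_succ, List.foldl_append, ih]
      have := Nat.mod_lt j hm
      simp only [List.foldl_cons, List.foldl_nil]
      split_ifs with h1
      · rw [Nat.add_mod, ← Nat.add_mod, ← Nat.mod_add_mod, h1, Nat.mod_self]
      · exact ((Nat.mod_add_mod j m 1).symm.trans (Nat.mod_eq_of_lt (by omega))).symm
  rwa [e] at h

end Program

/-! ### Selecting a best element of a list -/

open Classical in
/-- Keep `a` instead of the elements of the list if none of these is better. -/
def bestStep {α : Type*} (r : α → α → Prop) (c : List α) (a : α) : List α :=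
  if ∃ b ∈ c, r b a then c else [a]

/-- An element of the list that is best with respect to the relation `r`, as a list of length at
most one. -/
def bestBy {α : Type*} (r : α → α → Prop) (as : List α) : List α :=
  as.foldl (bestStep r) []

theorem bestBy_length {α : Type*} (r : α → α → Prop) (as : List α) :
    (bestBy r as).length ≤ 1 := by
  have : ∀ (as c : List α), c.length ≤ 1 →
      (as.foldl (bestStep r) c).length ≤ 1 := by
    intro as
    induction as with
    | nil => intro c h; simpa using h
    | cons a as ih =>
      intro c h
      refine ih _ ?_
      unfold bestStep
      split_ifs
      · exact h
      · simp
  exact this as [] (by simp)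

theorem mem_of_mem_bestBy {α : Type*} {r : α → α → Prop} {as : List α} {a : α}
    (h : a ∈ bestBy r as) : a ∈ as := by
  have : ∀ (as c : List α), (∀ b ∈ as.foldl (bestStep r) c, b ∈ c ∨ b ∈ as) := by
    intro as
    induction as with
    | nil => intro c b h; simpa using h
    | cons a as ih =>
      intro c b h
      have h' := ih _ b h
      unfold bestStep at h'
      split_ifs at h'
      · rcases h' with h' | h' <;> simp [h']
      · rcases h' with h' | h'
        · simp at h'; simp [h']
        · simp [h']
  simpa using this as [] a h

/-- The predicate `S` restricts totality and transitivity to the elements that occur: ratios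
compared by cross-multiplication are transitive only for positive denominators. -/
theorem exists_mem_bestBy {α : Type*} {r : α → α → Prop} {as : List α} (S : α → Prop)
    (hS : ∀ a ∈ as, S a) (htot : ∀ a b, S a → S b → r a b ∨ r b a)
    (htrans : ∀ a b c, S a → S b → S c → r a b → r b c → r a c) {a : α} (ha : a ∈ as) :
    ∃ b ∈ bestBy r as, r b a := by
  -- The induction hypothesis speaks of elements already dominated by the accumulator as well as of
  -- those still in the list.
  have : ∀ (as c : List α), (∀ a ∈ as, S a) → (∀ a ∈ c, S a) → c.length ≤ 1 →
      ∀ a, ((∃ b ∈ c, r b a) ∧ S a ∨ a ∈ as) → ∃ b ∈ as.foldl (bestStep r) c, r b a := by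
    intro as
    induction as with
    | nil => intro c _ _ _ a h; simpa using h.elim And.left (fun h => by simp at h)
    | cons d as ih =>
      intro c h1 h2 h3 a h
      have hd := h1 d (by simp)
      refine ih _ (fun a ha => h1 a (by simp [ha])) ?_ ?_ a ?_
      · unfold bestStep
        split_ifs
        · exact h2
        · simpa using hd
      · unfold bestStep
        split_ifs
        · exact h3
        · simp
      · rcases h with ⟨⟨b, hb, hba⟩, hSa⟩ | h
        · left
          refine ⟨?_, hSa⟩
          unfold bestStep
          split_ifs with hc
          · exact ⟨b, hb, hba⟩
          · push Not at hc
            refine ⟨d, by simp, htrans d b a hd (h2 b hb) hSa ?_ hba⟩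
            exact (htot d b hd (h2 b hb)).resolve_right (hc b hb)
        · rcases List.mem_cons.1 h with rfl | h
          · left
            refine ⟨?_, hd⟩
            unfold bestStep
            split_ifs with hc
            · exact hc
            · exact ⟨a, by simp, (htot a a hd hd).elim id id⟩
          · exact Or.inr h
  exact this as [] hS (by simp) (by simp) a (Or.inr ha)

/-- A program for `bestBy`; the program `r` for the relation finds its arguments in its
environment. -/
def Program.bestByP (l r : Program) : Program :=
  .foldP l .zeroP (.cond (.anyP .var1
    (.seq (.pair (.pair (.wk (.wk (.wk (.prim .id)))) .var0) .var1) r)) .var1 (.pair .var0 .zeroP))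

theorem Program.ok_bestBy {N : ℕ} {x : Data} {l p : Program} {α : Type*} [Enc α] {as : List α}
    {r : α → α → Prop} (hl : Ok N l x (enc as)) (hN : as.length ≤ N) (hN1 : 1 ≤ N)
    (hr : ∀ a ∈ as, ∀ b ∈ as, Ok N p (.pair (.pair x (enc a)) (enc b)) (enc (r a b))) :
    Ok N (bestByP l p) x (enc (bestBy r as)) := by
  refine ok_fold (fun c : List α => c.length ≤ 1 ∧ ∀ b ∈ c, b ∈ as) hl ok_nil hN (by simp)
    ?_ ?_
  · rintro c a ha ⟨h1, h2⟩
    unfold bestStep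
    split_ifs
    · exact ⟨h1, h2⟩
    · simpa using ha
  · rintro c a ha ⟨h1, h2⟩
    classical
    refine ok_ite (ok_any ok_var1 (fun b hb => ?_) (h1.trans hN1)) (fun _ => ok_var1)
      (fun _ => ok_cons ok_var0 ok_nil)
    exact (((ok_wk (ok_wk (ok_wk (Ok.prim .id x)))).pair ok_var0).pair ok_var1).seq
      (hr b (h2 b hb) a ha)
end

/-! ### The greedy algorithm and its dynamic program -/

noncomputable section

/-! ### The algorithm -/

/-- All lists of length `d` with entries in `0, …, n`. -/
def vectors (n d : ℕ) : List (List ℕ) :=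
  (List.range d).foldl
    (fun c _ => c.flatMap fun z => (List.range (n + 1)).map fun a => a :: z) [[]]

theorem vectors_succ (n d : ℕ) : vectors n (d + 1) =
    (vectors n d).flatMap fun z => (List.range (n + 1)).map fun a => a :: z := by
  simp [vectors, List.range_succ]

theorem mem_vectors {n d : ℕ} {z : List ℕ} :
    z ∈ vectors n d ↔ z.length = d ∧ ∀ a ∈ z, a ≤ n := by
  induction d generalizing z with
  | zero => cases z <;> simp [vectors]
  | succ d ih =>
    rw [vectors_succ]
    cases z with
    | nil => simp
    | cons a z => simp [ih]; tauto

theorem length_vectors (n d : ℕ) : (vectors n d).length = (n + 1) ^ d := by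
  induction d with
  | zero => simp [vectors]
  | succ d ih => simp [vectors_succ, List.length_flatMap, ih, pow_succ]

namespace HierInstance

variable {n : ℕ} (I : HierInstance (Fin n))

/-- The vertices `x` and `y` lie in the same part of the partition at level `ℓ`. -/
def Same (ℓ : ℕ) (x y : Fin n) : Prop := ∃ H ∈ (I.𝓗 ℓ).parts, x ∈ H ∧ y ∈ H

/-- The cost from the vertex `v` to the hub `g`; the number `n` stands for a missing hub. -/
def outCost (v : Fin n) (g : ℕ) : ℝ :=
  if h : g < n then if g = v then 0 else I.c v ⟨g, h⟩ else 0

/-- The cost from the hub `g` to the vertex `v`. -/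
def inCost (g : ℕ) (v : Fin n) : ℝ :=
  if h : g < n then if g = v then 0 else I.c ⟨g, h⟩ v else 0

/-- The positions are divided into blocks of length `2 ^ (s + 1)`.  In the first half of its block
the vertex `v` at position `t` pays the cost to the hub of the block, in the second half the cost
from the hub, if its distance from the centre of the block is at most `k`. -/
def hubCost (t s : ℕ) (v : Fin n) (g : ℕ) : ℝ :=
  if t % 2 ^ (s + 1) < 2 ^ s then
    if 2 ^ s ≤ t % 2 ^ (s + 1) + I.k then I.outCost v g else 0
  else if t % 2 ^ (s + 1) ≤ 2 ^ s + I.k then I.inCost g v else 0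

/-- The hub `g` may be followed by the hub `g'` at position `t`. -/
def HubStep (n t s g g' : ℕ) : Prop :=
  t % 2 ^ (s + 1) = 0 ∨ g' = g ∧ (t % 2 ^ (s + 1) = 2 ^ s → g' < n)

/-- The states of the dynamic program: the last vertex of the path, the gain so far, and a list
with, for each level, the number of vertices of the path in the part of the last vertex, followed
by the hubs of all scales. -/
abbrev PathState (n : ℕ) : Type := Fin n × ℕ × List ℕ

/-- The number of scales. -/
abbrev scales (n : ℕ) : ℕ := Nat.clog 2 n + 1

/-- The cost of the state `σ` at position `t`. -/
def stateCost (t : ℕ) (σ : PathState n) : ℝ :=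
  ((List.range (scales n)).map fun s =>
    (2 ^ s : ℕ) * I.hubCost t s σ.1 (σ.2.2.getD (I.L + s) 0)).sum

/-- The element `(x, j)`, for a vertex `x` and `1 ≤ j ≤ L`, is covered by the pair `(P, ℓ)` if
`ℓ ≤ j` and `P` visits `x` or at least `k` vertices of the part of `x` at level `j + 1`. -/
def Covers (P : List (Fin n)) (ℓ : ℕ) (e : Fin n × ℕ) : Prop :=
  open Classical in
  ℓ ≤ e.2 ∧ ((∃ y ∈ P, e.1 = y) ∨
    e.2 < I.L ∧ I.k ≤ (P.map fun y => if I.Same (e.2 + 1) e.1 y then 1 else 0).sum)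

/-- The gain of one vertex for one element. -/
def elementGain (ℓ : ℕ) (v : Fin n) (z : List ℕ) (e : Fin n × ℕ) : ℕ :=
  open Classical in
  (if ℓ ≤ e.2 ∧ e.1 = v then 1 else 0) +
    (if ℓ ≤ e.2 ∧ e.2 < I.L ∧ z.getD e.2 0 = I.k ∧ I.Same (e.2 + 1) e.1 v then 1 else 0)

/-- The gain of one vertex, for the list `U` of uncovered elements. -/
def gain (ℓ : ℕ) (U : List (Fin n × ℕ)) (v : Fin n) (z : List ℕ) : ℕ :=
  (U.map (I.elementGain ℓ v z)).sum

/-- The states in which a path may start. -/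
def Start (ℓ : ℕ) (U : List (Fin n × ℕ)) (σ : PathState n) : Prop :=
  (∀ j ∈ List.range I.L, σ.2.2.getD j 0 = 1) ∧ σ.2.1 = I.gain ℓ U σ.1 σ.2.2

open Classical in
/-- The steps of the dynamic program, into position `t`. -/
def Step (ℓ : ℕ) (U : List (Fin n × ℕ)) (t : ℕ) (σ σ' : PathState n) : Prop :=
  I.lt σ.1 σ'.1 ∧ I.Same ℓ σ.1 σ'.1 ∧
    (∀ j ∈ List.range I.L, σ'.2.2.getD j 0 =
      (if I.Same (j + 1) σ.1 σ'.1 then σ.2.2.getD j 0 else 0) + 1) ∧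
    (∀ s ∈ List.range (scales n),
      HubStep n t s (σ.2.2.getD (I.L + s) 0) (σ'.2.2.getD (I.L + s) 0)) ∧
    σ'.2.1 = σ.2.1 + I.gain ℓ U σ'.1 σ'.2.2

/-- The list of all states. -/
def states : List (PathState n) :=
  (List.finRange n).flatMap fun v => (List.range (2 * (n * I.L) + 1)).flatMap fun q =>
    (vectors n (I.L + scales n)).map fun z => (v, q, z)

theorem mem_states {σ : PathState n} : σ ∈ I.states ↔
    σ.2.1 ≤ 2 * (n * I.L) ∧ σ.2.2.length = I.L + scales n ∧ ∀ a ∈ σ.2.2, a ≤ n := by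
  obtain ⟨v, q, z⟩ := σ
  simp [states, mem_vectors]

theorem length_states :
    I.states.length = n * ((2 * (n * I.L) + 1) * (n + 1) ^ (I.L + scales n)) := by
  simp [states, List.length_flatMap, length_vectors]

/-- A state with the cost of a path that leads to it and the list of the vertices of this path, the
last one first. -/
abbrev PathLabel (n : ℕ) : Type := PathState n × ℝ × List (Fin n)

open Classical in
/-- The candidates for the label of the state `σ` at position `t`, given the labels at the previous
position. -/
def extensions (ℓ : ℕ) (U : List (Fin n × ℕ)) (t : ℕ) (T : List (PathLabel n)) (σ : PathState n) :
    List (PathLabel n) :=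
  (if I.Start ℓ U σ then [(σ, I.stateCost t σ, [σ.1])] else []) ++
    T.flatMap fun a => if I.Step ℓ U t a.1 σ then
      [(σ, a.2.1 + I.stateCost t σ, σ.1 :: a.2.2)] else []

/-- The labels at position `t`, given those at the previous position. -/
def extend (ℓ : ℕ) (U : List (Fin n × ℕ)) (t : ℕ) (T : List (PathLabel n)) :
    List (PathLabel n) :=
  I.states.flatMap fun σ => bestBy (fun a b => a.2.1 ≤ b.2.1) (I.extensions ℓ U t T σ)

/-- The labels at all positions. -/
def labels (ℓ : ℕ) (U : List (Fin n × ℕ)) : List (PathLabel n) :=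
  ((List.range (2 ^ scales n)).foldl (fun (c : List (PathLabel n) × List (PathLabel n)) t =>
    (I.extend ℓ U t c.1, I.extend ℓ U t c.1 ++ c.2)) ([], [])).2

open Classical in
/-- The candidates for the next pair of the solution, with their costs and gains. -/
def candidates (U : List (Fin n × ℕ)) : List ((ℝ × ℕ) × List (Fin n) × ℕ) :=
  (List.range I.L).flatMap fun j => (I.labels (j + 1) U).flatMap fun a =>
    if 1 ≤ a.1.2.1 then
      [((a.2.1 + I.k * (I.k * (I.D (j + 1) : ℝ)), a.1.2.1), a.2.2.reverse, j + 1)] else []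

/-- The candidate with the best ratio of cost and gain. -/
def choice (U : List (Fin n × ℕ)) : List ((ℝ × ℕ) × List (Fin n) × ℕ) :=
  bestBy (fun a b => b.1.2 * a.1.1 ≤ a.1.2 * b.1.1) (I.candidates U)

/-- The list of all elements. -/
def elements : List (Fin n × ℕ) :=
  (List.finRange n).flatMap fun x => (List.range I.L).map fun j => (x, j + 1)

theorem mem_elements {e : Fin n × ℕ} : e ∈ I.elements ↔ 1 ≤ e.2 ∧ e.2 ≤ I.L := by
  obtain ⟨x, j⟩ := e
  simp only [elements, List.mem_flatMap, List.mem_finRange, List.mem_map, List.mem_range,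
    Prod.mk.injEq, true_and]
  constructor
  · rintro ⟨_, i, h, rfl, rfl⟩
    omega
  · rintro ⟨h1, h2⟩
    exact ⟨x, j - 1, by omega, rfl, by omega⟩

theorem length_elements : I.elements.length = n * I.L := by
  simp [elements, List.length_flatMap]

open Classical in
/-- One step of the greedy algorithm: add the best pair and remove the elements that it covers. -/
def greedyStep (c : List (Fin n × ℕ) × List (List (Fin n) × ℕ)) :
    List (Fin n × ℕ) × List (List (Fin n) × ℕ) :=
  (I.choice c.1).foldl (fun c a =>
    (c.1.filter fun e => ¬ I.Covers a.2.1 a.2.2 e, a.2 :: c.2)) c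

/-- The greedy algorithm. -/
def greedy : List (List (Fin n) × ℕ) :=
  (I.elements.foldl (fun c _ => I.greedyStep c) (I.elements, [])).2

/-! ### The dynamic program -/

/-- `X o, …, X e` is a path in the state space, at the positions `o, …, e`. -/
def IsRun (ℓ : ℕ) (U : List (Fin n × ℕ)) (o e : ℕ) (X : ℕ → PathState n) : Prop :=
  o ≤ e ∧ I.Start ℓ U (X o) ∧ (∀ t, o ≤ t → t ≤ e → X t ∈ I.states) ∧
    ∀ t, o ≤ t → t < e → I.Step ℓ U (t + 1) (X t) (X (t + 1))

/-- The labels at position `t - 1`. -/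
def table (ℓ : ℕ) (U : List (Fin n × ℕ)) : ℕ → List (PathLabel n)
  | 0 => []
  | t + 1 => I.extend ℓ U t (table ℓ U t)

variable {I} {ℓ : ℕ} {U : List (Fin n × ℕ)}

theorem length_extend_le {t : ℕ} {T : List (PathLabel n)} :
    (I.extend ℓ U t T).length ≤ I.states.length := by
  unfold extend
  induction I.states with
  | nil => simp
  | cons σ S ih =>
    have := bestBy_length (fun a b : PathLabel n => a.2.1 ≤ b.2.1) (I.extensions ℓ U t T σ)
    simp only [List.flatMap_cons, List.length_append, List.length_cons]
    omega

theorem length_table_le (t : ℕ) : (I.table ℓ U t).length ≤ I.states.length := by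
  cases t with
  | zero => simp [table]
  | succ t => exact length_extend_le

theorem labels_foldl (m : ℕ) :
    ((List.range m).foldl (fun (c : List (PathLabel n) × List (PathLabel n)) t =>
      (I.extend ℓ U t c.1, I.extend ℓ U t c.1 ++ c.2)) ([], [])) =
    (I.table ℓ U m, ((List.range m).reverse.flatMap fun t => I.table ℓ U (t + 1))) := by
  induction m with
  | zero => simp [table]
  | succ m ih =>
    rw [List.range_succ, List.foldl_append, ih]
    simp [table]

theorem mem_labels {a : PathLabel n} :
    a ∈ I.labels ℓ U ↔ ∃ t < 2 ^ scales n, a ∈ I.table ℓ U (t + 1) := by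
  simp [labels, labels_foldl]

theorem length_labels_le : (I.labels ℓ U).length ≤ 2 ^ scales n * I.states.length := by
  rw [labels, labels_foldl, List.length_flatMap]
  refine (List.sum_le_card_nsmul _ (I.states.length) ?_).trans (by simp)
  intro x hx
  obtain ⟨t, _, rfl⟩ := List.mem_map.1 hx
  exact length_table_le _

theorem mem_extensions {t : ℕ} {T : List (PathLabel n)} {σ : PathState n} {b : PathLabel n} :
    b ∈ I.extensions ℓ U t T σ ↔
      (I.Start ℓ U σ ∧ b = (σ, I.stateCost t σ, [σ.1])) ∨
      ∃ a ∈ T, I.Step ℓ U t a.1 σ ∧ b = (σ, a.2.1 + I.stateCost t σ, σ.1 :: a.2.2) := by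
  unfold extensions
  rw [List.mem_append, List.mem_flatMap]
  refine or_congr ?_ (exists_congr fun a => and_congr_right fun _ => ?_) <;>
  split_ifs with h <;> simp [h]

/-- Every label describes a run. -/
theorem exists_run_of_mem_table {t : ℕ} {a : PathLabel n} (ha : a ∈ I.table ℓ U (t + 1)) :
    ∃ o X, I.IsRun ℓ U o t X ∧ X t = a.1 ∧
      a.2.1 = ∑ i ∈ Finset.Icc o t, I.stateCost i (X i) ∧
      a.2.2.reverse = (List.range' o (t + 1 - o)).map fun i => (X i).1 := by
  induction t generalizing a with
  | zero =>
    obtain ⟨σ, hσ, h⟩ := List.mem_flatMap.1 ha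
    rcases mem_extensions.1 (mem_of_mem_bestBy h) with ⟨h1, rfl⟩ | ⟨a, h1, -⟩
    · exact ⟨0, fun _ => σ, ⟨le_rfl, h1, fun _ _ _ => hσ, fun t _ h => by omega⟩, rfl, by simp,
        by simp⟩
    · simp [table] at h1
  | succ t ih =>
    obtain ⟨σ, hσ, h⟩ := List.mem_flatMap.1 ha
    rcases mem_extensions.1 (mem_of_mem_bestBy h) with ⟨h1, rfl⟩ | ⟨a, h1, h2, rfl⟩
    · exact ⟨t + 1, fun _ => σ, ⟨le_rfl, h1, fun _ _ _ => hσ, fun t _ h => by omega⟩, rfl,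
        by simp, by simp⟩
    · obtain ⟨o, X, ⟨hot, hS, hm, hst⟩, hX, hc, hP⟩ := ih h1
      -- The run of the predecessor label is prolonged by redefining it at position `t + 1` only.
      have hne : ∀ i, i ≤ t → Function.update X (t + 1) σ i = X i := fun i hi =>
        Function.update_of_ne (by omega) _ _
      refine ⟨o, Function.update X (t + 1) σ, ⟨by omega, ?_, ?_, ?_⟩, by simp, ?_, ?_⟩
      · rwa [hne o hot]
      · intro i h1 h2
        rcases Nat.lt_or_ge t i with h3 | h3
        · obtain rfl : i = t + 1 := by omega
          simpa using hσ
        · rw [hne i h3]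
          exact hm i h1 h3
      · intro i h1 h3
        rw [hne i (by omega)]
        rcases Nat.lt_or_ge i t with h4 | h4
        · rw [hne (i + 1) (by omega)]
          exact hst i h1 h4
        · obtain rfl : i = t := by omega
          simpa [hX] using h2
      · rw [← Finset.insert_Icc_right_eq_Icc_add_one (by omega), Finset.sum_insert (by simp),
          hc, add_comm]
        simp only [Function.update_self]
        congr 1
        refine Finset.sum_congr rfl fun i hi => ?_
        rw [hne i (Finset.mem_Icc.1 hi).2]
      · rw [List.reverse_cons, hP, show t + 1 + 1 - o = (t + 1 - o) + 1 by omega,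
          List.range'_concat, List.map_append]
        congr 1
        · refine List.map_congr_left fun i hi => ?_
          rw [hne i (by have := List.mem_range'_1.1 hi; omega)]
        · simp [show o + (t + 1 - o) = t + 1 by omega]

/-- Every run is dominated by a label. -/
theorem exists_mem_table_of_run {o t : ℕ} {X : ℕ → PathState n} (h : I.IsRun ℓ U o t X) :
    ∃ a ∈ I.table ℓ U (t + 1), a.1 = X t ∧
      a.2.1 ≤ ∑ i ∈ Finset.Icc o t, I.stateCost i (X i) := by
  obtain ⟨hot, hS, hm, hst⟩ := h
  -- All candidates for a state carry that same state, so the one kept by `bestBy` is at least as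
  -- cheap as any given candidate and agrees with it in the state.
  have key : ∀ {t T b}, X t ∈ I.states → b ∈ I.extensions ℓ U t T (X t) →
      ∃ a ∈ I.extend ℓ U t T, a.1 = X t ∧ a.2.1 ≤ b.2.1 := by
    intro t T b hX hb
    obtain ⟨a, ha, hab⟩ := exists_mem_bestBy (r := fun a b : PathLabel n => a.2.1 ≤ b.2.1)
      (fun _ => True) (fun _ _ => trivial) (fun a b _ _ => le_total _ _)
      (fun a b c _ _ _ => le_trans) hb
    refine ⟨a, List.mem_flatMap.2 ⟨X t, hX, ha⟩, ?_, hab⟩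
    rcases mem_extensions.1 (mem_of_mem_bestBy ha) with ⟨_, rfl⟩ | ⟨_, _, _, rfl⟩ <;> rfl
  induction t, hot using Nat.le_induction with
  | base =>
    obtain ⟨a, ha, h1, h2⟩ := key (t := o) (T := I.table ℓ U o) (hm o le_rfl le_rfl)
      (mem_extensions.2 (Or.inl ⟨hS, rfl⟩))
    exact ⟨a, ha, h1, by simpa using h2⟩
  | succ t hot ih =>
    obtain ⟨b, hb, h1, h2⟩ := ih (fun i h h' => hm i h (by omega))
      (fun i h h' => hst i h (by omega))
    have h3 := hst t hot (by omega)
    -- Principle of optimality: `Step` depends on the state alone, so the cheaper label at `X t` can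
    -- be prolonged in place of the run.
    rw [← h1] at h3
    obtain ⟨a, ha, h4, h5⟩ := key (hm (t + 1) (by omega) le_rfl)
      (mem_extensions.2 (Or.inr ⟨b, hb, h3, rfl⟩))
    have h6 : a.2.1 ≤ b.2.1 + I.stateCost (t + 1) (X (t + 1)) := h5
    refine ⟨a, ha, h4, ?_⟩
    rw [← Finset.insert_Icc_right_eq_Icc_add_one (by omega), Finset.sum_insert (by simp)]
    linarith

end HierInstance
end

/-! ### Counts in parts, and the gain as a measure of coverage -/

noncomputable section

namespace HierInstance

variable {n : ℕ} {I : HierInstance (Fin n)} {ℓ : ℕ} {U : List (Fin n × ℕ)}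

/-! ### Parts of the partitions -/

theorem Same.refl (j : ℕ) (x : Fin n) : I.Same j x x := by
  obtain ⟨H, hH, hx⟩ := (I.𝓗 j).exists_mem (Finset.mem_univ x)
  exact ⟨H, hH, hx, hx⟩

theorem Same.symm {j : ℕ} {x y : Fin n} (h : I.Same j x y) : I.Same j y x :=
  let ⟨H, hH, hx, hy⟩ := h
  ⟨H, hH, hy, hx⟩

theorem Same.trans {j : ℕ} {x y z : Fin n} (h : I.Same j x y) (h' : I.Same j y z) :
    I.Same j x z := by
  obtain ⟨H, hH, hx, hy⟩ := h
  obtain ⟨H', hH', hy', hz⟩ := h'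
  obtain rfl := (I.𝓗 j).eq_of_mem_parts hH hH' hy hy'
  exact ⟨H, hH, hx, hz⟩

theorem Same.of_lt {j : ℕ} (h1 : 1 ≤ j) (h2 : j ≤ I.L) {x y z : Fin n} (h : I.Same j x z)
    (hxy : I.lt x y) (hyz : I.lt y z) : I.Same j y z := by
  obtain ⟨H, hH, hx, hz⟩ := h
  exact ⟨H, hH, I.compatible j h1 h2 H hH x hx z hz y hxy hyz, hz⟩

theorem sum_map_range' {M : Type*} [AddCommMonoid M] (o e : ℕ) (f : ℕ → M) :
    ((List.range' o (e + 1 - o)).map f).sum = ∑ i ∈ Finset.Icc o e, f i := rfl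

theorem list_sum_finset_sum {α ι : Type*} (l : List α) (s : Finset ι) (f : ι → α → ℕ) :
    ∑ i ∈ s, (l.map (f i)).sum = (l.map fun a => ∑ i ∈ s, f i a).sum := by
  induction l with
  | nil => simp
  | cons a l ih => simp [Finset.sum_add_distrib, ih]

/-! ### Monotone sequences of vertices -/

/-- The vertices `v o, …, v e` increase. -/
def Increasing (I : HierInstance (Fin n)) (v : ℕ → Fin n) (o e : ℕ) : Prop :=
  ∀ a b, o ≤ a → a < b → b ≤ e → I.lt (v a) (v b)

/-- The path with the vertices `v o, …, v e`. -/
def seqPath (v : ℕ → Fin n) (o e : ℕ) : List (Fin n) := (List.range' o (e + 1 - o)).map v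

open Classical in
/-- The number of vertices up to `v t` in the same part at level `j` as the vertex `x`. -/
def sameCount (I : HierInstance (Fin n)) (v : ℕ → Fin n) (o j : ℕ) (x : Fin n) (t : ℕ) : ℕ :=
  ((Finset.Icc o t).filter fun i => I.Same j x (v i)).card

variable {v : ℕ → Fin n} {o e : ℕ}

theorem Increasing.injOn (hv : I.Increasing v o e) {a b : ℕ} (ha : o ≤ a) (ha' : a ≤ e)
    (hb : o ≤ b) (hb' : b ≤ e) (h : v a = v b) : a = b := by
  have := I.lt_total
  rcases lt_trichotomy a b with h1 | h1 | h1
  · exact absurd (h ▸ hv a b ha h1 hb') (irrefl (r := I.lt) _)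
  · exact h1
  · exact absurd (h ▸ hv b a hb h1 ha') (irrefl (r := I.lt) _)

open Classical in
theorem sameCount_congr {j : ℕ} {x y : Fin n} (h : I.Same j x y) (t : ℕ) :
    I.sameCount v o j x t = I.sameCount v o j y t := by
  unfold sameCount
  congr 1
  exact Finset.filter_congr fun i _ => ⟨fun h' => h.symm.trans h', fun h' => h.trans h'⟩

open Classical in
theorem sameCount_succ {j t : ℕ} (x : Fin n) (ht : o ≤ t + 1) :
    I.sameCount v o j x (t + 1) =
      I.sameCount v o j x t + if I.Same j x (v (t + 1)) then 1 else 0 := by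
  unfold sameCount
  rw [← Finset.insert_Icc_right_eq_Icc_add_one ht, Finset.filter_insert]
  split_ifs
  · rw [Finset.card_insert_of_notMem (by simp)]
  · simp

open Classical in
theorem sameCount_mono {j s t : ℕ} (x : Fin n) (h : s ≤ t) :
    I.sameCount v o j x s ≤ I.sameCount v o j x t :=
  Finset.card_le_card (Finset.filter_subset_filter _ (Finset.Icc_subset_Icc le_rfl h))

open Classical in
/-- The recursion for the number of vertices in the part of the current vertex. -/
theorem Increasing.sameCount_step (hv : I.Increasing v o e) {j t : ℕ} (h1 : 1 ≤ j)
    (h2 : j ≤ I.L) (ho : o ≤ t) (he : t + 1 ≤ e) :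
    I.sameCount v o j (v (t + 1)) (t + 1) =
      (if I.Same j (v t) (v (t + 1)) then I.sameCount v o j (v t) t else 0) + 1 := by
  rw [sameCount_succ _ (by omega), if_pos (Same.refl _ _)]
  congr 1
  split_ifs with h
  · exact (sameCount_congr h t).symm
  -- Upon entering a new part the old count is zero: an earlier vertex in the part of `v (t + 1)`
  -- would, by consecutiveness, pull `v t` into it.
  · refine Finset.card_eq_zero.2 (Finset.filter_eq_empty_iff.2 fun i hi hs => h ?_)
    obtain ⟨hi1, hi2⟩ := Finset.mem_Icc.1 hi
    rcases hi2.lt_or_eq with hi3 | rfl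
    · exact hs.symm.of_lt h1 h2 (hv i t hi1 hi3 (by omega)) (hv t (t + 1) ho (by omega) he)
    · exact hs.symm

theorem mem_seqPath {x : Fin n} : x ∈ seqPath v o e ↔ ∃ t, o ≤ t ∧ t ≤ e ∧ v t = x := by
  simp only [seqPath, List.mem_map, List.mem_range'_1]
  exact exists_congr fun t => by rw [← and_assoc]; exact and_congr_left fun _ => by omega

open Classical in
theorem covers_seqPath {x : Fin n × ℕ} : I.Covers (seqPath v o e) ℓ x ↔
    ℓ ≤ x.2 ∧ ((∃ t, o ≤ t ∧ t ≤ e ∧ v t = x.1) ∨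
      x.2 < I.L ∧ I.k ≤ I.sameCount v o (x.2 + 1) x.1 e) := by
  unfold Covers
  rw [show ((seqPath v o e).map fun y => if I.Same (x.2 + 1) x.1 y then 1 else 0).sum =
      I.sameCount v o (x.2 + 1) x.1 e by
    rw [seqPath, List.map_map, sum_map_range', sameCount, Finset.card_filter]
    rfl]
  simp only [exists_eq_right', mem_seqPath]

section Gain

variable {z : ℕ → List ℕ}
  (hz : ∀ t, o ≤ t → t ≤ e → ∀ j < I.L, (z t).getD j 0 = I.sameCount v o (j + 1) (v t) t)
include hz

open Classical in
-- Each of the two summands of `elementGain` fires at most once along the path: a vertex is visited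
-- only once, and the count of a part strictly increases at each vertex in the part, so it equals
-- `k` at one such vertex at most. Either event implies that the element is covered.
theorem Increasing.sum_elementGain_le (hv : I.Increasing v o e) (x : Fin n × ℕ) :
    ∑ t ∈ Finset.Icc o e, I.elementGain ℓ (v t) (z t) x ≤
      2 * if I.Covers (seqPath v o e) ℓ x then 1 else 0 := by
  have hone : ∀ (p : ℕ → Prop) [DecidablePred p],
      (∀ t, o ≤ t → t ≤ e → p t → I.Covers (seqPath v o e) ℓ x) →
      (∀ a b, o ≤ a → a < b → b ≤ e → p a → ¬ p b) →
      ∑ t ∈ Finset.Icc o e, (if p t then 1 else 0) ≤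
        if I.Covers (seqPath v o e) ℓ x then 1 else 0 := by
    intro p _ h1 h2
    rw [← Finset.card_filter]
    split_ifs with hc
    · refine Finset.card_le_one.2 fun a ha b hb => ?_
      simp only [Finset.mem_filter, Finset.mem_Icc] at ha hb
      by_contra hne
      rcases Nat.lt_or_gt_of_ne hne with h | h
      · exact h2 a b ha.1.1 h hb.1.2 ha.2 hb.2
      · exact h2 b a hb.1.1 h ha.1.2 hb.2 ha.2
    · refine (Finset.card_eq_zero.2 (Finset.filter_eq_empty_iff.2 fun t ht hp => hc ?_)).le
      exact h1 t (Finset.mem_Icc.1 ht).1 (Finset.mem_Icc.1 ht).2 hp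
  simp only [elementGain, Finset.sum_add_distrib, two_mul]
  refine add_le_add (hone _ ?_ ?_) (hone _ ?_ ?_)
  · rintro t h1 h2 ⟨h3, h4⟩
    exact covers_seqPath.2 ⟨h3, Or.inl ⟨t, h1, h2, h4.symm⟩⟩
  · rintro a b h1 h2 h3 ⟨-, h4⟩ ⟨-, h5⟩
    have := hv.injOn h1 (by omega) (by omega) h3 (h4.symm.trans h5)
    omega
  · rintro t h1 h2 ⟨h3, h4, h5, h6⟩
    refine covers_seqPath.2 ⟨h3, Or.inr ⟨h4, ?_⟩⟩
    rw [← h5, hz t h1 h2 _ h4, ← sameCount_congr h6]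
    exact sameCount_mono _ h2
  · rintro a b h1 h2 h3 ⟨-, h4, h5, h6⟩ ⟨-, -, h7, h8⟩
    rw [hz _ (by omega) (by omega) _ h4] at h5 h7
    rw [← sameCount_congr h6] at h5
    rw [← sameCount_congr h8] at h7
    obtain ⟨b, rfl⟩ : ∃ c, b = c + 1 := ⟨b - 1, by omega⟩
    rw [sameCount_succ _ (by omega), if_pos h8] at h7
    have := sameCount_mono (I := I) (v := v) (o := o) (j := x.2 + 1) x.1 (show a ≤ b by omega)
    omega

/-- If coverage comes from `k` vertices of a part, consider the first time at which the count is at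
least `k`. Counts grow by at most one, so at that time the count is exactly `k` and the current
vertex lies in the part. -/
theorem one_le_sum_elementGain (hk : 1 ≤ I.k) {x : Fin n × ℕ}
    (hc : I.Covers (seqPath v o e) ℓ x) :
    1 ≤ ∑ t ∈ Finset.Icc o e, I.elementGain ℓ (v t) (z t) x := by
  classical
  suffices h : ∃ t ∈ Finset.Icc o e, 1 ≤ I.elementGain ℓ (v t) (z t) x by
    obtain ⟨t, ht, h⟩ := h
    exact h.trans (Finset.single_le_sum (f := fun t => I.elementGain ℓ (v t) (z t) x)
      (fun _ _ => Nat.zero_le _) ht)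
  obtain ⟨h1, ⟨t, h2, h3, h4⟩ | ⟨h2, h3⟩⟩ := covers_seqPath.1 hc
  · refine ⟨t, Finset.mem_Icc.2 ⟨h2, h3⟩, ?_⟩
    rw [elementGain, if_pos ⟨h1, h4.symm⟩]
    omega
  · have hex : ∃ t, I.k ≤ I.sameCount v o (x.2 + 1) x.1 t := ⟨e, h3⟩
    obtain ⟨t, ht⟩ : ∃ t, t = Nat.find hex := ⟨_, rfl⟩
    have hte : t ≤ e := ht ▸ Nat.find_min' hex h3
    have hk1 : I.k ≤ I.sameCount v o (x.2 + 1) x.1 t := ht ▸ Nat.find_spec hex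
    -- Before position `o` the count is `0`, and `k ≥ 1`. For `k = 0` the count would never be seen
    -- to reach `k`.
    have hot : o ≤ t := by
      by_contra h
      rw [sameCount, Finset.Icc_eq_empty (by omega)] at hk1
      simp at hk1
      omega
    -- The case `t = 0` is separated because `t - 1` is truncated; the previous count is then `0`.
    have hprev : I.sameCount v o (x.2 + 1) x.1 t =
        (if t = 0 then 0 else I.sameCount v o (x.2 + 1) x.1 (t - 1)) +
        if I.Same (x.2 + 1) x.1 (v t) then 1 else 0 := by
      cases t with
      | zero =>
        obtain rfl : o = 0 := by omega
        simp [sameCount, Finset.filter_singleton]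
        split_ifs <;> simp
      | succ t => simpa using sameCount_succ _ hot
    have hlt : (if t = 0 then 0 else I.sameCount v o (x.2 + 1) x.1 (t - 1)) < I.k := by
      split_ifs with h0
      · omega
      · have := Nat.find_min hex (show t - 1 < _ by omega)
        omega
    have hs : I.Same (x.2 + 1) x.1 (v t) := by
      by_contra h
      rw [if_neg h] at hprev
      omega
    rw [if_pos hs] at hprev
    refine ⟨t, Finset.mem_Icc.2 ⟨hot, hte⟩, ?_⟩
    have h4 : (z t).getD x.2 0 = I.k := by
      rw [hz t hot hte _ h2, ← sameCount_congr hs]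
      omega
    rw [elementGain, if_pos (c := _ ∧ _ < _ ∧ _) ⟨h1, h2, h4, hs⟩]
    omega

open Classical in
-- The state does not remember which elements have been credited, so an element may be credited for
-- both reasons. The resulting factor `2` enters the approximation ratio.
theorem Increasing.sum_gain_le (hv : I.Increasing v o e) :
    ∑ t ∈ Finset.Icc o e, I.gain ℓ U (v t) (z t) ≤
      2 * U.countP fun x => I.Covers (seqPath v o e) ℓ x := by
  simp only [gain]
  rw [list_sum_finset_sum]
  induction U with
  | nil => simp
  | cons x U ih =>
    have := hv.sum_elementGain_le (ℓ := ℓ) hz x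
    rw [List.countP_cons]
    simp only [List.map_cons, List.sum_cons, decide_eq_true_eq]
    omega

open Classical in
theorem countP_le_sum_gain (hk : 1 ≤ I.k) :
    (U.countP fun x => I.Covers (seqPath v o e) ℓ x) ≤
      ∑ t ∈ Finset.Icc o e, I.gain ℓ U (v t) (z t) := by
  simp only [gain]
  rw [list_sum_finset_sum]
  induction U with
  | nil => simp
  | cons x U ih =>
    rw [List.countP_cons]
    simp only [List.map_cons, List.sum_cons, decide_eq_true_eq]
    by_cases h : I.Covers (seqPath v o e) ℓ x
    · have := one_le_sum_elementGain hz hk h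
      rw [if_pos h]
      omega
    · rw [if_neg h]
      omega

end Gain

/-! ### Runs -/

variable {X : ℕ → PathState n}

theorem IsRun.increasing (h : I.IsRun ℓ U o e X) : I.Increasing (fun t => (X t).1) o e := by
  obtain ⟨-, -, -, hst⟩ := h
  intro a b ha hab hb
  have := I.lt_total
  induction b, hab using Nat.le_induction with
  | base => exact (hst a ha (by omega)).1
  | succ b hab ih =>
    have h1 : I.lt (X a).1 (X b).1 := ih (by omega)
    exact _root_.trans (r := I.lt) h1 (hst b (by omega) (by omega)).1

theorem IsRun.same (h : I.IsRun ℓ U o e X) {t : ℕ} (ho : o ≤ t) (he : t ≤ e) :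
    I.Same ℓ (X o).1 (X t).1 := by
  obtain ⟨-, -, -, hst⟩ := h
  induction t, ho using Nat.le_induction with
  | base => exact Same.refl _ _
  | succ t ho ih => exact (ih (by omega)).trans (hst t ho (by omega)).2.1

theorem IsRun.getD (h : I.IsRun ℓ U o e X) {t : ℕ} (ho : o ≤ t) (he : t ≤ e) {j : ℕ}
    (hj : j < I.L) :
    (X t).2.2.getD j 0 = I.sameCount (fun t => (X t).1) o (j + 1) (X t).1 t := by
  have hv := h.increasing
  obtain ⟨-, hS, -, hst⟩ := h
  induction t, ho using Nat.le_induction with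
  | base =>
    rw [hS.1 j (List.mem_range.2 hj)]
    simp [sameCount, Finset.filter_singleton, Same.refl]
  | succ t ho ih =>
    rw [(hst t ho (by omega)).2.2.1 j (List.mem_range.2 hj),
      hv.sameCount_step (by omega) (by omega) ho he, ih (by omega)]

theorem IsRun.gain (h : I.IsRun ℓ U o e X) {t : ℕ} (ho : o ≤ t) (he : t ≤ e) :
    (X t).2.1 = ∑ i ∈ Finset.Icc o t, I.gain ℓ U (X i).1 (X i).2.2 := by
  obtain ⟨-, hS, -, hst⟩ := h
  induction t, ho using Nat.le_induction with
  | base => simpa using hS.2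
  | succ t ho ih =>
    rw [(hst t ho (by omega)).2.2.2.2, ih (by omega),
      ← Finset.insert_Icc_right_eq_Icc_add_one (by omega), Finset.sum_insert (by simp), add_comm]

theorem seqPath_isChain (hv : I.Increasing v o e) : (seqPath v o e).IsChain I.lt := by
  rw [List.isChain_iff_getElem]
  intro i hi
  simp only [seqPath, List.length_map, List.length_range'] at hi
  simp only [seqPath, List.getElem_map, List.getElem_range']
  exact hv _ _ (by omega) (by omega) (by omega)

theorem IsRun.isPathLevelPair (h : I.IsRun ℓ U o e X) (h1 : 1 ≤ ℓ) (h2 : ℓ ≤ I.L) :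
    I.IsPathLevelPair (seqPath (fun t => (X t).1) o e, ℓ) := by
  have hoe := h.1
  refine ⟨⟨?_, seqPath_isChain h.increasing⟩, h1, h2, ?_⟩
  · intro hnil
    have := congrArg List.length hnil
    simp [seqPath] at this
    omega
  · obtain ⟨H, hH, ho, -⟩ := h.same le_rfl hoe
    refine ⟨H, hH, fun x hx => ?_⟩
    obtain ⟨t, ht1, ht2, rfl⟩ := mem_seqPath.1 hx
    obtain ⟨H', hH', ho', ht'⟩ := h.same ht1 ht2
    obtain rfl := (I.𝓗 ℓ).eq_of_mem_parts hH hH' ho ho'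
    exact ht'

end HierInstance
end

/-! ### Hub costs as an approximation of the hop cost -/

noncomputable section

namespace HierInstance

variable {n : ℕ} {I : HierInstance (Fin n)} {ℓ : ℕ} {U : List (Fin n × ℕ)}
  {v : ℕ → Fin n} {o e : ℕ} {X : ℕ → PathState n}

/-! ### The cost of a run -/

theorem outCost_nonneg (x : Fin n) (g : ℕ) : 0 ≤ I.outCost x g := by
  unfold outCost
  split_ifs <;> first | exact le_rfl | exact I.c_nonneg _ _

theorem inCost_nonneg (g : ℕ) (x : Fin n) : 0 ≤ I.inCost g x := by
  unfold inCost
  split_ifs <;> first | exact le_rfl | exact I.c_nonneg _ _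

theorem hubCost_nonneg (t s : ℕ) (x : Fin n) (g : ℕ) : 0 ≤ I.hubCost t s x g := by
  unfold hubCost
  split_ifs <;> first | exact le_rfl | exact outCost_nonneg _ _ | exact inCost_nonneg _ _

/-- The triangle inequality through the hub. If the hub is one of the endpoints, the vanishing cost
of a hub to itself leaves the edge itself; both cannot happen since `x ≠ y`. -/
theorem cost_le_outCost_add_inCost {x y : Fin n} (hxy : x ≠ y) {g : ℕ} (hg : g < n) :
    I.c x y ≤ I.outCost x g + I.inCost g y := by
  unfold outCost inCost
  rw [dif_pos hg, dif_pos hg]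
  split_ifs with h1 h2 h2
  · exact absurd (Fin.ext (h1.symm.trans h2)) hxy
  · obtain rfl : x = ⟨g, hg⟩ := Fin.ext h1.symm
    simp
  · obtain rfl : y = ⟨g, hg⟩ := Fin.ext h2.symm
    simp
  · exact I.c_triangle _ _ _

theorem hopCost_nonneg (P : List (Fin n)) : 0 ≤ I.hopCost P := by
  unfold hopCost
  refine Finset.sum_nonneg fun Δ _ => Finset.sum_nonneg fun i _ => ?_
  split_ifs
  · exact I.c_nonneg _ _
  · exact le_rfl

theorem hopCost_seqPath (hoe : o ≤ e + 1) : I.hopCost (seqPath v o e) =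
    ∑ a ∈ Finset.Icc o e, ∑ Δ ∈ Finset.Icc 1 I.k,
      if a + Δ ≤ e then I.c (v a) (v (a + Δ)) else 0 := by
  have hlen : (seqPath v o e).length = e + 1 - o := by simp [seqPath]
  rw [hopCost, Finset.sum_comm, ← Finset.Ico_add_one_right_eq_Icc o e,
    Finset.sum_Ico_eq_sum_range]
  refine Finset.sum_congr (by rw [hlen]) fun i hi => Finset.sum_congr rfl fun Δ _ => ?_
  by_cases h : i + Δ < e + 1 - o
  · rw [dif_pos (by rwa [hlen]), if_pos (by omega)]
    simp only [seqPath, List.getElem_map, List.getElem_range', one_mul, add_assoc]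
  · rw [dif_neg (by rwa [hlen]), if_neg (by omega)]

/-- Positions `a` and `b` lie in the first and second half of the same block at scale `s`. -/
def Separated (s a b : ℕ) : Prop := a / 2 ^ s % 2 = 0 ∧ b / 2 ^ s = a / 2 ^ s + 1

instance (s a b : ℕ) : Decidable (Separated s a b) := inferInstanceAs (Decidable (_ ∧ _))

/-- Take the least exponent at which the two quotients agree; it is positive because `a ≠ b`. One
scale below, the quotients differ but have equal halves, so they are `2q` and `2q + 1`. -/
theorem exists_separated {S a b : ℕ} (hab : a < b) (hb : b < 2 ^ S) :
    ∃ s < S, Separated s a b := by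
  have hex : ∃ s, a / 2 ^ s = b / 2 ^ s := ⟨S, by
    rw [Nat.div_eq_of_lt hb, Nat.div_eq_of_lt (hab.trans hb)]⟩
  obtain ⟨s, hs⟩ : ∃ s, s = Nat.find hex := ⟨_, rfl⟩
  have h1 : a / 2 ^ s = b / 2 ^ s := hs ▸ Nat.find_spec hex
  have h2 : s ≤ S := hs ▸ Nat.find_min' hex (by
    rw [Nat.div_eq_of_lt hb, Nat.div_eq_of_lt (hab.trans hb)])
  cases s with
  | zero => simp at h1; omega
  | succ s =>
    have h3 : a / 2 ^ s ≠ b / 2 ^ s := Nat.find_min hex (show s < _ by omega)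
    have h4 : a / 2 ^ s ≤ b / 2 ^ s := Nat.div_le_div_right hab.le
    rw [pow_succ, ← Nat.div_div_eq_div_mul, ← Nat.div_div_eq_div_mul] at h1
    exact ⟨s, by omega, by unfold Separated; omega⟩

theorem card_div_eq_le (B : Finset ℕ) (h q : ℕ) (hh : 0 < h) :
    (B.filter fun b => b / h = q).card ≤ h := by
  calc (B.filter fun b => b / h = q).card ≤ (Finset.Ico (q * h) (q * h + h)).card := by
        refine Finset.card_le_card fun b hb => ?_
        have h1 := (Finset.mem_filter.1 hb).2
        have h2 := Nat.div_add_mod b h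
        have h3 := Nat.mod_lt b hh
        rw [h1, mul_comm] at h2
        exact Finset.mem_Ico.2 ⟨by omega, by omega⟩
    _ = h := by simp

/-- A position lies in only one half of its block, so one of the two sets is empty; the partners
fill at most the other half, which has `2 ^ s` positions. This is the origin of the weight `2 ^ s`
in `stateCost`. -/
theorem card_separated_le (B : Finset ℕ) (s t : ℕ) :
    (B.filter fun b => Separated s t b).card + (B.filter fun a => Separated s a t).card ≤
      2 ^ s := by
  have hpos : 0 < 2 ^ s := by positivity
  by_cases h : t / 2 ^ s % 2 = 0
  · have h1 : (B.filter fun a => Separated s a t) = ∅ :=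
      Finset.filter_eq_empty_iff.2 fun a _ h' => by unfold Separated at h'; omega
    rw [h1, Finset.card_empty, add_zero]
    refine (Finset.card_le_card (Finset.monotone_filter_right B ?_)).trans
      (card_div_eq_le B _ (t / 2 ^ s + 1) hpos)
    intro b _ hb
    exact hb.2
  · have h1 : (B.filter fun b => Separated s t b) = ∅ :=
      Finset.filter_eq_empty_iff.2 fun a _ h' => h h'.1
    rw [h1, Finset.card_empty, zero_add]
    refine (Finset.card_le_card (Finset.monotone_filter_right B ?_)).trans
      (card_div_eq_le B _ (t / 2 ^ s - 1) hpos)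
    intro a _ ha
    have h2 : t / 2 ^ s = a / 2 ^ s + 1 := ha.2
    exact (Nat.sub_eq_of_eq_add h2).symm

/-- If two positions are separated at some scale then the costs that their vertices pay for the
common hub are an upper bound for the cost of the edge between them. -/
theorem IsRun.cost_le (h : I.IsRun ℓ U o e X) {s a b : ℕ} (hs : s < scales n) (ha : o ≤ a)
    (hab : a < b) (hb : b ≤ e) (hk : b ≤ a + I.k) (hsep : Separated s a b) :
    I.c (X a).1 (X b).1 ≤ I.hubCost a s (X a).1 ((X a).2.2.getD (I.L + s) 0) +
      I.hubCost b s (X b).1 ((X b).2.2.getD (I.L + s) 0) := by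
  have hv := h.increasing
  obtain ⟨-, -, -, hst⟩ := h
  obtain ⟨q, hq⟩ : ∃ q, a / 2 ^ s = 2 * q := ⟨a / 2 ^ s / 2, by have := hsep.1; omega⟩
  have hq' : b / 2 ^ s = 2 * q + 1 := by rw [hsep.2, hq]
  have hpos : 0 < 2 ^ s := by positivity
  have ha1 := Nat.div_add_mod a (2 ^ s)
  have hb1 := Nat.div_add_mod b (2 ^ s)
  have ha2 := Nat.mod_lt a hpos
  have hb2 := Nat.mod_lt b hpos
  rw [hq] at ha1
  rw [hq', mul_add, mul_one] at hb1
  -- Both positions lie in the block that starts at `2 ^ s * (2 * q)`, hence so do all positions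
  -- between them.
  have hmod : ∀ t, a ≤ t → t ≤ b → t % 2 ^ (s + 1) = t - 2 ^ s * (2 * q) := by
    intro t h1 h2
    have h3 : t = (t - 2 ^ s * (2 * q)) + 2 ^ (s + 1) * q := by
      rw [pow_succ, mul_assoc]; omega
    conv_lhs => rw [h3]
    rw [Nat.add_mul_mod_self_left, Nat.mod_eq_of_lt]
    rw [pow_succ]; omega
  set g := (X a).2.2.getD (I.L + s) 0 with hg
  -- No position in `(a, b]` starts a block, so `HubStep` forces the hub to stay the same.
  have hconst : ∀ t, a ≤ t → t ≤ b → (X t).2.2.getD (I.L + s) 0 = g := by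
    intro t h1
    induction t, h1 using Nat.le_induction with
    | base => intro _; rfl
    | succ t h1 ih =>
      intro h2
      rw [← ih (by omega)]
      rcases (hst t (by omega) (by omega)).2.2.2.1 s (List.mem_range.2 hs) with h3 | h3
      · rw [hmod _ (by omega) h2] at h3
        omega
      · exact h3.1
  -- The run steps into the centre of the block on its way from `a` to `b`, and there `HubStep`
  -- forbids the missing hub `n`.
  have hgn : g < n := by
    obtain ⟨t, ht⟩ : ∃ t, t + 1 = 2 ^ s * (2 * q) + 2 ^ s :=
      ⟨2 ^ s * (2 * q) + 2 ^ s - 1, by omega⟩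
    have hm := hmod (t + 1) (by omega) (by omega)
    rcases (hst t (by omega) (by omega)).2.2.2.1 s (List.mem_range.2 hs) with h3 | h3
    · omega
    · have := h3.2 (by omega)
      rwa [hconst _ (by omega) (by omega)] at this
  rw [hconst b hab.le le_rfl]
  have hma := hmod a le_rfl hab.le
  have hmb := hmod b hab.le le_rfl
  -- The centre lies in `(a, b]` and `b ≤ a + k`, so both positions are within distance `k` of it
  -- and really pay.
  have e1 : I.hubCost a s (X a).1 g = I.outCost (X a).1 g := by
    rw [hubCost, if_pos (by omega), if_pos (by omega)]
  have e2 : I.hubCost b s (X b).1 g = I.inCost g (X b).1 := by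
    rw [hubCost, if_neg (by omega), if_pos (by omega)]
  rw [e1, e2]
  refine cost_le_outCost_add_inCost (fun hne => ?_) hgn
  have := hv.injOn ha (by omega) (by omega) hb hne
  omega

/-- The cost of a run is an upper bound for the hop cost of its path. -/
theorem IsRun.hopCost_le (h : I.IsRun ℓ U o e X) (he : e < 2 ^ scales n) :
    I.hopCost (seqPath (fun t => (X t).1) o e) ≤
      ∑ t ∈ Finset.Icc o e, I.stateCost t (X t) := by
  set B := Finset.Icc o e
  set w : ℕ → ℕ → ℝ := fun s t => I.hubCost t s (X t).1 ((X t).2.2.getD (I.L + s) 0) with hw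
  have hw0 : ∀ s t, 0 ≤ w s t := fun s t => hubCost_nonneg _ _ _ _
  -- Each edge is charged to a scale that separates its ends; all other terms on the right are
  -- nonnegative.
  have h1 : ∀ a ∈ B, ∑ Δ ∈ Finset.Icc 1 I.k,
      (if a + Δ ≤ e then I.c (X a).1 (X (a + Δ)).1 else 0) ≤
      ∑ b ∈ B, ∑ s ∈ Finset.range (scales n), if Separated s a b then w s a + w s b else 0 := by
    intro a ha
    obtain ⟨ha1, ha2⟩ := Finset.mem_Icc.1 ha
    rw [← Finset.sum_filter]
    have himg : ((Finset.Icc 1 I.k).filter fun Δ => a + Δ ≤ e).image (fun Δ => a + Δ) ⊆ B := by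
      intro b hb
      obtain ⟨Δ, hΔ, rfl⟩ := Finset.mem_image.1 hb
      simp only [Finset.mem_filter, Finset.mem_Icc] at hΔ
      exact Finset.mem_Icc.2 ⟨by omega, hΔ.2⟩
    refine le_trans ?_ (Finset.sum_le_sum_of_subset_of_nonneg himg fun b _ _ =>
      Finset.sum_nonneg fun s _ => ?_)
    · rw [Finset.sum_image (by intro x _ y _ h; simpa using h)]
      refine Finset.sum_le_sum fun Δ hΔ => ?_
      simp only [Finset.mem_filter, Finset.mem_Icc] at hΔ
      obtain ⟨s, hs, hsep⟩ := exists_separated (show a < a + Δ by omega)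
        (show a + Δ < 2 ^ scales n by omega)
      refine le_trans ?_ (Finset.single_le_sum
        (f := fun s => if Separated s a (a + Δ) then w s a + w s (a + Δ) else 0)
        (fun s _ => ?_) (Finset.mem_range.2 hs))
      · rw [if_pos hsep]
        exact h.cost_le hs ha1 (by omega) hΔ.2 (by omega) hsep
      · split_ifs
        · exact add_nonneg (hw0 _ _) (hw0 _ _)
        · exact le_rfl
    · split_ifs
      · exact add_nonneg (hw0 _ _) (hw0 _ _)
      · exact le_rfl
  rw [hopCost_seqPath (h.1.trans (Nat.le_succ e))]
  refine (Finset.sum_le_sum h1).trans ?_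
  have h2 : ∀ s, ∑ a ∈ B, ∑ b ∈ B, (if Separated s a b then w s a + w s b else 0) ≤
      ∑ t ∈ B, ((2 ^ s : ℕ) : ℝ) * w s t := by
    intro s
    -- Double counting: position `t` pays `w s t` once for every partner, later or earlier.
    have e1 : ∑ a ∈ B, ∑ b ∈ B, (if Separated s a b then w s a + w s b else 0) =
        ∑ t ∈ B, (((B.filter fun b => Separated s t b).card +
          (B.filter fun a => Separated s a t).card : ℕ) : ℝ) * w s t := by
      have e2 : ∀ a b, (if Separated s a b then w s a + w s b else 0) =
          (if Separated s a b then w s a else 0) + (if Separated s a b then w s b else 0) := by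
        intro a b; split_ifs <;> simp
      simp only [e2, Finset.sum_add_distrib]
      rw [Finset.sum_comm (f := fun a b => if Separated s a b then w s b else 0),
        ← Finset.sum_add_distrib]
      refine Finset.sum_congr rfl fun t _ => ?_
      rw [← Finset.sum_filter, ← Finset.sum_filter, Finset.sum_const, Finset.sum_const,
        nsmul_eq_mul, nsmul_eq_mul]
      push_cast
      ring
    rw [e1]
    refine Finset.sum_le_sum fun t _ => mul_le_mul_of_nonneg_right ?_ (hw0 _ _)
    exact_mod_cast card_separated_le B s t
  calc ∑ a ∈ B, ∑ b ∈ B, ∑ s ∈ Finset.range (scales n),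
        (if Separated s a b then w s a + w s b else 0)
      = ∑ s ∈ Finset.range (scales n), ∑ a ∈ B, ∑ b ∈ B,
        (if Separated s a b then w s a + w s b else 0) := by
        rw [Finset.sum_comm]
        conv_rhs => rw [Finset.sum_comm]
        rw [Finset.sum_comm]
        exact Finset.sum_congr rfl fun a _ => Finset.sum_comm
    _ ≤ ∑ s ∈ Finset.range (scales n), ∑ t ∈ B, ((2 ^ s : ℕ) : ℝ) * w s t :=
        Finset.sum_le_sum fun s _ => h2 s
    _ = ∑ t ∈ B, I.stateCost t (X t) := by
        rw [Finset.sum_comm]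
        rfl

/-! ### The runs of a given path -/

/-- The hub of the block of position `t` at scale `s`: the vertex at its centre. -/
def canonicalHub (v : ℕ → Fin n) (o e s t : ℕ) : ℕ :=
  if o ≤ t / 2 ^ (s + 1) * 2 ^ (s + 1) + 2 ^ s ∧ t / 2 ^ (s + 1) * 2 ^ (s + 1) + 2 ^ s ≤ e then
    (v (t / 2 ^ (s + 1) * 2 ^ (s + 1) + 2 ^ s) : ℕ) else n

/-- The counts and hubs at position `t`. -/
def canonicalList (I : HierInstance (Fin n)) (v : ℕ → Fin n) (o e t : ℕ) : List ℕ :=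
  ((List.range I.L).map fun j => I.sameCount v o (j + 1) (v t) t) ++
    (List.range (scales n)).map fun s => canonicalHub v o e s t

/-- The state at position `t` of the run of the path `v o, …, v e`. -/
def canonicalRun (I : HierInstance (Fin n)) (ℓ : ℕ) (U : List (Fin n × ℕ)) (v : ℕ → Fin n)
    (o e t : ℕ) : PathState n :=
  (v t, ∑ i ∈ Finset.Icc o t, I.gain ℓ U (v i) (I.canonicalList v o e i),
    I.canonicalList v o e t)

theorem canonicalList_getD_level {t j : ℕ} (hj : j < I.L) :
    (I.canonicalList v o e t).getD j 0 = I.sameCount v o (j + 1) (v t) t := by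
  rw [List.getD_eq_getElem _ _ (by simp [canonicalList]; omega)]
  simp only [canonicalList]
  rw [List.getElem_append_left (by simpa using hj)]
  simp

theorem canonicalList_getD_hub {t s : ℕ} (hs : s < scales n) :
    (I.canonicalList v o e t).getD (I.L + s) 0 = canonicalHub v o e s t := by
  have hs' : s < Nat.clog 2 n + 1 := hs
  rw [List.getD_eq_getElem _ _ (by simp [canonicalList]; omega)]
  simp [canonicalList]

theorem canonicalHub_le (s t : ℕ) : canonicalHub v o e s t ≤ n := by
  unfold canonicalHub
  split_ifs
  · exact (v _).isLt.le
  · exact le_rfl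

open Classical in
theorem Increasing.sameCount_le (hv : I.Increasing v o e) {j t : ℕ} {x : Fin n} (ht : t ≤ e) :
    I.sameCount v o j x t ≤ n := by
  calc I.sameCount v o j x t ≤ (Finset.Icc o t).card := Finset.card_filter_le _ _
    _ = ((Finset.Icc o t).image v).card := by
        refine (Finset.card_image_of_injOn fun a ha b hb h => ?_).symm
        rw [Finset.mem_coe, Finset.mem_Icc] at ha hb
        exact hv.injOn ha.1 (by omega) hb.1 (by omega) h
    _ ≤ n := by simpa using Finset.card_le_univ ((Finset.Icc o t).image v)

/-- The central vertex is a legal choice of hub: it changes only when a new block begins, and at the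
centre it is the current vertex. The bound on `U.length` keeps the gain, at most twice the coverage,
within the range of `states`. -/
theorem Increasing.canonicalRun_isRun (hv : I.Increasing v o e) (hoe : o ≤ e)
    (hsame : ∀ t, o ≤ t → t < e → I.Same ℓ (v t) (v (t + 1))) (hU : U.length ≤ n * I.L) :
    I.IsRun ℓ U o e (I.canonicalRun ℓ U v o e) := by
  classical
  refine ⟨hoe, ⟨fun j hj => ?_, by simp [canonicalRun]⟩, fun t h1 h2 => ?_, fun t h1 h2 => ?_⟩
  · show (I.canonicalList v o e o).getD j 0 = 1
    rw [canonicalList_getD_level (List.mem_range.1 hj)]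
    simp [sameCount, Finset.filter_singleton, Same.refl]
  · refine I.mem_states.2 ⟨?_, by simp [canonicalRun, canonicalList], ?_⟩
    · have h3 := Increasing.sum_gain_le (I := I) (ℓ := ℓ) (U := U) (v := v) (o := o) (e := t)
        (z := I.canonicalList v o e) (fun i _ _ j hj => canonicalList_getD_level hj)
        (fun a b ha hab hb => hv a b ha hab (by omega))
      refine h3.trans ?_
      have := List.countP_le_length (l := U)
        (p := fun x => decide (I.Covers (seqPath v o t) ℓ x))
      omega
    · intro a ha
      simp only [canonicalRun, canonicalList, List.mem_append, List.mem_map] at ha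
      rcases ha with ⟨j, -, rfl⟩ | ⟨s, -, rfl⟩
      · exact hv.sameCount_le h2
      · exact canonicalHub_le _ _
  · refine ⟨hv t (t + 1) h1 (by omega) h2, hsame t h1 h2, fun j hj => ?_, fun s hs => ?_, ?_⟩
    · have hj := List.mem_range.1 hj
      show (I.canonicalList v o e (t + 1)).getD j 0 =
        (if I.Same (j + 1) (v t) (v (t + 1)) then (I.canonicalList v o e t).getD j 0 else 0) + 1
      rw [canonicalList_getD_level hj, canonicalList_getD_level hj]
      exact hv.sameCount_step (by omega) (by omega) h1 h2
    · have hs := List.mem_range.1 hs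
      show HubStep n (t + 1) s ((I.canonicalList v o e t).getD (I.L + s) 0)
        ((I.canonicalList v o e (t + 1)).getD (I.L + s) 0)
      rw [canonicalList_getD_hub hs, canonicalList_getD_hub hs]
      by_cases h0 : (t + 1) % 2 ^ (s + 1) = 0
      · exact Or.inl h0
      · have hdiv : (t + 1) / 2 ^ (s + 1) = t / 2 ^ (s + 1) := by
          rw [Nat.succ_div, if_neg (fun h => h0 (Nat.mod_eq_zero_of_dvd h)), add_zero]
        refine Or.inr ⟨by unfold canonicalHub; rw [hdiv], fun h3 => ?_⟩
        have h4 := Nat.div_add_mod' (t + 1) (2 ^ (s + 1))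
        rw [h3] at h4
        unfold canonicalHub
        rw [h4, if_pos ⟨by omega, h2⟩]
        exact (v (t + 1)).isLt
    · show ∑ i ∈ Finset.Icc o (t + 1), _ = ∑ i ∈ Finset.Icc o t, _ + _
      rw [← Finset.insert_Icc_right_eq_Icc_add_one (by omega), Finset.sum_insert (by simp),
        add_comm]
      rfl

/-- With the central hub a position pays for a single edge, to or from the centre at distance `Δ ≤
k`, and this edge is a term of the hop cost. The sum over all `Δ` is written out so that offsets can
be averaged term by term. -/
theorem hubCost_canonicalHub_le {s t : ℕ} :
    I.hubCost t s (v t) (canonicalHub v o e s t) ≤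
      ∑ Δ ∈ Finset.Icc 1 I.k,
        ((if t + Δ ≤ e ∧ (t + Δ) % 2 ^ (s + 1) = 2 ^ s then I.c (v t) (v (t + Δ)) else 0) +
        (if o + Δ ≤ t ∧ (t - Δ) % 2 ^ (s + 1) = 2 ^ s then I.c (v (t - Δ)) (v t) else 0)) := by
  have hnn : ∀ Δ ∈ Finset.Icc 1 I.k, 0 ≤
      ((if t + Δ ≤ e ∧ (t + Δ) % 2 ^ (s + 1) = 2 ^ s then I.c (v t) (v (t + Δ)) else 0) +
        (if o + Δ ≤ t ∧ (t - Δ) % 2 ^ (s + 1) = 2 ^ s then I.c (v (t - Δ)) (v t) else 0)) := by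
    intro Δ _
    refine add_nonneg ?_ ?_ <;> split_ifs <;> first | exact le_rfl | exact I.c_nonneg _ _
  have h0 := Finset.sum_nonneg hnn
  have hle : ∀ (x y : Fin n), I.outCost x y ≤ I.c x y ∧ I.inCost x y ≤ I.c x y := by
    intro x y
    unfold outCost inCost
    rw [dif_pos y.isLt, dif_pos x.isLt]
    constructor <;> split_ifs <;> first | exact le_rfl | exact I.c_nonneg _ _
  have hd := Nat.div_add_mod' t (2 ^ (s + 1))
  have hlt := Nat.mod_lt t (show 0 < 2 ^ (s + 1) by positivity)
  have hpos : 0 < 2 ^ s := by positivity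
  have hC : (t / 2 ^ (s + 1) * 2 ^ (s + 1) + 2 ^ s) % 2 ^ (s + 1) = 2 ^ s := by
    rw [Nat.mul_add_mod_self_right, Nat.mod_eq_of_lt]
    rw [pow_succ]; omega
  unfold canonicalHub
  set C := t / 2 ^ (s + 1) * 2 ^ (s + 1) + 2 ^ s with hCdef
  unfold hubCost
  split_ifs with h1 h2 h3 h2 h3
  · refine le_trans ?_ (Finset.single_le_sum hnn
      (Finset.mem_Icc.2 (show 1 ≤ C - t ∧ C - t ≤ I.k by omega)))
    rw [show t + (C - t) = C by omega, if_pos ⟨h3.2, hC⟩]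
    refine le_trans (hle _ _).1 (le_add_of_nonneg_right ?_)
    split_ifs <;> first | exact le_rfl | exact I.c_nonneg _ _
  · simpa [outCost] using h0
  · exact h0
  -- The centre belongs to the second half of its block; the vertex there is its own hub and pays
  -- nothing.
  · rcases Nat.eq_or_lt_of_le (show C ≤ t by omega) with h4 | h4
    · rw [h4, inCost, dif_pos (v t).isLt, if_pos rfl]
      exact h0
    · refine le_trans ?_ (Finset.single_le_sum hnn
        (Finset.mem_Icc.2 (show 1 ≤ t - C ∧ t - C ≤ I.k by omega)))
      rw [show t - (t - C) = C by omega, if_pos (c := o + (t - C) ≤ t ∧ _) ⟨by omega, hC⟩]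
      refine le_trans (hle _ _).2 (le_add_of_nonneg_left ?_)
      split_ifs <;> first | exact le_rfl | exact I.c_nonneg _ _
  · simpa [inCost] using h0
  · exact h0

/-- Solutions of the congruence are at least `2 ^ (s + 1)` apart, so each of the `2 ^ (m - s)`
intervals of length `2 ^ s` contains at most one. In this form the bound includes the top scale `s =
m`. -/
theorem card_offsets_le {m s : ℕ} (hs : s ≤ m) (a : ℕ) :
    ((Finset.range (2 ^ m)).filter fun o => (o + a) % 2 ^ (s + 1) = 2 ^ s).card * 2 ^ s ≤
      2 ^ m := by
  have hpos : 0 < 2 ^ s := by positivity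
  have h : ((Finset.range (2 ^ m)).filter fun o => (o + a) % 2 ^ (s + 1) = 2 ^ s).card ≤
      (Finset.range (2 ^ (m - s))).card := by
    refine Finset.card_le_card_of_injOn (fun o => o / 2 ^ s) (fun o ho => ?_) ?_
    · have h1 := Finset.mem_range.1 (Finset.mem_filter.1 ho).1
      rw [Finset.mem_coe, Finset.mem_range, Nat.div_lt_iff_lt_mul hpos, ← pow_add,
        Nat.sub_add_cancel hs]
      exact h1
    · have key : ∀ o o', o ≤ o' → (o + a) % 2 ^ (s + 1) = 2 ^ s → (o' + a) % 2 ^ (s + 1) = 2 ^ s →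
          o / 2 ^ s = o' / 2 ^ s → o = o' := by
        intro o o' hle h1 h2 h3
        have h4 := Nat.sub_mod_eq_zero_of_mod_eq (h2.trans h1.symm)
        rw [show o' + a - (o + a) = o' - o by omega] at h4
        have h5 := Nat.div_add_mod o (2 ^ s)
        have h6 := Nat.div_add_mod o' (2 ^ s)
        have h7 := Nat.mod_lt o hpos
        have h8 := Nat.mod_lt o' hpos
        rw [h3] at h5
        rw [Nat.mod_eq_of_lt (by rw [pow_succ]; omega)] at h4
        omega
      intro o ho o' ho' h3
      have h1 := (Finset.mem_filter.1 ho).2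
      have h2 := (Finset.mem_filter.1 ho').2
      rcases le_total o o' with h | h
      · exact key o o' h h1 h2 h3
      · exact (key o' o h h2 h1 h3.symm).symm
  rw [Finset.card_range] at h
  calc _ ≤ 2 ^ (m - s) * 2 ^ s := Nat.mul_le_mul_right _ h
    _ = 2 ^ m := by rw [← pow_add, Nat.sub_add_cancel hs]

theorem sum_backward_eq (r k : ℕ) (f : ℕ → ℕ → ℝ) :
    ∑ i ∈ Finset.range r, ∑ Δ ∈ Finset.Icc 1 k, (if Δ ≤ i then f (i - Δ) Δ else 0) =
      ∑ i ∈ Finset.range r, ∑ Δ ∈ Finset.Icc 1 k, if i + Δ < r then f i Δ else 0 := by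
  rw [Finset.sum_comm]
  conv_rhs => rw [Finset.sum_comm]
  refine Finset.sum_congr rfl fun Δ _ => ?_
  rw [← Finset.sum_filter, ← Finset.sum_filter]
  refine Finset.sum_nbij' (fun i => i - Δ) (fun i => i + Δ) ?_ ?_ ?_ ?_ ?_
  all_goals
    intro i hi
    simp only [Finset.mem_filter, Finset.mem_range] at hi ⊢
    try omega

/-- For some offset the cost of the run of a path is small. -/
theorem exists_offset {v : ℕ → Fin n} {r : ℕ} (hr : 0 < r) :
    ∃ o < 2 ^ Nat.clog 2 n, ∑ t ∈ Finset.Icc o (o + r - 1), ∑ s ∈ Finset.range (scales n),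
      ((2 ^ s : ℕ) : ℝ) * I.hubCost t s (v (t - o))
        (canonicalHub (fun t => v (t - o)) o (o + r - 1) s t) ≤
      2 * scales n * I.hopCost (seqPath v 0 (r - 1)) := by
  set m := Nat.clog 2 n with hm
  set F : ℕ → ℕ → ℝ := fun i Δ => I.c (v i) (v (i + Δ)) with hF
  have hF0 : ∀ i Δ, 0 ≤ F i Δ := fun _ _ => I.c_nonneg _ _
  set W := ∑ i ∈ Finset.range r, ∑ Δ ∈ Finset.Icc 1 I.k, if i + Δ < r then F i Δ else 0 with hW
  have hWhop : I.hopCost (seqPath v 0 (r - 1)) = W := by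
    rw [hopCost_seqPath (by omega), hW, ← Finset.Ico_add_one_right_eq_Icc,
      Finset.range_eq_Ico, Nat.sub_add_cancel (show 1 ≤ r from hr)]
    refine Finset.sum_congr rfl fun i _ => Finset.sum_congr rfl fun Δ _ => ?_
    simp only [show (i + Δ ≤ r - 1 ↔ i + Δ < r) by omega, hF]
  rw [hWhop]
  -- At offset `o`, the edges of hop length `Δ` from and to the vertex with index `i` count only if
  -- their other end sits at a centre.
  set G : ℕ → ℕ → ℕ → ℕ → ℝ := fun o s i Δ =>
    (if i + Δ < r then (if (o + (i + Δ)) % 2 ^ (s + 1) = 2 ^ s then F i Δ else 0) else 0) +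
    (if Δ ≤ i then (if (o + (i - Δ)) % 2 ^ (s + 1) = 2 ^ s then F (i - Δ) Δ else 0) else 0) with hG
  have hterm : ∀ o, ∑ t ∈ Finset.Icc o (o + r - 1), ∑ s ∈ Finset.range (scales n),
      ((2 ^ s : ℕ) : ℝ) * I.hubCost t s (v (t - o))
        (canonicalHub (fun t => v (t - o)) o (o + r - 1) s t) ≤
      ∑ i ∈ Finset.range r, ∑ s ∈ Finset.range (scales n),
        ((2 ^ s : ℕ) : ℝ) * ∑ Δ ∈ Finset.Icc 1 I.k, G o s i Δ := by
    intro o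
    rw [← Finset.Ico_add_one_right_eq_Icc, Finset.sum_Ico_eq_sum_range,
      show o + r - 1 + 1 - o = r by omega]
    refine Finset.sum_le_sum fun i hi => Finset.sum_le_sum fun s _ =>
      mul_le_mul_of_nonneg_left ?_ (by positivity)
    have hi := Finset.mem_range.1 hi
    refine (hubCost_canonicalHub_le (v := fun t => v (t - o)) (s := s)).trans (le_of_eq ?_)
    refine Finset.sum_congr rfl fun Δ hΔ => ?_
    have hΔ := Finset.mem_Icc.1 hΔ
    simp only [hG, hF]
    congr 1
    · rw [← ite_and, ← add_assoc]
      simp only [show (o + i + Δ ≤ o + r - 1 ↔ i + Δ < r) by omega,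
        show o + i + Δ - o = i + Δ by omega, show o + i - o = i by omega]
    · by_cases h : Δ ≤ i
      · rw [← ite_and]
        simp only [show (o + Δ ≤ o + i ↔ Δ ≤ i) by omega,
          show o + (i - Δ) - o = i - Δ by omega, show o + i - o = i by omega,
          show o + i - Δ = o + (i - Δ) by omega, show i - Δ + Δ = i by omega]
      · rw [if_neg (by omega), if_neg h]
  -- At most `2 ^ (m - s)` of the `2 ^ m` offsets put a given vertex at a centre of scale `s`, which
  -- cancels the weight `2 ^ s`.
  have hG0 : ∀ i Δ s, s ≤ m → ∑ o ∈ Finset.range (2 ^ m), ((2 ^ s : ℕ) : ℝ) * G o s i Δ ≤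
      (2 ^ m : ℕ) * ((if i + Δ < r then F i Δ else 0) + if Δ ≤ i then F (i - Δ) Δ else 0) := by
    intro i Δ s hs
    have key : ∀ (a : ℕ) (y : ℝ), 0 ≤ y → ∑ o ∈ Finset.range (2 ^ m), ((2 ^ s : ℕ) : ℝ) *
        (if (o + a) % 2 ^ (s + 1) = 2 ^ s then y else 0) ≤ (2 ^ m : ℕ) * y := by
      intro a y hy
      rw [← Finset.mul_sum, ← Finset.sum_filter, Finset.sum_const, nsmul_eq_mul, ← mul_assoc]
      refine mul_le_mul_of_nonneg_right ?_ hy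
      have := card_offsets_le hs a
      rw [mul_comm] at this
      exact_mod_cast this
    simp only [hG, mul_add, Finset.sum_add_distrib]
    refine add_le_add ?_ ?_
    · split_ifs
      · exact key _ _ (hF0 _ _)
      · simp
    · split_ifs
      · exact key _ _ (hF0 _ _)
      · simp
  -- Averaging over all offsets. The factor `2` arises because every edge is counted from both of
  -- its ends, as `sum_backward_eq` shows.
  obtain ⟨o, ho, h⟩ := Finset.exists_le_of_sum_le (s := Finset.range (2 ^ m))
    (f := fun o => ∑ i ∈ Finset.range r, ∑ s ∈ Finset.range (scales n),
        ((2 ^ s : ℕ) : ℝ) * ∑ Δ ∈ Finset.Icc 1 I.k, G o s i Δ)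
    (g := fun _ => 2 * scales n * W) ⟨0, by simp⟩ (by
      calc ∑ o ∈ Finset.range (2 ^ m), ∑ i ∈ Finset.range r, ∑ s ∈ Finset.range (scales n),
            ((2 ^ s : ℕ) : ℝ) * ∑ Δ ∈ Finset.Icc 1 I.k, G o s i Δ
          = ∑ s ∈ Finset.range (scales n), ∑ i ∈ Finset.range r, ∑ Δ ∈ Finset.Icc 1 I.k,
              ∑ o ∈ Finset.range (2 ^ m), ((2 ^ s : ℕ) : ℝ) * G o s i Δ := by
            simp only [Finset.mul_sum]
            rw [Finset.sum_comm]
            conv_rhs => rw [Finset.sum_comm]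
            refine Finset.sum_congr rfl fun i _ => ?_
            rw [Finset.sum_comm]
            refine Finset.sum_congr rfl fun s _ => ?_
            rw [Finset.sum_comm]
        _ ≤ ∑ s ∈ Finset.range (scales n), ∑ i ∈ Finset.range r, ∑ Δ ∈ Finset.Icc 1 I.k,
              (2 ^ m : ℕ) * ((if i + Δ < r then F i Δ else 0) +
                if Δ ≤ i then F (i - Δ) Δ else 0) := by
            refine Finset.sum_le_sum fun s hs => Finset.sum_le_sum fun i _ =>
              Finset.sum_le_sum fun Δ _ => hG0 i Δ s ?_
            have := Finset.mem_range.1 hs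
            simp only [scales] at this
            omega
        _ = ∑ o ∈ Finset.range (2 ^ m), 2 * scales n * W := by
            simp only [← Finset.mul_sum, Finset.sum_add_distrib]
            rw [sum_backward_eq r I.k F]
            simp only [Finset.sum_const, Finset.card_range, nsmul_eq_mul]
            push_cast
            ring)
  exact ⟨o, Finset.mem_range.1 ho, (hterm o).trans h⟩

end HierInstance
end

/-! ### Set cover, the approximate oracle and the greedy analysis -/

noncomputable section

namespace HierInstance

variable {n : ℕ} {I : HierInstance (Fin n)} {ℓ : ℕ} {U : List (Fin n × ℕ)}

/-! ### Solutions as set covers -/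

theorem pairwise_of_isMonotonePath {P : List (Fin n)} (h : I.IsMonotonePath P) :
    P.Pairwise I.lt := by
  have := I.lt_total
  exact h.2.pairwise

theorem nodup_of_isMonotonePath {P : List (Fin n)} (h : I.IsMonotonePath P) : P.Nodup := by
  have := I.lt_total
  exact (pairwise_of_isMonotonePath h).imp fun h => ne_of_irrefl h

open Classical in
theorem sum_same_eq_card {P : List (Fin n)} (hP : P.Nodup) {j : ℕ} {x : Fin n}
    {H : Finset (Fin n)} (hH : H ∈ (I.𝓗 j).parts) (hx : x ∈ H) :
    (P.map fun y => if I.Same j x y then 1 else 0).sum = (P.toFinset ∩ H).card := by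
  rw [← List.sum_toFinset _ hP, ← Finset.card_filter]
  congr 1
  ext y
  simp only [Finset.mem_filter, Finset.mem_inter, and_congr_right_iff]
  intro _
  refine ⟨fun ⟨H', hH', hx', hy⟩ => ?_, fun hy => ⟨H, hH, hx, hy⟩⟩
  obtain rfl := (I.𝓗 j).eq_of_mem_parts hH hH' hx hx'
  exact hy

theorem IsSolution.exists_covers {S : Finset (List (Fin n) × ℕ)} (hS : I.IsSolution S)
    {e : Fin n × ℕ} (he : e ∈ I.elements) : ∃ p ∈ S, I.Covers p.1 p.2 e := by
  classical
  obtain ⟨x, j⟩ := e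
  obtain ⟨h1, h2⟩ := I.mem_elements.1 he
  obtain ⟨hp, ha, hb⟩ := hS
  rcases h2.lt_or_eq with h3 | h3
  · obtain ⟨H, hH, hx⟩ := (I.𝓗 (j + 1)).exists_mem (Finset.mem_univ x)
    rcases hb (j + 1) (by simp only at h1; omega) h3 H hH with h | ⟨p, hpS, h4, h5⟩
    · obtain ⟨p, hpS, h4, h5⟩ := h x hx
      exact ⟨p, hpS, Nat.le_of_lt_succ h4, Or.inl ⟨x, h5, rfl⟩⟩
    · refine ⟨p, hpS, Nat.le_of_lt_succ h4, Or.inr ⟨h3, ?_⟩⟩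
      rw [sum_same_eq_card (nodup_of_isMonotonePath (hp p hpS).1) hH hx]
      convert h5
  · obtain ⟨p, hpS, h4⟩ := ha x
    exact ⟨p, hpS, (hp p hpS).2.2.1.trans h3.ge, Or.inl ⟨x, h4, rfl⟩⟩

/-- For a part at level `j + 1`, if one of its elements `(x, j)` is covered by `k` vertices of the
part, then the second alternative of (b) holds for the whole part. Otherwise every `(x, j)` is
covered by a visit to `x`, which is the first alternative. -/
theorem isSolution_of_covers {S : Finset (List (Fin n) × ℕ)}
    (hp : ∀ p ∈ S, I.IsPathLevelPair p)
    (hc : ∀ e ∈ I.elements, ∃ p ∈ S, I.Covers p.1 p.2 e) : I.IsSolution S := by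
  classical
  have hL := I.one_le_L
  refine ⟨hp, fun v => ?_, fun ℓ h2 hℓ H hH => ?_⟩
  · obtain ⟨p, hpS, -, ⟨y, hy, rfl⟩ | ⟨h, -⟩⟩ := hc (v, I.L) (I.mem_elements.2 ⟨hL, le_rfl⟩)
    · exact ⟨p, hpS, hy⟩
    · exact absurd h (lt_irrefl _)
  · obtain ⟨j, rfl⟩ : ∃ j, ℓ = j + 1 := ⟨ℓ - 1, by omega⟩
    by_cases hheavy : ∃ x ∈ H, ∃ p ∈ S, p.2 ≤ j ∧
        I.k ≤ (p.1.map fun y => if I.Same (j + 1) x y then 1 else 0).sum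
    · obtain ⟨x, hx, p, hpS, h3, h4⟩ := hheavy
      refine Or.inr ⟨p, hpS, Nat.lt_succ_of_le h3, ?_⟩
      rw [sum_same_eq_card (nodup_of_isMonotonePath (hp p hpS).1) hH hx] at h4
      convert h4
    · refine Or.inl fun x hx => ?_
      obtain ⟨p, hpS, h3, ⟨y, hy, rfl⟩ | ⟨h4, h5⟩⟩ :=
        hc (x, j) (I.mem_elements.2 ⟨by simp only; omega, by simp only; omega⟩)
      · exact ⟨p, hpS, Nat.lt_succ_of_le h3, hy⟩
      · exact absurd ⟨x, hx, p, hpS, h3, h5⟩ hheavy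

theorem IsPathLevelPair.weight_nonneg {p : List (Fin n) × ℕ} (hp : I.IsPathLevelPair p) :
    0 ≤ I.pairWeight p := by
  have := I.D_nonneg p.2 hp.2.1 hp.2.2.1
  exact add_nonneg (hopCost_nonneg _) (mul_nonneg (by positivity) (by exact_mod_cast this))

/-! ### The candidates -/

open Classical in
/-- The number of elements of `U` that are covered by a pair. -/
def coverCount (I : HierInstance (Fin n)) (U : List (Fin n × ℕ)) (p : List (Fin n) × ℕ) : ℕ :=
  U.countP fun e => I.Covers p.1 p.2 e

theorem exists_label (hk : 1 ≤ I.k) (hU : U.length ≤ n * I.L) {P : List (Fin n)}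
    (hP : I.IsPathLevelPair (P, ℓ)) :
    ∃ a ∈ I.labels ℓ U, a.2.1 ≤ 2 * scales n * I.hopCost P ∧ I.coverCount U (P, ℓ) ≤ a.1.2.1 := by
  obtain ⟨hmono, -, -, H, hH, hPH⟩ := hP
  have hpw := pairwise_of_isMonotonePath hmono
  have hne := hmono.1
  obtain ⟨r, hr⟩ : ∃ r, r = P.length := ⟨_, rfl⟩
  have hr0 : 0 < r := hr ▸ List.length_pos_iff.2 hne
  -- Beyond the end the sequence is padded by the first vertex; these values are never used.
  set v : ℕ → Fin n := fun i => P.getD i (P.head hne) with hv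
  have hvi : ∀ i (hi : i < P.length), v i = P[i] := fun i hi => List.getD_eq_getElem _ _ hi
  have hpath : ∀ o, seqPath (fun t => v (t - o)) o (o + r - 1) = P := by
    intro o
    refine List.ext_getElem (by simp [seqPath]; omega) fun i h1 h2 => ?_
    simp only [seqPath, List.getElem_map, List.getElem_range', one_mul, Nat.add_sub_cancel_left]
    exact hvi i h2
  obtain ⟨o, ho, hcost⟩ := exists_offset (I := I) (v := v) hr0
  have hpath0 : seqPath v 0 (r - 1) = P := by simpa using hpath 0
  rw [hpath0] at hcost
  have hinc : I.Increasing (fun t => v (t - o)) o (o + r - 1) := by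
    intro a b ha hab hb
    simp only
    rw [hvi _ (by omega), hvi _ (by omega)]
    exact List.pairwise_iff_getElem.1 hpw _ _ _ _ (by omega)
  have hsame : ∀ t, o ≤ t → t < o + r - 1 → I.Same ℓ (v (t - o)) (v (t + 1 - o)) := by
    intro t h1 h2
    rw [hvi _ (by omega), hvi _ (by omega)]
    exact ⟨H, hH, hPH _ (List.getElem_mem _), hPH _ (List.getElem_mem _)⟩
  have hrun := hinc.canonicalRun_isRun (by omega) hsame hU
  -- With `o < 2 ^ Nat.clog 2 n` and `r ≤ n ≤ 2 ^ Nat.clog 2 n` the run ends before `2 ^ scales n`;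
  -- this is why there is one scale more than `Nat.clog 2 n`.
  have hrn : r ≤ n := by
    have := (nodup_of_isMonotonePath hmono).length_le_card
    simpa [← hr] using this
  have hn2 : n ≤ 2 ^ Nat.clog 2 n := Nat.le_pow_clog (by norm_num) n
  obtain ⟨a, ha, h1, h2⟩ := exists_mem_table_of_run hrun
  refine ⟨a, mem_labels.2 ⟨o + r - 1, ?_, ha⟩, h2.trans (le_trans (le_of_eq ?_) hcost), ?_⟩
  · show _ < 2 ^ (_ + 1)
    rw [pow_succ]
    omega
  · refine Finset.sum_congr rfl fun t ht => ?_
    change ∑ s ∈ Finset.range (scales n), _ = _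
    refine Finset.sum_congr rfl fun s hs => ?_
    rw [show (I.canonicalRun ℓ U (fun t => v (t - o)) o (o + r - 1) t).2.2 =
      I.canonicalList (fun t => v (t - o)) o (o + r - 1) t from rfl,
      canonicalList_getD_hub (Finset.mem_range.1 hs)]
    rfl
  · rw [h1, hrun.gain (by omega) le_rfl]
    have := countP_le_sum_gain (I := I) (ℓ := ℓ) (U := U) (v := fun t => v (t - o)) (o := o)
      (e := o + r - 1) (z := I.canonicalList (fun t => v (t - o)) o (o + r - 1))
      (fun i _ _ j hj => canonicalList_getD_level hj) hk
    rw [hpath] at this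
    exact this

/-- What a label tells about its path. -/
theorem label_sound {a : PathLabel n} (ha : a ∈ I.labels ℓ U) (h1 : 1 ≤ ℓ) (h2 : ℓ ≤ I.L) :
    I.IsPathLevelPair (a.2.2.reverse, ℓ) ∧ I.hopCost a.2.2.reverse ≤ a.2.1 ∧
      a.1.2.1 ≤ 2 * I.coverCount U (a.2.2.reverse, ℓ) ∧ a.1 ∈ I.states ∧
      a.2.2.length ≤ 2 ^ scales n := by
  obtain ⟨t, ht, ha⟩ := mem_labels.1 ha
  obtain ⟨o, X, hrun, hX, hc, hP⟩ := exists_run_of_mem_table ha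
  have hP' : a.2.2.reverse = seqPath (fun t => (X t).1) o t := hP
  refine ⟨hP' ▸ hrun.isPathLevelPair h1 h2, ?_, ?_, ?_, ?_⟩
  · rw [hP', hc]
    exact hrun.hopCost_le ht
  · rw [← hX, hrun.gain hrun.1 le_rfl, hP']
    exact hrun.increasing.sum_gain_le fun i hi1 hi2 j hj => hrun.getD hi1 hi2 hj
  · rw [← hX]
    exact hrun.2.2.1 t hrun.1 le_rfl
  · rw [← List.length_reverse, hP]
    simp only [List.length_map, List.length_range']
    omega

theorem mem_candidates {c : (ℝ × ℕ) × List (Fin n) × ℕ} : c ∈ I.candidates U ↔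
    ∃ j < I.L, ∃ a ∈ I.labels (j + 1) U, 1 ≤ a.1.2.1 ∧
      c = ((a.2.1 + I.k * (I.k * (I.D (j + 1) : ℝ)), a.1.2.1), a.2.2.reverse, j + 1) := by
  unfold candidates
  simp only [List.mem_flatMap, List.mem_range]
  refine exists_congr fun j => and_congr_right fun _ => exists_congr fun a =>
    and_congr_right fun _ => ?_
  split_ifs with h <;> simp [h]

theorem candidate_sound {c : (ℝ × ℕ) × List (Fin n) × ℕ} (hc : c ∈ I.candidates U) :
    I.IsPathLevelPair c.2 ∧ I.pairWeight c.2 ≤ c.1.1 ∧ 1 ≤ c.1.2 ∧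
      c.1.2 ≤ 2 * I.coverCount U c.2 ∧ c.1.2 ≤ 2 * (n * I.L) ∧
      c.2.1.length ≤ 2 ^ scales n := by
  obtain ⟨j, hj, a, ha, h1, rfl⟩ := mem_candidates.1 hc
  obtain ⟨h2, h3, h4, h5, h6⟩ := label_sound ha (by omega) hj
  refine ⟨h2, ?_, h1, h4, (I.mem_states.1 h5).1, by simpa using h6⟩
  simp only [pairWeight]
  linarith [sq (I.k : ℝ), mul_assoc (I.k : ℝ) I.k (I.D (j + 1))]

/-- Only the hop cost is approximated. The term `k ^ 2 * D` is exact and nonnegative, so the factor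
`2 * scales n ≥ 1` may be applied to it too. -/
theorem exists_candidate (hk : 1 ≤ I.k) (hU : U.length ≤ n * I.L) {p : List (Fin n) × ℕ}
    (hp : I.IsPathLevelPair p) (hcov : 1 ≤ I.coverCount U p) :
    ∃ c ∈ I.candidates U, c.1.1 ≤ 2 * scales n * I.pairWeight p ∧ I.coverCount U p ≤ c.1.2 := by
  obtain ⟨P, ℓ⟩ := p
  obtain ⟨a, ha, h1, h2⟩ := exists_label hk hU hp
  obtain ⟨-, h3, h4, -⟩ := id hp
  obtain ⟨j, rfl⟩ : ∃ j, ℓ = j + 1 := ⟨ℓ - 1, by simp only at h3; omega⟩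
  refine ⟨_, mem_candidates.2 ⟨j, h4, a, ha, hcov.trans h2, rfl⟩, ?_, h2⟩
  have hD : (0 : ℝ) ≤ I.D (j + 1) := by exact_mod_cast I.D_nonneg (j + 1) h3 h4
  have h5 : (0 : ℝ) ≤ (I.k : ℝ) ^ 2 * I.D (j + 1) := by positivity
  have h6 : (1 : ℝ) ≤ scales n := by exact_mod_cast Nat.succ_le_succ (Nat.zero_le _)
  simp only [pairWeight]
  nlinarith

theorem ratio_trans {a b c : ℝ × ℕ} (ha : 1 ≤ a.2) (hb : 1 ≤ b.2) (hc : 1 ≤ c.2)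
    (hab : (b.2 : ℝ) * a.1 ≤ a.2 * b.1) (hbc : (c.2 : ℝ) * b.1 ≤ b.2 * c.1) :
    (c.2 : ℝ) * a.1 ≤ a.2 * c.1 := by
  have ha' : (0 : ℝ) < a.2 := by exact_mod_cast ha
  have hb' : (0 : ℝ) < b.2 := by exact_mod_cast hb
  have hc' : (0 : ℝ) < c.2 := by exact_mod_cast hc
  have h1 := mul_le_mul_of_nonneg_left hab hc'.le
  have h2 := mul_le_mul_of_nonneg_left hbc ha'.le
  refine le_of_mul_le_mul_left ?_ hb'
  linarith

/-- The chosen candidate has the best ratio. -/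
theorem exists_mem_choice {c : (ℝ × ℕ) × List (Fin n) × ℕ} (hc : c ∈ I.candidates U) :
    ∃ b ∈ I.choice U, (c.1.2 : ℝ) * b.1.1 ≤ b.1.2 * c.1.1 :=
  exists_mem_bestBy (r := fun a b : (ℝ × ℕ) × List (Fin n) × ℕ =>
      (b.1.2 : ℝ) * a.1.1 ≤ a.1.2 * b.1.1)
    (fun a => 1 ≤ a.1.2) (fun _ ha => (candidate_sound ha).2.2.1)
    (fun _ _ _ _ => le_total _ _) (fun _ _ _ ha hb hc hab hbc => ratio_trans ha hb hc hab hbc) hc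

/-- An uncovered element `(x, j)` is covered by the path with the single vertex `x` at level `j`, so
there is always a candidate. -/
theorem exists_choice_eq (hk : 1 ≤ I.k) (hU : U.length ≤ n * I.L) (hne : U ≠ [])
    (hsub : ∀ e ∈ U, e ∈ I.elements) : ∃ c, I.choice U = [c] := by
  obtain ⟨e, he⟩ := List.exists_mem_of_ne_nil U hne
  obtain ⟨h1, h2⟩ := I.mem_elements.1 (hsub e he)
  have hp : I.IsPathLevelPair ([e.1], e.2) := by
    obtain ⟨H, hH, hx⟩ := (I.𝓗 e.2).exists_mem (Finset.mem_univ e.1)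
    exact ⟨⟨by simp, by simp⟩, h1, h2, H, hH, by simpa using hx⟩
  have hcov : 1 ≤ I.coverCount U ([e.1], e.2) := by
    classical
    exact List.countP_pos_iff.2 ⟨e, he, by simp [Covers]⟩
  obtain ⟨c, hc, -⟩ := exists_candidate hk hU hp hcov
  obtain ⟨b, hb, -⟩ := exists_mem_choice hc
  have hlen : (I.choice U).length ≤ 1 := bestBy_length _ _
  match h : I.choice U with
  | [] => simp [h] at hb
  | [c] => exact ⟨c, rfl⟩
  | _ :: _ :: _ => simp [h] at hlen
/-- The weight of the chosen pair, compared with a solution. -/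
theorem choice_weight_le (hk : 1 ≤ I.k) (hU : U.length ≤ n * I.L)
    (hsub : ∀ e ∈ U, e ∈ I.elements) {c : (ℝ × ℕ) × List (Fin n) × ℕ} (hc : I.choice U = [c])
    {S : Finset (List (Fin n) × ℕ)} (hS : I.IsSolution S) :
    U.length * I.pairWeight c.2 ≤ I.coverCount U c.2 * (4 * scales n * I.weight S) := by
  classical
  obtain ⟨h1, h2, h3, h4, -⟩ := candidate_sound (mem_of_mem_bestBy (as := I.candidates U)
    (show c ∈ I.choice U by simp [hc]))
  have hw := h1.weight_nonneg
  have hq : (0 : ℝ) ≤ c.1.2 := by positivity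
  have h4' : (c.1.2 : ℝ) ≤ 2 * I.coverCount U c.2 := by exact_mod_cast h4
  -- Every pair of the solution is matched by a candidate of nearly its weight and no smaller gain,
  -- and the choice has a ratio at least as good as this candidate.
  have hterm : ∀ p ∈ S,
      (I.coverCount U p : ℝ) * c.1.1 ≤ c.1.2 * (2 * scales n * I.pairWeight p) := by
    intro p hp
    have hpw := (hS.1 p hp).weight_nonneg
    rcases Nat.eq_zero_or_pos (I.coverCount U p) with h0 | h0
    · rw [h0]
      simp only [Nat.cast_zero, zero_mul]
      positivity
    · obtain ⟨d, hd, h5, h6⟩ := exists_candidate hk hU (hS.1 p hp) h0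
      obtain ⟨b, hb, h7⟩ := exists_mem_choice hd
      obtain rfl : b = c := by simpa [hc] using hb
      have h6' : (I.coverCount U p : ℝ) ≤ d.1.2 := by exact_mod_cast h6
      calc (I.coverCount U p : ℝ) * b.1.1 ≤ d.1.2 * b.1.1 :=
            mul_le_mul_of_nonneg_right h6' (hw.trans h2)
        _ ≤ b.1.2 * d.1.1 := h7
        _ ≤ _ := mul_le_mul_of_nonneg_left h5 hq
  -- Every uncovered element is covered by some pair of `S`; summing the previous bounds over `S`
  -- gives the usual averaging argument for greedy set cover.
  have hcount : U.length ≤ ∑ p ∈ S, I.coverCount U p := by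
    have key : ∀ V : List (Fin n × ℕ), (∀ e ∈ V, e ∈ I.elements) →
        V.length ≤ ∑ p ∈ S, I.coverCount V p := by
      intro V
      induction V with
      | nil => simp
      | cons e V ih =>
        intro hV
        obtain ⟨p, hp, hcov⟩ := hS.exists_covers (hV e (by simp))
        have h8 := ih fun e he => hV e (by simp [he])
        have h9 : ∀ p, I.coverCount (e :: V) p =
            I.coverCount V p + if I.Covers p.1 p.2 e then 1 else 0 := by
          intro p
          simp [coverCount, List.countP_cons]
        simp only [h9, Finset.sum_add_distrib, List.length_cons]
        have h10 : 1 ≤ ∑ p ∈ S, if I.Covers p.1 p.2 e then 1 else 0 := by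
          rw [← Finset.card_filter]
          exact Finset.card_pos.2 ⟨p, Finset.mem_filter.2 ⟨hp, hcov⟩⟩
        omega
    exact key U hsub
  have hW : 0 ≤ I.weight S := Finset.sum_nonneg fun p hp => (hS.1 p hp).weight_nonneg
  calc (U.length : ℝ) * I.pairWeight c.2 ≤ U.length * c.1.1 :=
        mul_le_mul_of_nonneg_left h2 (by positivity)
    _ ≤ (∑ p ∈ S, (I.coverCount U p : ℝ)) * c.1.1 :=
        mul_le_mul_of_nonneg_right (by exact_mod_cast hcount) (hw.trans h2)
    _ ≤ ∑ p ∈ S, c.1.2 * (2 * scales n * I.pairWeight p) := by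
        rw [Finset.sum_mul]
        exact Finset.sum_le_sum hterm
    _ = c.1.2 * (2 * scales n * I.weight S) := by rw [← Finset.mul_sum, ← Finset.mul_sum]; rfl
    _ ≤ 2 * I.coverCount U c.2 * (2 * scales n * I.weight S) :=
        mul_le_mul_of_nonneg_right h4' (by positivity)
    _ = _ := by ring

/-! ### The greedy algorithm -/

/-- The difference consists of the `d` reciprocals of `m - d + 1, …, m`, each at least `1 / m`. -/
theorem div_le_harmonic_sub {d m : ℕ} (h : d ≤ m) :
    (d : ℝ) / m ≤ (harmonic m : ℝ) - (harmonic (m - d) : ℝ) := by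
  induction d with
  | zero => simp
  | succ d ih =>
    have h1 := ih (by omega)
    obtain ⟨r, hr⟩ : ∃ r, m - d = r + 1 := ⟨m - d - 1, by omega⟩
    rw [hr, harmonic_succ] at h1
    rw [show m - (d + 1) = r by omega]
    push_cast at h1 ⊢
    have h2 : (m : ℝ)⁻¹ ≤ ((r : ℝ) + 1)⁻¹ := by
      refine inv_anti₀ (by positivity) ?_
      exact_mod_cast (show r + 1 ≤ m by omega)
    rw [add_div, one_div]
    linarith

/-- The invariant of the greedy algorithm. -/
structure GreedyInv (I : HierInstance (Fin n))
    (c : List (Fin n × ℕ) × List (List (Fin n) × ℕ)) : Prop where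
  length_le : c.1.length ≤ n * I.L
  mem_elements : ∀ e ∈ c.1, e ∈ I.elements
  isPathLevelPair : ∀ p ∈ c.2, I.IsPathLevelPair p
  covers : ∀ e ∈ I.elements, e ∈ c.1 ∨ ∃ p ∈ c.2, I.Covers p.1 p.2 e
  weight_le : ∀ S, I.IsSolution S → (c.2.map I.pairWeight).sum ≤
    4 * scales n * I.weight S * ((harmonic (n * I.L) : ℝ) - (harmonic c.1.length : ℝ))

theorem greedyInv_init : I.GreedyInv (I.elements, []) where
  length_le := I.length_elements.le
  mem_elements := fun _ he => he
  isPathLevelPair := by simp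
  covers := fun _ he => Or.inl he
  weight_le := by simp [length_elements]

/-- A pair that covers `d` of the `m` remaining elements weighs at most `d / m` times `4 * scales n
* weight S`, and `d / m` is at most the drop of the harmonic potential. -/
theorem GreedyInv.step (hk : 1 ≤ I.k) {c : List (Fin n × ℕ) × List (List (Fin n) × ℕ)}
    (hc : I.GreedyInv c) : I.GreedyInv (I.greedyStep c) ∧
      (I.greedyStep c).1.length ≤ c.1.length - 1 := by
  classical
  rcases eq_or_ne c.1 [] with h0 | hne
  · have hcand : I.choice c.1 = [] := by
      refine List.eq_nil_iff_forall_not_mem.2 fun b hb => ?_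
      obtain ⟨-, -, h1, h2, -⟩ := candidate_sound (mem_of_mem_bestBy (as := I.candidates c.1) hb)
      rw [h0, coverCount, List.countP_nil] at h2
      omega
    have hstep : I.greedyStep c = c := by rw [greedyStep, hcand]; rfl
    rw [hstep]
    exact ⟨hc, by simp [h0]⟩
  · obtain ⟨a, ha⟩ := exists_choice_eq hk hc.length_le hne hc.mem_elements
    obtain ⟨h1, h2, h3, h4, -⟩ := candidate_sound (mem_of_mem_bestBy (as := I.candidates c.1)
      (show a ∈ I.choice c.1 by simp [ha]))
    have hstep : I.greedyStep c =
        (c.1.filter fun e => ¬ I.Covers a.2.1 a.2.2 e, a.2 :: c.2) := by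
      rw [greedyStep, ha]; rfl
    have hlen : (c.1.filter fun e => ¬ I.Covers a.2.1 a.2.2 e).length =
        c.1.length - I.coverCount c.1 a.2 := by
      have h5 := List.length_eq_countP_add_countP
        (fun e => decide (I.Covers a.2.1 a.2.2 e)) (l := c.1)
      have h6 : (c.1.filter fun e => ¬ I.Covers a.2.1 a.2.2 e).length =
          c.1.countP fun e => ¬ decide (I.Covers a.2.1 a.2.2 e) = true := by
        rw [List.countP_eq_length_filter]
        simp
      rw [coverCount]
      omega
    have hcov : I.coverCount c.1 a.2 ≤ c.1.length := List.countP_le_length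
    have hpos : 0 < c.1.length := List.length_pos_iff.2 hne
    rw [hstep]
    refine ⟨⟨?_, ?_, ?_, ?_, ?_⟩, ?_⟩
    · exact (List.length_filter_le _ _).trans hc.length_le
    · exact fun e he => hc.mem_elements e (List.mem_of_mem_filter he)
    · exact List.forall_mem_cons.2 ⟨h1, hc.isPathLevelPair⟩
    · intro e he
      by_cases h5 : I.Covers a.2.1 a.2.2 e
      · exact Or.inr ⟨a.2, by simp, h5⟩
      · rcases hc.covers e he with h6 | ⟨p, hp, h6⟩
        · exact Or.inl (List.mem_filter.2 ⟨h6, by simpa using h5⟩)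
        · exact Or.inr ⟨p, by simp [hp], h6⟩
    · intro S hS
      have hW : 0 ≤ I.weight S := Finset.sum_nonneg fun p hp => (hS.1 p hp).weight_nonneg
      have h5 := hc.weight_le S hS
      have h6 := choice_weight_le hk hc.length_le hc.mem_elements ha hS
      have h7 := div_le_harmonic_sub hcov
      simp only [List.map_cons, List.sum_cons, hlen]
      have hm : (0 : ℝ) < c.1.length := by exact_mod_cast hpos
      have h8 : I.pairWeight a.2 ≤
          (I.coverCount c.1 a.2 : ℝ) / c.1.length * (4 * scales n * I.weight S) := by
        rw [div_mul_eq_mul_div, le_div_iff₀ hm, mul_comm]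
        exact h6
      have h9 := mul_le_mul_of_nonneg_right h7
        (show 0 ≤ 4 * (scales n : ℝ) * I.weight S by positivity)
      linarith
    · simp only [hlen]
      omega

theorem greedyInv_foldl (hk : 1 ≤ I.k) {α : Type*} (as : List α)
    {c : List (Fin n × ℕ) × List (List (Fin n) × ℕ)} (hc : I.GreedyInv c) :
    I.GreedyInv (as.foldl (fun c _ => I.greedyStep c) c) ∧
      (as.foldl (fun c _ => I.greedyStep c) c).1.length ≤ c.1.length - as.length := by
  induction as generalizing c with
  | nil => exact ⟨hc, by simp⟩
  | cons a as ih =>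
    obtain ⟨h1, h2⟩ := hc.step hk
    obtain ⟨h3, h4⟩ := ih h1
    exact ⟨h3, h4.trans (by simp only [List.length_cons]; omega)⟩

/-- The greedy algorithm is an approximation algorithm. -/
theorem greedy_spec (hk : 1 ≤ I.k) : I.IsSolution I.greedy.toFinset ∧
    ∀ S, I.IsSolution S → I.weight I.greedy.toFinset ≤
      4 * scales n * I.weight S * (harmonic (n * I.L) : ℝ) := by
  obtain ⟨h1, h2⟩ := greedyInv_foldl hk I.elements (I.greedyInv_init)
  -- There are as many rounds as elements, and every round removes at least one until none is left.
  have hnil : (I.elements.foldl (fun c _ => I.greedyStep c) (I.elements, [])).1 = [] :=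
    List.eq_nil_of_length_eq_zero (by simp only at h2; omega)
  have hpair : ∀ p ∈ I.greedy, I.IsPathLevelPair p := h1.isPathLevelPair
  refine ⟨isSolution_of_covers (fun p hp => hpair p (List.mem_toFinset.1 hp)) fun e he => ?_,
    fun S hS => ?_⟩
  · rcases h1.covers e he with h | ⟨p, hp, h⟩
    · rw [hnil] at h
      simp at h
    · exact ⟨p, List.mem_toFinset.2 hp, h⟩
  · have h3 := h1.weight_le S hS
    rw [hnil, List.length_nil, harmonic_zero, Rat.cast_zero, sub_zero] at h3
    refine le_trans ?_ h3
    -- Passing to a finset merges repeated pairs, which does not increase the weight because weights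
    -- of pairs are nonnegative.
    have key : ∀ l : List (List (Fin n) × ℕ), (∀ p ∈ l, I.IsPathLevelPair p) →
        I.weight l.toFinset ≤ (l.map I.pairWeight).sum := by
      intro l
      induction l with
      | nil => simp [weight]
      | cons p l ih =>
        intro hl
        have h4 := ih fun p hp => hl p (by simp [hp])
        have h5 := (hl p (by simp)).weight_nonneg
        simp only [List.map_cons, List.sum_cons, List.toFinset_cons]
        by_cases hp : p ∈ l.toFinset
        · rw [Finset.insert_eq_of_mem hp]
          linarith
        · rw [weight, Finset.sum_insert hp]
          exact add_le_add le_rfl h4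
    exact key I.greedy hpair

end HierInstance
end

/-! ### Implementation of the algorithm as a program -/

noncomputable section

open Enc (enc)
open HierInstance

/-! ### The program -/

namespace HierInstance

/-- The lists that the algorithm handles have length at most `N`. -/
structure Fits {n : ℕ} (I : HierInstance (Fin n)) (N : ℕ) : Prop where
  vertices : n + 1 ≤ N
  coordinates : I.L + scales n ≤ N
  gains : 2 * (n * I.L) + 1 ≤ N
  positions : 2 ^ scales n ≤ N
  vectors : (n + 1) ^ (I.L + scales n) ≤ N
  states : I.states.length + 1 ≤ N
  labels : 2 ^ scales n * I.states.length ≤ N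
  candidates : I.L * (2 ^ scales n * I.states.length) ≤ N

end HierInstance

namespace Program

variable {n N : ℕ} {I : HierInstance (Fin n)} {x : Data} {G f g l p t s j u v z c d : Program}

/-- The number of vertices. -/
def nP (G : Program) : Program := .seq G (.prim .fst)

/-- The depth. -/
def depthP (G : Program) : Program := .seq (.seq G (.prim .snd)) (.prim .fst)

/-- The hop-distance. -/
def hopsP (G : Program) : Program := .seq (.seq (.seq G (.prim .snd)) (.prim .snd)) (.prim .fst)

/-- The part of the input after the first three numbers. -/
def tablesP (G : Program) : Program :=
  .seq (.seq (.seq G (.prim .snd)) (.prim .snd)) (.prim .snd)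

/-- The order of two vertices. -/
def orderP (G u v : Program) : Program := nthP (nthP (.seq (tablesP G) (.prim .fst)) u) v

/-- Whether two vertices lie in the same part at level `j + 1`. -/
def sameP (G j u v : Program) : Program :=
  nthP (nthP (nthP (.seq (.seq (tablesP G) (.prim .snd)) (.prim .fst)) j) u) v

/-- The number `D (j + 1)`. -/
def boundP (G j : Program) : Program :=
  nthP (.seq (.seq (.seq (tablesP G) (.prim .snd)) (.prim .snd)) (.prim .fst)) j

/-- The cost of an edge. -/
def costP (G u v : Program) : Program :=
  nthP (nthP (.seq (.seq (.seq (.seq (tablesP G) (.prim .snd)) (.prim .snd)) (.prim .snd))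
    (.prim .fst)) u) v

theorem ok_n (hG : Ok N G x I.encode) : Ok N (nP G) x (enc n) := hG.seq (Ok.prim .fst _)

theorem ok_depth (hG : Ok N G x I.encode) : Ok N (depthP G) x (enc I.L) :=
  (hG.seq (Ok.prim .snd _)).seq (Ok.prim .fst _)

theorem ok_hops (hG : Ok N G x I.encode) : Ok N (hopsP G) x (enc I.k) :=
  ((hG.seq (Ok.prim .snd _)).seq (Ok.prim .snd _)).seq (Ok.prim .fst _)

theorem ok_order (hI : I.Fits N) (hG : Ok N G x I.encode) {a b : Fin n} (hu : Ok N u x (enc a))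
    (hv : Ok N v x (enc b)) : Ok N (orderP G u v) x (enc (I.lt a b)) :=
  ok_matrix ((((hG.seq (Ok.prim .snd _)).seq (Ok.prim .snd _)).seq (Ok.prim .snd _)).seq
    (Ok.prim .fst _)) hu hv (by have := hI.vertices; omega)

theorem ok_same (hI : I.Fits N) (hG : Ok N G x I.encode) {i : ℕ} (hi : i < I.L)
    (hj : Ok N j x (enc i)) {a b : Fin n} (hu : Ok N u x (enc a)) (hv : Ok N v x (enc b)) :
    Ok N (sameP G j u v) x (enc (I.Same (i + 1) a b)) := by
  have h1 := hI.vertices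
  have h2 := hI.coordinates
  have h := ok_nth (((((hG.seq (Ok.prim .snd _)).seq (Ok.prim .snd _)).seq (Ok.prim .snd _)).seq
    (Ok.prim .snd _)).seq (Ok.prim .fst _)) hj (by omega) (by simpa using hi)
  rw [List.getElem_map, List.getElem_range'] at h
  rw [add_comm i 1, ← one_mul i]
  exact ok_matrix h hu hv (by omega)

theorem ok_bound (hI : I.Fits N) (hG : Ok N G x I.encode) {i : ℕ} (hi : i < I.L)
    (hj : Ok N j x (enc i)) : Ok N (boundP G j) x (enc (I.D (i + 1) : ℝ)) := by
  have h2 := hI.coordinates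
  have h := ok_nth ((((((hG.seq (Ok.prim .snd _)).seq (Ok.prim .snd _)).seq (Ok.prim .snd _)).seq
    (Ok.prim .snd _)).seq (Ok.prim .snd _)).seq (Ok.prim .fst _)) hj (by omega)
    (by simpa using hi)
  rw [List.getElem_map, List.getElem_range'] at h
  rw [add_comm i 1, ← one_mul i]
  exact h

theorem ok_cost (hI : I.Fits N) (hG : Ok N G x I.encode) {a b : Fin n} (hu : Ok N u x (enc a))
    (hv : Ok N v x (enc b)) : Ok N (costP G u v) x (enc (I.c a b)) :=
  ok_matrix (((((((hG.seq (Ok.prim .snd _)).seq (Ok.prim .snd _)).seq (Ok.prim .snd _)).seq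
    (Ok.prim .snd _)).seq (Ok.prim .snd _)).seq (Ok.prim .snd _)).seq (Ok.prim .fst _)) hu hv
    (by have := hI.vertices; omega)

/-- The number of scales. -/
def scalesP (G : Program) : Program :=
  addP (sumP (rangeP (nP G)) (.cond (ltP (twoPowP var0) (wk (nP G))) oneP zeroP)) oneP

/-- The number of scales is computed by counting the powers of two below `n`. -/
theorem sum_pow_lt_eq_clog (n : ℕ) :
    ((List.range n).map fun s => if 2 ^ s < n then 1 else 0).sum = Nat.clog 2 n := by
  have h1 : Nat.clog 2 n ≤ n := Nat.clog_le_of_le_pow Nat.lt_two_pow_self.le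
  change ∑ s ∈ Finset.range n, (if 2 ^ s < n then 1 else 0) = _
  rw [← Finset.card_filter]
  have h2 : ((Finset.range n).filter fun s => 2 ^ s < n) = Finset.range (Nat.clog 2 n) := by
    ext s
    simp only [Finset.mem_filter, Finset.mem_range, ← Nat.lt_clog_iff_pow_lt (le_refl 2)]
    omega
  rw [h2, Finset.card_range]

theorem ok_scales (hI : I.Fits N) (hG : Ok N G x I.encode) :
    Ok N (scalesP G) x (enc (scales n)) := by
  have h1 := hI.vertices
  refine ok_add ?_ ok_one
  rw [← sum_pow_lt_eq_clog]
  exact ok_sum (ok_range (ok_n hG) (by omega)) (fun i hi =>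
    ok_ite (ok_lt (ok_twoPow ok_var0 (by have := List.mem_range.1 hi; omega)) (ok_wk (ok_n hG)))
      (fun _ => ok_one) (fun _ => ok_zero)) (by simp; omega)

/-- The cost from a vertex to a hub. -/
def outCostP (G v g : Program) : Program :=
  .cond (ltP g (nP G)) (.cond (eqP g v) zeroP (costP G v g)) zeroP

/-- The cost from a hub to a vertex. -/
def inCostP (G g v : Program) : Program :=
  .cond (ltP g (nP G)) (.cond (eqP g v) zeroP (costP G g v)) zeroP

theorem ok_outCost (hI : I.Fits N) (hG : Ok N G x I.encode) {a : Fin n} {h : ℕ}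
    (hv : Ok N v x (enc a)) (hg : Ok N g x (enc h)) :
    Ok N (outCostP G v g) x (enc (I.outCost a h)) := by
  refine Ok.ite (ok_lt hg (ok_n hG)) (fun hlt => ?_) (fun hlt => ?_)
  · rw [outCost, dif_pos hlt]
    exact ok_ite (ok_eq (s := (a : ℕ)) hg hv) (fun _ => ok_zero_real)
      (fun _ => ok_cost hI hG hv (b := ⟨h, hlt⟩) hg)
  · rw [outCost, dif_neg hlt]
    exact ok_zero_real

theorem ok_inCost (hI : I.Fits N) (hG : Ok N G x I.encode) {a : Fin n} {h : ℕ}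
    (hg : Ok N g x (enc h)) (hv : Ok N v x (enc a)) :
    Ok N (inCostP G g v) x (enc (I.inCost h a)) := by
  refine Ok.ite (ok_lt hg (ok_n hG)) (fun hlt => ?_) (fun hlt => ?_)
  · rw [inCost, dif_pos hlt]
    exact ok_ite (ok_eq (s := (a : ℕ)) hg hv) (fun _ => ok_zero_real)
      (fun _ => ok_cost hI hG (a := ⟨h, hlt⟩) hg hv)
  · rw [inCost, dif_neg hlt]
    exact ok_zero_real

/-- The remainder of the position `t` modulo the length of a block at scale `s`. -/
def phaseP (t s : Program) : Program := modP t (twoPowP (addP s oneP))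

theorem ok_phase (hI : I.Fits N) {b i : ℕ} (hb : b < 2 ^ scales n) (hi : i < scales n)
    (ht : Ok N t x (enc b)) (hs : Ok N s x (enc i)) :
    Ok N (phaseP t s) x (enc (b % 2 ^ (i + 1))) := by
  have h1 := hI.positions
  have h2 := hI.coordinates
  exact ok_mod ht (ok_twoPow (ok_add hs ok_one) (by omega)) (by omega) (by positivity)

/-- The cost that a vertex pays for its hub. -/
def hubCostP (G t s v g : Program) : Program :=
  .cond (ltP (phaseP t s) (twoPowP s))
    (.cond (leP (twoPowP s) (addP (phaseP t s) (hopsP G))) (outCostP G v g) zeroP)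
    (.cond (leP (phaseP t s) (addP (twoPowP s) (hopsP G))) (inCostP G g v) zeroP)

theorem ok_hubCost (hI : I.Fits N) (hG : Ok N G x I.encode) {b i h : ℕ} {a : Fin n}
    (hb : b < 2 ^ scales n) (hi : i < scales n) (ht : Ok N t x (enc b)) (hs : Ok N s x (enc i))
    (hv : Ok N v x (enc a)) (hg : Ok N g x (enc h)) :
    Ok N (hubCostP G t s v g) x (enc (I.hubCost b i a h)) := by
  have h2 := hI.coordinates
  have hφ := ok_phase hI hb hi ht hs
  have hpow : Ok N (twoPowP s) x (enc (2 ^ i)) := ok_twoPow hs (by omega)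
  exact ok_ite (ok_lt hφ hpow)
    (fun _ => ok_ite (ok_le hpow (ok_add hφ (ok_hops hG)))
      (fun _ => ok_outCost hI hG hv hg) (fun _ => ok_zero_real))
    (fun _ => ok_ite (ok_le hφ (ok_add hpow (ok_hops hG)))
      (fun _ => ok_inCost hI hG hg hv) (fun _ => ok_zero_real))

/-- The cost of a state. -/
def stateCostP (G t p : Program) : Program :=
  sumP (rangeP (scalesP G)) (mulP (hubCostP (wk G) (wk t) var0 (wk (fstP p))
    (nthP (wk (sndP (sndP p))) (addP (wk (depthP G)) var0))) (twoPowP var0))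

theorem ok_stateCost (hI : I.Fits N) (hG : Ok N G x I.encode) {b : ℕ} {σ : PathState n}
    (hb : b < 2 ^ scales n) (ht : Ok N t x (enc b)) (hp : Ok N p x (enc σ)) :
    Ok N (stateCostP G t p) x (enc (I.stateCost b σ)) := by
  have h2 := hI.coordinates
  have h3 := hI.positions
  refine ok_sum_real (ok_range (ok_scales hI hG) (by omega)) (fun i hi => ?_)
    (by rw [List.length_range]; omega)
  have hi := List.mem_range.1 hi
  have hpow : 2 ^ i ≤ 2 ^ scales n := Nat.pow_le_pow_right (by norm_num) hi.le
  exact ok_mul_real (ok_hubCost hI (ok_wk hG) hb hi (ok_wk ht) ok_var0 (ok_wk (ok_fst hp))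
    (ok_getD (ok_wk (ok_snd (ok_snd hp))) (ok_add (ok_wk (ok_depth hG)) ok_var0) (by omega)))
    (ok_twoPow ok_var0 (by omega)) (by omega)

/-- Whether the path `p` with level `l` covers an element. -/
def coversP (G p l c : Program) : Program :=
  andP (leP l (sndP c)) (orP (anyP p (eqP (wk (fstP c)) var0))
    (andP (ltP (sndP c) (depthP G)) (leP (hopsP G)
      (sumP p (.cond (sameP (wk G) (wk (sndP c)) (wk (fstP c)) var0) oneP zeroP)))))

theorem ok_covers (hI : I.Fits N) (hG : Ok N G x I.encode) {P : List (Fin n)} {ℓ : ℕ}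
    {e : Fin n × ℕ} (hP : P.length ≤ N) (hp : Ok N p x (enc P)) (hl : Ok N l x (enc ℓ))
    (hc : Ok N c x (enc e)) : Ok N (coversP G p l c) x (enc (I.Covers P ℓ e)) := by
  classical
  exact ok_and (ok_le hl (ok_snd hc)) fun _ => ok_or
    (ok_any hp (fun _ _ => ok_eq_fin (ok_wk (ok_fst hc)) ok_var0) hP) fun _ =>
    ok_and (ok_lt (ok_snd hc) (ok_depth hG)) fun h => ok_le (ok_hops hG)
      (ok_sum hp (fun _ _ => ok_ite (ok_same hI (ok_wk hG) h (ok_wk (ok_snd hc))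
        (ok_wk (ok_fst hc)) ok_var0) (fun _ => ok_one) (fun _ => ok_zero)) hP)

/-- The gain of a vertex, at level `j + 1`. -/
def gainP (G j u v z : Program) : Program :=
  sumP u (addP
    (.cond (andP (leP (wk (addP j oneP)) (sndP var0)) (eqP (fstP var0) (wk v))) oneP zeroP)
    (.cond (andP (leP (wk (addP j oneP)) (sndP var0)) (andP (ltP (sndP var0) (wk (depthP G)))
      (andP (eqP (nthP (wk z) (sndP var0)) (wk (hopsP G)))
        (sameP (wk G) (sndP var0) (fstP var0) (wk v))))) oneP zeroP))

theorem ok_gain (hI : I.Fits N) (hG : Ok N G x I.encode) {i : ℕ} {U : List (Fin n × ℕ)}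
    {a : Fin n} {w : List ℕ} (hU : U.length ≤ n * I.L) (hj : Ok N j x (enc i))
    (hu : Ok N u x (enc U)) (hv : Ok N v x (enc a)) (hz : Ok N z x (enc w)) :
    Ok N (gainP G j u v z) x (enc (I.gain (i + 1) U a w)) := by
  classical
  have h1 := hI.gains
  have h2 := hI.coordinates
  refine ok_sum hu (fun e _ => ?_) (by omega)
  have he : Ok N var0 (.pair x (enc e)) (enc e) := ok_var0
  exact ok_add
    (ok_ite (ok_and (ok_le (ok_wk (ok_add hj ok_one)) (ok_snd he))
      (fun _ => ok_eq_fin (ok_fst he) (ok_wk hv))) (fun _ => ok_one) (fun _ => ok_zero))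
    (ok_ite (ok_and (ok_le (ok_wk (ok_add hj ok_one)) (ok_snd he)) fun _ =>
      ok_and (ok_lt (ok_snd he) (ok_wk (ok_depth hG))) fun h =>
      ok_and (ok_eq (ok_getD (ok_wk hz) (ok_snd he) (by omega)) (ok_wk (ok_hops hG))) fun _ =>
      ok_same hI (ok_wk hG) h (ok_snd he) (ok_fst he) (ok_wk hv))
      (fun _ => ok_one) (fun _ => ok_zero))

/-- Whether a path may start in a state. -/
def startP (G j u p : Program) : Program :=
  andP (allP (rangeP (depthP G)) (eqP (nthP (wk (sndP (sndP p))) var0) oneP))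
    (eqP (fstP (sndP p)) (gainP G j u (fstP p) (sndP (sndP p))))

theorem ok_start (hI : I.Fits N) (hG : Ok N G x I.encode) {i : ℕ} {U : List (Fin n × ℕ)}
    {σ : PathState n} (hU : U.length ≤ n * I.L) (hj : Ok N j x (enc i))
    (hu : Ok N u x (enc U)) (hp : Ok N p x (enc σ)) :
    Ok N (startP G j u p) x (enc (I.Start (i + 1) U σ)) := by
  have h2 := hI.coordinates
  exact ok_and (ok_all (ok_range (ok_depth hG) (by omega)) (fun i hi =>
      ok_eq (ok_getD (ok_wk (ok_snd (ok_snd hp))) ok_var0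
        (by have := List.mem_range.1 hi; omega)) ok_one) (by rw [List.length_range]; omega))
    fun _ => ok_eq (ok_fst (ok_snd hp)) (ok_gain hI hG hU hj hu (ok_fst hp) (ok_snd (ok_snd hp)))

/-- Whether the hub `f` may be followed by the hub `g`. -/
def hubStepP (G t s f g : Program) : Program :=
  orP (eqP (phaseP t s) zeroP)
    (andP (eqP g f) (orP (notP (eqP (phaseP t s) (twoPowP s))) (ltP g (nP G))))

theorem ok_hubStep (hI : I.Fits N) (hG : Ok N G x I.encode) {b i h h' : ℕ}
    (hb : b < 2 ^ scales n) (hi : i < scales n) (ht : Ok N t x (enc b)) (hs : Ok N s x (enc i))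
    (hf : Ok N f x (enc h)) (hg : Ok N g x (enc h')) :
    Ok N (hubStepP G t s f g) x (enc (HubStep n b i h h')) := by
  have h2 := hI.coordinates
  have hφ := ok_phase hI hb hi ht hs
  unfold HubStep
  rw [imp_iff_not_or]
  exact ok_or (ok_eq hφ ok_zero) fun _ => ok_and (ok_eq hg hf) fun _ =>
    ok_or (ok_not (ok_eq hφ (ok_twoPow hs (by omega)))) fun _ => ok_lt hg (ok_n hG)

/-- Whether the state `c` may be followed by the state `d` at position `t`. -/
def stepP (G j u t c d : Program) : Program :=
  andP (orderP G (fstP c) (fstP d)) (andP (sameP G j (fstP c) (fstP d))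
    (andP (allP (rangeP (depthP G)) (eqP (nthP (wk (sndP (sndP d))) var0)
        (addP (.cond (sameP (wk G) var0 (wk (fstP c)) (wk (fstP d)))
          (nthP (wk (sndP (sndP c))) var0) zeroP) oneP)))
      (andP (allP (rangeP (scalesP G)) (hubStepP (wk G) (wk t) var0
          (nthP (wk (sndP (sndP c))) (addP (wk (depthP G)) var0))
          (nthP (wk (sndP (sndP d))) (addP (wk (depthP G)) var0))))
        (eqP (fstP (sndP d)) (addP (fstP (sndP c)) (gainP G j u (fstP d) (sndP (sndP d))))))))

theorem ok_step (hI : I.Fits N) (hG : Ok N G x I.encode) {b i : ℕ} {U : List (Fin n × ℕ)}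
    {σ τ : PathState n} (hb : b < 2 ^ scales n) (hi : i < I.L) (hU : U.length ≤ n * I.L)
    (hj : Ok N j x (enc i)) (hu : Ok N u x (enc U)) (ht : Ok N t x (enc b))
    (hc : Ok N c x (enc σ)) (hd : Ok N d x (enc τ)) :
    Ok N (stepP G j u t c d) x (enc (I.Step (i + 1) U b σ τ)) := by
  classical
  have h2 := hI.coordinates
  refine ok_and (ok_order hI hG (ok_fst hc) (ok_fst hd)) fun _ =>
    ok_and (ok_same hI hG hi hj (ok_fst hc) (ok_fst hd)) fun _ =>
    ok_and (ok_all (ok_range (ok_depth hG) (by omega)) (fun a ha => ?_)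
      (by rw [List.length_range]; omega)) fun _ =>
    ok_and (ok_all (ok_range (ok_scales hI hG) (by omega)) (fun a ha => ?_)
      (by rw [List.length_range]; omega)) fun _ =>
    ok_eq (ok_fst (ok_snd hd)) (ok_add (ok_fst (ok_snd hc))
      (ok_gain hI hG hU hj hu (ok_fst hd) (ok_snd (ok_snd hd))))
  · have ha := List.mem_range.1 ha
    exact ok_eq (ok_getD (ok_wk (ok_snd (ok_snd hd))) ok_var0 (by omega))
      (ok_add (ok_ite (ok_same hI (ok_wk hG) ha ok_var0 (ok_wk (ok_fst hc)) (ok_wk (ok_fst hd)))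
        (fun _ => ok_getD (ok_wk (ok_snd (ok_snd hc))) ok_var0 (by omega))
        (fun _ => ok_zero)) ok_one)
  · have ha := List.mem_range.1 ha
    exact ok_hubStep hI (ok_wk hG) hb ha (ok_wk ht) ok_var0
      (ok_getD (ok_wk (ok_snd (ok_snd hc))) (ok_add (ok_wk (ok_depth hG)) ok_var0) (by omega))
      (ok_getD (ok_wk (ok_snd (ok_snd hd))) (ok_add (ok_wk (ok_depth hG)) ok_var0) (by omega))

/-- All lists of the length of the counts and hubs of a state. -/
def vectorsP (G : Program) : Program :=
  foldP (rangeP (addP (depthP G) (scalesP G))) (.pair zeroP zeroP)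
    (flatMapP var1 (mapP (rangeP (addP (wk (wk (wk (nP G)))) oneP)) (.pair var0 var1)))

theorem ok_vectors (hI : I.Fits N) (hG : Ok N G x I.encode) :
    Ok N (vectorsP G) x (enc (vectors n (I.L + scales n))) := by
  have h1 := hI.vertices
  have h2 := hI.coordinates
  have h3 := hI.vectors
  have hlen : ∀ i ≤ I.L + scales n, (vectors n i).length ≤ N := fun i hi => by
    rw [length_vectors]
    exact (Nat.pow_le_pow_right (by omega) hi).trans h3
  -- The accumulator is pinned down exactly, which bounds its length in every round.
  refine ok_foldIdx (fun i c => c = vectors n i)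
    (ok_range (ok_add (ok_depth hG) (ok_scales hI hG)) h2) (ok_cons ok_nil ok_nil)
    (by rwa [List.length_range]) rfl ?_ ?_
  · rintro i hi c rfl
    rw [vectors_succ]
  · rintro i hi c rfl
    rw [List.length_range] at hi
    exact ok_flatMap ok_var1 (fun w _ => ok_map
        (ok_range (ok_add (ok_wk (ok_wk (ok_wk (ok_n hG)))) ok_one) h1)
        (fun a _ => ok_cons ok_var0 ok_var1) (by rwa [List.length_range]) (by omega))
      (hlen i hi.le) (fun w _ => by simpa using h1)
      (by rw [← vectors_succ]; exact hlen (i + 1) hi)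

/-- All states. -/
def statesP (G : Program) : Program :=
  flatMapP (rangeP (nP G)) (flatMapP
    (rangeP (addP (addP (mulP (wk (depthP G)) (wk (nP G))) (mulP (wk (depthP G)) (wk (nP G))))
      oneP))
    (mapP (wk (wk (vectorsP G))) (.pair (wk var1) (.pair var1 var0))))

/-- A vertex and its number have the same representation, so a list of numbers produced by `rangeP`
serves as the list of vertices. -/
theorem enc_finRange (n : ℕ) : enc (List.finRange n) = enc (List.range n) := by
  show Data.ofList _ = Data.ofList _
  rw [← List.map_coe_finRange_eq_range, List.map_map]
  rfl

theorem ok_states (hI : I.Fits N) (hG : Ok N G x I.encode) :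
    Ok N (statesP G) x (enc I.states) := by
  have h1 := hI.vertices
  have h2 := hI.gains
  have h3 := hI.states
  have h4 := hI.vectors
  have hn := I.k_lt
  rw [Fintype.card_fin] at hn
  have h5 : (2 * (n * I.L) + 1) * (n + 1) ^ (I.L + scales n) ≤ N := by
    have := I.length_states
    have := Nat.le_mul_of_pos_left ((2 * (n * I.L) + 1) * (n + 1) ^ (I.L + scales n))
      (show 0 < n by omega)
    omega
  have hr : Ok N (rangeP (nP G)) x (enc (List.finRange n)) := by
    rw [enc_finRange]
    exact ok_range (ok_n hG) (by omega)
  refine ok_flatMap hr (fun a _ => ok_flatMap (ok_range ?_ h2) (fun q _ =>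
      ok_map (ok_wk (ok_wk (ok_vectors hI hG))) (fun w _ => ok_pair (ok_wk ok_var1)
        (ok_pair ok_var1 ok_var0)) (by rwa [length_vectors]) (by omega))
      (by rwa [List.length_range]) (fun q _ => by rwa [List.length_map, length_vectors]) ?_)
    (by rw [List.length_finRange]; omega) (fun a _ => ?_) (by simp only [states] at h3; omega)
  · rw [two_mul]
    exact ok_add (ok_add (ok_mul (ok_wk (ok_depth hG)) (ok_wk (ok_n hG)) (by omega))
      (ok_mul (ok_wk (ok_depth hG)) (ok_wk (ok_n hG)) (by omega))) ok_one
  · simpa [List.length_flatMap, length_vectors] using h5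
  · simpa [List.length_flatMap, length_vectors] using h5

/-- The candidates for the label of the state `p` at position `t`. -/
def extensionsP (G j u t c p : Program) : Program :=
  appendP
    (.cond (startP G j u p) (.pair (.pair p (.pair (stateCostP G t p) (.pair (fstP p) zeroP)))
      zeroP) zeroP)
    (flatMapP c (.cond (stepP (wk G) (wk j) (wk u) (wk t) (fstP var0) (wk p))
      (.pair (.pair (wk p) (.pair (addP (fstP (sndP var0)) (wk (stateCostP G t p)))
        (.pair (wk (fstP p)) (sndP (sndP var0))))) zeroP) zeroP))

theorem length_extensions_le {ℓ b : ℕ} {U : List (Fin n × ℕ)} {T : List (PathLabel n)}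
    {σ : PathState n} : (I.extensions ℓ U b T σ).length ≤ T.length + 1 := by
  classical
  have h : (T.flatMap fun a => if I.Step ℓ U b a.1 σ then
      [((σ, a.2.1 + I.stateCost b σ, σ.1 :: a.2.2) : PathLabel n)] else []).length ≤
        T.length := by
    induction T with
    | nil => simp
    | cons a T ih =>
      rw [List.flatMap_cons, List.length_append, List.length_cons]
      split_ifs <;> simp only [List.length_nil, List.length_singleton] <;> omega
  unfold extensions
  rw [List.length_append]
  split_ifs <;> simp only [List.length_nil, List.length_singleton] <;> omega

theorem ok_extensions (hI : I.Fits N) (hG : Ok N G x I.encode) {b i : ℕ}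
    {U : List (Fin n × ℕ)} {T : List (PathLabel n)} {σ : PathState n} (hb : b < 2 ^ scales n)
    (hi : i < I.L) (hU : U.length ≤ n * I.L) (hT : T.length ≤ I.states.length)
    (hj : Ok N j x (enc i)) (hu : Ok N u x (enc U)) (ht : Ok N t x (enc b))
    (hc : Ok N c x (enc T)) (hp : Ok N p x (enc σ)) :
    Ok N (extensionsP G j u t c p) x (enc (I.extensions (i + 1) U b T σ)) := by
  classical
  have h1 := hI.states
  have hw := ok_stateCost hI hG hb ht hp
  have hlen := length_extensions_le (I := I) (ℓ := i + 1) (b := b) (U := U) (T := T) (σ := σ)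
  unfold extensions at hlen
  rw [List.length_append] at hlen
  refine ok_append
    (ok_ite (ok_start hI hG hU hj hu hp)
      (fun _ => ok_cons (ok_pair hp (ok_pair hw (ok_cons (ok_fst hp) ok_nil))) ok_nil)
      (fun _ => ok_nil))
    (ok_flatMap hc (fun a _ => ?_) (by omega) (fun a _ => ?_) (by omega)) (by omega)
  · have ha : Ok N var0 (.pair x (enc a)) (enc a) := ok_var0
    exact ok_ite (ok_step hI (ok_wk hG) hb hi hU (ok_wk hj) (ok_wk hu) (ok_wk ht) (ok_fst ha)
        (ok_wk hp))
      (fun _ => ok_cons (ok_pair (ok_wk hp) (ok_pair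
        (ok_add_real (ok_fst (ok_snd ha)) (ok_wk hw))
        (ok_cons (ok_wk (ok_fst hp)) (ok_snd (ok_snd ha))))) ok_nil)
      (fun _ => ok_nil)
  · split_ifs <;> simp only [List.length_nil, List.length_singleton] <;> omega

/-- The labels at position `t`, given the list `c` of the labels at the previous position. -/
def extendP (G j u t c : Program) : Program :=
  flatMapP (statesP G) (bestByP (extensionsP (wk G) (wk j) (wk u) (wk t) (wk c) var0)
    (leP (fstP (sndP var1)) (fstP (sndP var0))))

theorem ok_extend (hI : I.Fits N) (hG : Ok N G x I.encode) {b i : ℕ}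
    {U : List (Fin n × ℕ)} {T : List (PathLabel n)} (hb : b < 2 ^ scales n)
    (hi : i < I.L) (hU : U.length ≤ n * I.L) (hT : T.length ≤ I.states.length)
    (hj : Ok N j x (enc i)) (hu : Ok N u x (enc U)) (ht : Ok N t x (enc b))
    (hc : Ok N c x (enc T)) :
    Ok N (extendP G j u t c) x (enc (I.extend (i + 1) U b T)) := by
  have h1 := hI.states
  refine ok_flatMap (ok_states hI hG) (fun σ _ => ok_bestBy
      (ok_extensions hI (ok_wk hG) hb hi hU hT (ok_wk hj) (ok_wk hu) (ok_wk ht) (ok_wk hc) ok_var0)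
      (length_extensions_le.trans (by omega)) (by omega) (fun a _ a' _ => ?_)) (by omega)
    (fun σ _ => (bestBy_length _ _).trans (by omega)) (length_extend_le.trans (by omega))
  have ha : Ok N var1 (.pair (.pair (.pair x (enc σ)) (enc a)) (enc a')) (enc a) := ok_var1
  have ha' : Ok N var0 (.pair (.pair (.pair x (enc σ)) (enc a)) (enc a')) (enc a') := ok_var0
  exact ok_le_real (ok_fst (ok_snd ha)) (ok_fst (ok_snd ha'))

/-- The labels at all positions. -/
def labelsP (G j u : Program) : Program :=
  sndP (foldP (rangeP (twoPowP (scalesP G))) (.pair zeroP zeroP)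
    (letP (extendP (wk (wk G)) (wk (wk j)) (wk (wk u)) var0 (fstP var1))
      (.pair var0 (appendP var0 (wk (sndP var1))))))

theorem ok_labels (hI : I.Fits N) (hG : Ok N G x I.encode) {i : ℕ}
    {U : List (Fin n × ℕ)} (hi : i < I.L) (hU : U.length ≤ n * I.L)
    (hj : Ok N j x (enc i)) (hu : Ok N u x (enc U)) :
    Ok N (labelsP G j u) x (enc (I.labels (i + 1) U)) := by
  have h1 := hI.states
  have h2 := hI.coordinates
  have h3 := hI.positions
  refine ok_snd (ok_fold (fun c : List (PathLabel n) × List (PathLabel n) =>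
      c.1.length ≤ I.states.length) (ok_range (ok_twoPow (ok_scales hI hG) (by omega)) h3)
    (ok_pair ok_nil ok_nil) (by rwa [List.length_range]) (by simp)
    (fun c b _ _ => length_extend_le) (fun c b hb hc => ?_))
  have hcc : Ok N var1 (.pair (.pair x (enc c)) (enc b)) (enc c) := ok_var1
  exact ok_let (ok_extend hI (ok_wk (ok_wk hG)) (List.mem_range.1 hb) hi hU hc (ok_wk (ok_wk hj))
      (ok_wk (ok_wk hu)) ok_var0 (ok_fst hcc))
    (ok_pair ok_var0 (ok_append ok_var0 (ok_wk (ok_snd hcc))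
      (length_extend_le.trans (by omega))))

/-- The candidates for the next pair. -/
def candidatesP (G u : Program) : Program :=
  flatMapP (rangeP (depthP G)) (flatMapP (labelsP (wk G) var0 (wk u))
    (.cond (leP oneP (fstP (sndP (fstP var0))))
      (.pair (.pair (.pair (addP (fstP (sndP var0))
          (mulP (mulP (boundP (wk (wk G)) var1) (hopsP (wk (wk G)))) (hopsP (wk (wk G)))))
          (fstP (sndP (fstP var0))))
        (.pair (reverseP (sndP (sndP var0))) (addP var1 oneP))) zeroP) zeroP))

theorem length_candidates_le {U : List (Fin n × ℕ)} :
    (∀ i, (open Classical in (I.labels (i + 1) U).flatMap fun a => if 1 ≤ a.1.2.1 then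
      [((a.2.1 + I.k * (I.k * (I.D (i + 1) : ℝ)), a.1.2.1), a.2.2.reverse, i + 1)]
        else []).length ≤ 2 ^ scales n * I.states.length) ∧
    (I.candidates U).length ≤ I.L * (2 ^ scales n * I.states.length) := by
  classical
  have h : ∀ i, ((I.labels (i + 1) U).flatMap fun a => if 1 ≤ a.1.2.1 then
      [((a.2.1 + I.k * (I.k * (I.D (i + 1) : ℝ)), a.1.2.1), a.2.2.reverse, i + 1)]
        else []).length ≤ 2 ^ scales n * I.states.length := by
    intro i
    refine le_trans ?_ (length_labels_le (I := I) (ℓ := i + 1) (U := U))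
    induction I.labels (i + 1) U with
    | nil => simp
    | cons a T ih =>
      rw [List.flatMap_cons, List.length_append, List.length_cons]
      split_ifs <;> simp only [List.length_nil, List.length_singleton] <;> omega
  refine ⟨h, ?_⟩
  unfold candidates
  rw [List.length_flatMap]
  refine (List.sum_le_card_nsmul _ (2 ^ scales n * I.states.length) ?_).trans (by simp)
  intro m hm
  obtain ⟨i, _, rfl⟩ := List.mem_map.1 hm
  exact h i

theorem ok_candidates (hI : I.Fits N) (hG : Ok N G x I.encode) {U : List (Fin n × ℕ)}
    (hU : U.length ≤ n * I.L) (hu : Ok N u x (enc U)) :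
    Ok N (candidatesP G u) x (enc (I.candidates U)) := by
  classical
  have h1 := hI.vertices
  have h2 := hI.coordinates
  have h3 := hI.positions
  have h4 := hI.labels
  have h5 := hI.candidates
  have hk := I.k_lt
  rw [Fintype.card_fin] at hk
  obtain ⟨h6, h7⟩ := length_candidates_le (I := I) (U := U)
  refine ok_flatMap (ok_range (ok_depth hG) (by omega)) (fun i hi => ?_)
    (by rw [List.length_range]; omega) (fun i _ => (h6 i).trans h4) (h7.trans h5)
  have hi := List.mem_range.1 hi
  refine ok_flatMap (ok_labels hI (ok_wk hG) hi hU ok_var0 (ok_wk hu)) (fun a ha => ?_)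
    (length_labels_le.trans h4) (fun a _ => ?_) ((h6 i).trans h4)
  · obtain ⟨-, -, -, -, h8⟩ := label_sound ha (by omega) hi
    have ha : Ok N var0 (.pair (.pair x (enc i)) (enc a)) (enc a) := ok_var0
    have hG' := ok_wk (y := enc a) (ok_wk (y := enc i) hG)
    exact ok_ite (ok_le ok_one (ok_fst (ok_snd (ok_fst ha)))) (fun _ => ok_cons (ok_pair (ok_pair
        (ok_add_real (ok_fst (ok_snd ha)) (ok_mul_real (ok_mul_real (ok_bound hI hG' hi ok_var1)
          (ok_hops hG') (by omega)) (ok_hops hG') (by omega)))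
        (ok_fst (ok_snd (ok_fst ha))))
        (ok_pair (ok_reverse (ok_snd (ok_snd ha)) (by omega)) (ok_add ok_var1 ok_one))) ok_nil)
      (fun _ => ok_nil)
  · split_ifs <;> simp only [List.length_nil, List.length_singleton] <;> omega

/-- The best candidate. -/
def choiceP (G u : Program) : Program :=
  bestByP (candidatesP G u) (leP (mulP (fstP (fstP var1)) (sndP (fstP var0)))
    (mulP (fstP (fstP var0)) (sndP (fstP var1))))

/-- Ratios are compared by cross-multiplication, carried out by repeated addition; this is cheap
because the gains are at most `2 * (n * I.L)`. -/
theorem ok_choice (hI : I.Fits N) (hG : Ok N G x I.encode) {U : List (Fin n × ℕ)}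
    (hU : U.length ≤ n * I.L) (hu : Ok N u x (enc U)) :
    Ok N (choiceP G u) x (enc (I.choice U)) := by
  have h1 := hI.vertices
  have h2 := hI.gains
  refine ok_bestBy (ok_candidates hI hG hU hu) (length_candidates_le.2.trans hI.candidates)
    (by omega) fun a ha b hb => ?_
  have h3 := (candidate_sound ha).2.2.2.2.1
  have h4 := (candidate_sound hb).2.2.2.2.1
  have ha' : Ok N var1 (.pair (.pair x (enc a)) (enc b)) (enc a) := ok_var1
  have hb' : Ok N var0 (.pair (.pair x (enc a)) (enc b)) (enc b) := ok_var0
  exact ok_le_real (ok_mul_real (ok_fst (ok_fst ha')) (ok_snd (ok_fst hb')) (by omega))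
    (ok_mul_real (ok_fst (ok_fst hb')) (ok_snd (ok_fst ha')) (by omega))

/-- All elements. -/
def elementsP (G : Program) : Program :=
  flatMapP (rangeP (nP G)) (mapP (wk (rangeP (depthP G))) (.pair var1 (addP var0 oneP)))

theorem ok_elements (hI : I.Fits N) (hG : Ok N G x I.encode) :
    Ok N (elementsP G) x (enc I.elements) := by
  have h1 := hI.vertices
  have h2 := hI.coordinates
  have h3 := hI.gains
  have hr : Ok N (rangeP (nP G)) x (enc (List.finRange n)) := by
    rw [enc_finRange]
    exact ok_range (ok_n hG) (by omega)
  exact ok_flatMap hr (fun a _ => ok_map (ok_wk (ok_range (ok_depth hG) (by omega)))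
      (fun i _ => ok_pair ok_var1 (ok_add ok_var0 ok_one)) (by rw [List.length_range]; omega)
      (by omega)) (by rw [List.length_finRange]; omega)
    (fun a _ => by rw [List.length_map, List.length_range]; omega)
    (by have := I.length_elements; simp only [elements] at this; omega)

/-- One step of the greedy algorithm. -/
def greedyStepP (G c : Program) : Program :=
  foldP (choiceP G (fstP c)) c (.pair
    (filterP (fstP var1) (notP (coversP (wk (wk (wk G))) (fstP (sndP var1)) (sndP (sndP var1))
      var0)))
    (.pair (sndP var0) (sndP var1)))

theorem ok_greedyStep (hI : I.Fits N) (hG : Ok N G x I.encode)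
    {a : List (Fin n × ℕ) × List (List (Fin n) × ℕ)} (ha : a.1.length ≤ n * I.L)
    (hc : Ok N c x (enc a)) : Ok N (greedyStepP G c) x (enc (I.greedyStep a)) := by
  classical
  have h1 := hI.vertices
  have h2 := hI.gains
  have h3 := hI.positions
  refine ok_fold (fun a : List (Fin n × ℕ) × List (List (Fin n) × ℕ) => a.1.length ≤ n * I.L)
    (ok_choice hI hG ha (ok_fst hc)) hc ((bestBy_length _ _).trans (by omega)) ha
    (fun a _ _ h => (List.length_filter_le _ _).trans h) (fun b d hd hb => ?_)
  have h4 := (candidate_sound (mem_of_mem_bestBy (as := I.candidates a.1) hd)).2.2.2.2.2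
  have hb' : Ok N var1 (.pair (.pair x (enc b)) (enc d)) (enc b) := ok_var1
  have hd' : Ok N var0 (.pair (.pair x (enc b)) (enc d)) (enc d) := ok_var0
  refine ok_pair ?_ (ok_cons (ok_snd hd') (ok_snd hb'))
  refine ok_filter (ok_fst hb') (fun e _ => ?_) (by omega) (by omega)
  have hd'' : Ok N var1 (.pair (.pair (.pair x (enc b)) (enc d)) (enc e)) (enc d) := ok_var1
  exact ok_not (ok_covers hI (ok_wk (ok_wk (ok_wk hG))) (by omega) (ok_fst (ok_snd hd''))
    (ok_snd (ok_snd hd'')) ok_var0)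

/-- The greedy algorithm. -/
def greedyP (G : Program) : Program :=
  sndP (foldP (elementsP G) (.pair (elementsP G) zeroP) (greedyStepP (wk (wk G)) var1))

/-- The invariant of the greedy analysis also serves the running time: it bounds the list of
uncovered elements in every round. -/
theorem ok_greedy (hI : I.Fits N) (hk : 1 ≤ I.k) (hG : Ok N G x I.encode) :
    Ok N (greedyP G) x (enc I.greedy) := by
  have h2 := hI.gains
  exact ok_snd (ok_fold (fun a => I.GreedyInv a) (ok_elements hI hG)
    (ok_pair (ok_elements hI hG) ok_nil) (by rw [I.length_elements]; omega) I.greedyInv_init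
    (fun a _ _ ha => (ha.step hk).1)
    (fun a _ _ ha => ok_greedyStep hI (ok_wk (ok_wk hG)) ha.length_le ok_var1))

end Program
end

/-! ### Numerical estimates and conclusion -/

noncomputable section

open Enc (enc)
open HierInstance

namespace HierInstance

variable {n : ℕ} {I : HierInstance (Fin n)}

/-! ### The bound on the running time -/

/-- A bound for the lengths of all lists that the algorithm handles. -/
def sizeBound (I : HierInstance (Fin n)) : ℕ :=
  (4 * (n * I.L)) ^ (2 * (I.L + scales n) + 3)

/-- With `B = 4 * (n * L)` and `K = L + scales n`, each of `n`, `n + 1`, `2 * (n * L) + 1`, `L` and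
`2` is at most `B`. There are at most `B ^ (K + 2)` states, at most `B ^ K` positions and at most
`B` levels, which gives the exponent `2 * K + 3`. -/
theorem fits_sizeBound (I : HierInstance (Fin n)) (hn : 1 ≤ n) : I.Fits I.sizeBound := by
  have hL := I.one_le_L
  have hn1 : n ≤ n * I.L := Nat.le_mul_of_pos_right n (by omega)
  have hL1 : I.L ≤ n * I.L := Nat.le_mul_of_pos_left _ (by omega)
  obtain ⟨B, hB⟩ : ∃ B, B = 4 * (n * I.L) := ⟨_, rfl⟩
  obtain ⟨K, hK⟩ : ∃ K, K = I.L + scales n := ⟨_, rfl⟩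
  have hN : I.sizeBound = B ^ (2 * K + 3) := by rw [sizeBound, hB, hK]
  have hB0 : 0 < B := by omega
  have hle : ∀ a, a ≤ 2 * K + 3 → B ^ a ≤ I.sizeBound := fun a ha => by
    rw [hN]
    exact Nat.pow_le_pow_right hB0 ha
  have h1 : B ≤ I.sizeBound := by simpa using hle 1 (by omega)
  have h2 : 2 ^ scales n ≤ B ^ K := (Nat.pow_le_pow_left (show 2 ≤ B by omega) _).trans
    (Nat.pow_le_pow_right hB0 (by omega))
  have h3 : (n + 1) ^ K ≤ B ^ K := Nat.pow_le_pow_left (by omega) _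
  have h4 : I.states.length ≤ B * (B * B ^ K) := by
    rw [length_states, ← hK]
    exact Nat.mul_le_mul (by omega) (Nat.mul_le_mul (by omega) h3)
  have h5 : 2 ^ scales n * I.states.length ≤ B ^ (2 * K + 2) :=
    (Nat.mul_le_mul h2 h4).trans (le_of_eq (by ring))
  refine ⟨by omega, ?_, by omega, h2.trans (hle _ (by omega)), ?_, ?_,
    h5.trans (hle _ (by omega)), ?_⟩
  · rw [← hK]
    exact (Nat.lt_pow_self (show 1 < B by omega)).le.trans (hle _ (by omega))
  · rw [← hK]
    exact h3.trans (hle _ (by omega))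
  · refine le_trans ?_ (hle (K + 3) (by omega))
    have h6 : B * (B * B ^ K) = B ^ (K + 2) := by ring
    have h7 : B ^ (K + 3) = B * B ^ (K + 2) := by ring
    have h8 : 0 < B ^ (K + 2) := by positivity
    have h9 := Nat.mul_le_mul (show 2 ≤ B by omega) (le_refl (B ^ (K + 2)))
    omega
  · exact (Nat.mul_le_mul (show I.L ≤ B by omega) h5).trans (le_trans (le_of_eq (by ring))
      (hle (2 * K + 3) le_rfl))

/-- For `n = 1` the logarithm vanishes although `L ≥ 1`; `n = 0` is excluded by `k < n`. -/
theorem LowDepth.two_le {γ : ℝ} (h : I.LowDepth γ) : 2 ≤ n := by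
  by_contra hn
  have hk := I.k_lt
  rw [Fintype.card_fin] at hk
  obtain rfl : n = 1 := by omega
  have hL : (1 : ℝ) ≤ I.L := by exact_mod_cast I.one_le_L
  have h' : (I.L : ℝ) ≤ γ * Real.logb 2 (Fintype.card (Fin 1)) := h
  simp at h'
  have := I.one_le_L
  omega

theorem one_le_logb (hn : 2 ≤ n) : 1 ≤ Real.logb 2 n := by
  rw [Real.le_logb_iff_rpow_le (by norm_num) (by positivity)]
  simpa using (by exact_mod_cast hn : (2 : ℝ) ≤ n)

/-- Rounding up and the extra scale each add at most `1 ≤ logb 2 n`. -/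
theorem scales_le (hn : 2 ≤ n) : (scales n : ℝ) ≤ 3 * Real.logb 2 n := by
  have h1 := one_le_logb hn
  have h2 := Real.natCeil_logb_natCast 2 n
  have h3 := (Nat.ceil_lt_add_one (a := Real.logb 2 n) (by linarith)).le
  rw [Nat.cast_ofNat] at h2
  rw [h2] at h3
  rw [scales]
  push_cast
  linarith

theorem LowDepth.le_pow {γ : ℝ} (h : I.LowDepth γ) {m : ℕ} (hm : γ ≤ m) :
    I.L ≤ n ^ (m + 1) := by
  have hn := h.two_le
  have h1 := one_le_logb hn
  have h2 : Real.logb 2 n ≤ n := by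
    rw [Real.logb_le_iff_le_rpow (by norm_num) (by positivity), Real.rpow_natCast]
    exact_mod_cast Nat.lt_two_pow_self.le
  have h3 : (I.L : ℝ) ≤ γ * Real.logb 2 (Fintype.card (Fin n)) := h
  rw [Fintype.card_fin] at h3
  have h4 : (I.L : ℝ) ≤ m * n := h3.trans (mul_le_mul hm h2 (by linarith) (by positivity))
  have h5 : I.L ≤ m * n := by exact_mod_cast h4
  rw [pow_succ]
  exact h5.trans (Nat.mul_le_mul_right n (Nat.lt_pow_self (by omega)).le)

theorem LowDepth.time_le {γ : ℝ} (h : I.LowDepth γ) {m : ℕ} (hm : γ ≤ m) (e : ℕ) :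
    (((I.sizeBound + 2) ^ e : ℕ) : ℝ) ≤
      (n : ℝ) ^ ((m + 4) * (2 * γ + 9) * (2 * e) * Real.logb 2 n) := by
  have hn := h.two_le
  have h1 := one_le_logb hn
  have h2 := scales_le hn
  have h3 : (I.L : ℝ) ≤ γ * Real.logb 2 (Fintype.card (Fin n)) := h
  rw [Fintype.card_fin] at h3
  -- The factor `4` costs `n ^ 2`, and `n * L ≤ n ^ (m + 2)`.
  have h4 : 4 * (n * I.L) ≤ n ^ (m + 4) := by
    have h5 : 4 ≤ n ^ 2 := by nlinarith
    refine (Nat.mul_le_mul h5 (Nat.mul_le_mul (le_refl n) (h.le_pow hm))).trans (le_of_eq ?_)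
    ring
  have h6 : 2 ≤ I.sizeBound := by
    have hL := I.one_le_L
    have hnL : n ≤ n * I.L := Nat.le_mul_of_pos_right n (by omega)
    refine le_trans (show 2 ≤ 4 * (n * I.L) by omega) (Nat.le_self_pow (by omega) _)
  -- Squaring absorbs the summand `2`, whence the factor `2 * e`.
  have h7 : (I.sizeBound + 2) ^ e ≤
      n ^ ((m + 4) * (2 * (I.L + scales n) + 3) * (2 * e)) := by
    rw [pow_mul, pow_mul, pow_mul n]
    have h8 : I.sizeBound ≤ (n ^ (m + 4)) ^ (2 * (I.L + scales n) + 3) :=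
      Nat.pow_le_pow_left h4 _
    refine Nat.pow_le_pow_left ?_ e
    refine le_trans ?_ (Nat.pow_le_pow_left h8 2)
    nlinarith
  refine le_trans (Nat.cast_le.2 h7) ?_
  rw [Nat.cast_pow, ← Real.rpow_natCast]
  refine Real.rpow_le_rpow_of_exponent_le (by exact_mod_cast (by omega : 1 ≤ n)) ?_
  simp only [Nat.cast_mul, Nat.cast_add, Nat.cast_ofNat]
  -- The depth contributes `2 * γ`, the scales `6` and the constant `3` another `3`, all times `logb
  -- 2 n ≥ 1`.
  have h9 : 2 * ((I.L : ℝ) + (Nat.clog 2 n + (1 : ℕ))) + 3 ≤ (2 * γ + 9) * Real.logb 2 n := by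
    rw [← Nat.cast_add]
    linarith
  calc ((m : ℝ) + 4) * (2 * ((I.L : ℝ) + (Nat.clog 2 n + (1 : ℕ))) + 3) * (2 * e)
      ≤ (m + 4) * ((2 * γ + 9) * Real.logb 2 n) * (2 * e) := by gcongr
    _ = _ := by ring

/-- Since `n * L ≤ n ^ (m + 2)`, the harmonic number is at most `1 + (m + 2) * log n ≤ (m + 3) *
logb 2 n`; the scales contribute the other logarithm with factor `3`. -/
theorem LowDepth.ratio_le {γ : ℝ} (h : I.LowDepth γ) {m : ℕ} (hm : γ ≤ m) :
    4 * scales n * (harmonic (n * I.L) : ℝ) ≤ 12 * (m + 3) * Real.logb 2 n ^ 2 := by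
  have hn := h.two_le
  have h1 := one_le_logb hn
  have h2 := scales_le hn
  have hL := I.one_le_L
  have hpos : 0 < n * I.L := Nat.mul_pos (by omega) hL
  have h3 : n * I.L ≤ n ^ (m + 2) := by
    refine (Nat.mul_le_mul (le_refl n) (h.le_pow hm)).trans (le_of_eq ?_)
    ring
  have h4 : Real.log (n * I.L : ℕ) ≤ (m + 2) * Real.log n := by
    have := Real.log_le_log (by exact_mod_cast hpos)
      (show ((n * I.L : ℕ) : ℝ) ≤ ((n ^ (m + 2) : ℕ) : ℝ) by exact_mod_cast h3)
    rw [Nat.cast_pow, Real.log_pow] at this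
    exact_mod_cast this
  have h5 : Real.log n ≤ Real.logb 2 n := by
    rw [Real.logb, le_div_iff₀ (Real.log_pos (by norm_num))]
    have h6 : Real.log 2 ≤ 1 := by
      have := Real.log_two_lt_d9
      linarith
    exact mul_le_of_le_one_right (Real.log_natCast_nonneg n) h6
  have h6 := harmonic_le_one_add_log (n * I.L)
  have h7 : (harmonic (n * I.L) : ℝ) ≤ (m + 3) * Real.logb 2 n := by
    have h8 := mul_le_mul_of_nonneg_left h5 (show (0 : ℝ) ≤ m + 2 by positivity)
    linarith
  calc 4 * scales n * (harmonic (n * I.L) : ℝ)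
      ≤ 4 * (3 * Real.logb 2 n) * ((m + 3) * Real.logb 2 n) :=
        mul_le_mul (by linarith) h7 (by exact_mod_cast (harmonic_pos hpos.ne').le)
          (by linarith)
    _ = _ := by ring

/-! ### Small hop-distances -/

/-- The instance with the hop-distance raised to at least `1`. -/
def raised (I : HierInstance (Fin n)) (hn : 2 ≤ n) : HierInstance (Fin n) :=
  { I with
    k := max I.k 1
    k_lt := max_lt I.k_lt (by rw [Fintype.card_fin]; omega) }

/-- Raising `k` only strengthens the second alternative of condition (b). -/
theorem isSolution_of_raised (hn : 2 ≤ n) {S : Finset (List (Fin n) × ℕ)}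
    (h : (I.raised hn).IsSolution S) : I.IsSolution S :=
  ⟨h.1, h.2.1, fun ℓ h2 hℓ H hH => (h.2.2 ℓ h2 hℓ H hH).imp id fun ⟨p, hp, hj, hc⟩ =>
    ⟨p, hp, hj, (le_max_left _ _).trans hc⟩⟩

theorem weight_eq_zero (hk : I.k = 0) (S : Finset (List (Fin n) × ℕ)) : I.weight S = 0 := by
  simp [weight, pairWeight, hopCost, hk]

theorem raised_eq (hn : 2 ≤ n) (hk : 1 ≤ I.k) : I.raised hn = I := by
  cases I
  simp only [raised] at *
  congr
  exact max_eq_left hk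

theorem IsSolution.weight_nonneg {S : Finset (List (Fin n) × ℕ)} (h : I.IsSolution S) :
    0 ≤ I.weight S :=
  Finset.sum_nonneg fun p hp => (h.1 p hp).weight_nonneg

theorem opt_nonneg : 0 ≤ I.opt := by
  refine Real.sInf_nonneg ?_
  rintro _ ⟨S, hS, rfl⟩
  exact hS.weight_nonneg

/-- For `k = 0` every set has weight `0`, so any solution is optimal; for `k ≥ 1` raising changes
nothing and the greedy bound applies to every solution, hence to the infimum. -/
theorem raised_greedy_weight_le {γ : ℝ} (h : I.LowDepth γ) {m : ℕ} (hm : γ ≤ m) :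
    I.weight (I.raised h.two_le).greedy.toFinset ≤
      12 * (m + 3) * Real.logb 2 n ^ 2 * I.opt := by
  rcases Nat.eq_zero_or_pos I.k with hk | hk
  · rw [weight_eq_zero hk]
    have := I.opt_nonneg
    positivity
  rw [raised_eq _ hk]
  obtain ⟨h1, h2⟩ := greedy_spec hk
  have h3 := one_le_logb h.two_le
  have hpos : 0 < 12 * ((m : ℝ) + 3) * Real.logb 2 n ^ 2 := by positivity
  rw [← div_le_iff₀' hpos]
  refine le_csInf ⟨_, _, h1, rfl⟩ ?_
  rintro _ ⟨S, hS, rfl⟩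
  rw [div_le_iff₀' hpos]
  refine (h2 S hS).trans ?_
  rw [mul_right_comm]
  exact mul_le_mul_of_nonneg_right (h.ratio_le hm) hS.weight_nonneg

end HierInstance

namespace Program

variable {n N : ℕ} {I : HierInstance (Fin n)} {x : Data} {G : Program}

/-- Raise the hop-distance of an instance to at least `1`. -/
def raisedP (G : Program) : Program :=
  .pair (nP G) (.pair (depthP G)
    (.pair (.cond (leP oneP (hopsP G)) (hopsP G) oneP) (tablesP G)))

theorem ok_raised (hn : 2 ≤ n) (hG : Ok N G x I.encode) :
    Ok N (raisedP G) x (I.raised hn).encode := by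
  refine (ok_n hG).pair ((ok_depth hG).pair (Ok.pair (y := enc (max I.k 1)) ?_
    (((hG.seq (Ok.prim .snd _)).seq (Ok.prim .snd _)).seq (Ok.prim .snd _))))
  exact (ok_le ok_one (ok_hops hG)).ite
    (fun h => by rw [max_eq_left h]; exact ok_hops hG)
    (fun h => by rw [max_eq_right (by omega)]; exact ok_one)

theorem enc_pairs (l : List (List (Fin n) × ℕ)) : enc l = encodePairs l := by
  unfold encodePairs
  change Data.ofList (l.map enc) = _
  congr 1
  refine List.map_congr_left fun p _ => ?_
  change Data.pair (Data.ofList (p.1.map enc)) (enc p.2) = _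
  congr 2
  rw [show (p.1 >>= fun a => pure (a : ℕ)) = p.1.map fun a : Fin n => (a : ℕ) from
    List.flatMap_pure_eq_map _ _, List.map_map]
  rfl

end Program
end

open HierInstance Program in
theorem mainTheorem9 (γ : ℝ) (hγ : 0 < γ) :
    ∃ (A : Program) (C : ℝ), 0 < C ∧
      ∀ (n : ℕ) (I : HierInstance (Fin n)), I.LowDepth γ →
        ∃ (l : List (List (Fin n) × ℕ)) (t : ℕ),
          A.Runs I.encode (encodePairs l) t ∧
          (t : ℝ) ≤ (n : ℝ) ^ (C * Real.logb 2 n) ∧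
          I.IsSolution l.toFinset ∧
          I.weight l.toFinset ≤ C * Real.logb 2 n ^ 2 * I.opt := by
  obtain ⟨m, hm⟩ := exists_nat_ge γ
  obtain ⟨A, hA⟩ : ∃ A : Program, A = .seq (raisedP (.prim .id)) (greedyP (.prim .id)) := ⟨_, rfl⟩
  -- The constant is the sum of the one for the running time and the one for the ratio, each
  -- nonnegative; `A.expo` is a constant because `A` does not depend on the instance.
  refine ⟨A, (m + 4) * (2 * γ + 9) * (2 * A.expo) + 12 * (m + 3), by positivity,
    fun n I h => ?_⟩
  have hn := h.two_le
  have hlog := one_le_logb hn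
  have hk : 1 ≤ (I.raised hn).k := le_max_right _ _
  have hrun : Ok I.sizeBound A I.encode (encodePairs (I.raised hn).greedy) := by
    rw [hA]
    rw [← enc_pairs]
    exact (ok_raised hn (.prim .id _)).seq
      (ok_greedy ((I.raised hn).fits_sizeBound (by omega)) hk (.prim .id _))
  obtain ⟨t, ht, hruns⟩ := hrun
  refine ⟨(I.raised hn).greedy, t, hruns, ?_, isSolution_of_raised hn (greedy_spec hk).1, ?_⟩
  · refine ((Nat.cast_le.2 ht).trans (h.time_le hm A.expo)).trans
      (Real.rpow_le_rpow_of_exponent_le (by exact_mod_cast (by omega : 1 ≤ n)) ?_)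
    refine mul_le_mul_of_nonneg_right ?_ (by linarith)
    have : (0 : ℝ) ≤ 12 * (m + 3) := by positivity
    linarith
  · refine (raised_greedy_weight_le h hm).trans ?_
    refine mul_le_mul_of_nonneg_right (mul_le_mul_of_nonneg_right ?_ (sq_nonneg _)) I.opt_nonneg
    have : (0 : ℝ) ≤ (m + 4) * (2 * γ + 9) * (2 * A.expo) := by positivity
    linarith
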